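/- Let $\lambda,\mu\in\mathbb R$ satisfy $\mu>0$ and $2\mu+3\lambda>0$, let $\omega>0$, and let $\Delta^*\mathbf u=\mu\Delta\mathbf u+(\lambda+\mu)\nabla(\nabla\cdot\mathbf u)$ and $\mathcal T_\nu\mathbf u=\lambda(\nabla\cdot\mathbf u)\nu+2\mu(\nabla^s\mathbf u)\nu$ with $\nabla^s\mathbf u=\frac12(\nabla\mathbf u+\nabla\mathbf u^t)$. Let $-\pi<\theta_{\min}<\theta_{\max}<\pi$ with $\theta_{\max}-\theta_{\min}<\pi$, let $h,M>0$, and set $$S_h=\{(r\cos\theta,r\sin\theta):0<r<h,\ \theta_{\min}<\theta<\theta_{\max}\},$$ $$\Gamma_h^{+}=\{(r\cos\theta_{\max},r\sin\theta_{\max}):0<r<h\},\qquad \Gamma_h^{-}=\{(r\cos\theta_{\min},r\sin\theta_{\min}):0<r<h\}.$$ Let $\mathbf v,\mathbf w\in H^1(S_h\times(-M,M))^3$ be complex-valued and satisfy $$\begin{cases}\Delta^*\mathbf v+\omega^2\mathbf v=\mathbf 0,\quad \Delta^*\mathbf w+\omega^2\mathbf w=\mathbf 0 &\text{in } S_h\times(-M,M),\\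 \mathbf w-\mathbf v=\mathbf f_1,\quad \mathcal T_\nu\mathbf w-\mathcal T_\nu\mathbf v=\mathbf g_1&\text{on }\Gamma_h^+\times(-M,M),\\ \mathbf w-\mathbf v=\mathbf f_2,\quad \mathcal T_\nu\mathbf w-\mathcal T_\nu\mathbf v=\mathbf g_2&\text{on }\Gamma_h^-\times(-M,M),\end{cases}$$ where $\nu$ is the exterior unit normal, the equations hold in the weak sense, the displacement jumps are understood as Sobolev traces and the traction jumps as weak conormal derivatives. Assume $\mathbf f_1\in C^{1,\alpha_1}(\Gamma_h^+\times(-M,M))^3$, $\mathbf f_2\in C^{1,\alpha_2}(\Gamma_h^-\times(-M,M))^3$, $\mathbf g_1\in C^{\beta_1}(\Gamma_h^+\times(-M,M))^3$, $\mathbf g_2\in C^{\beta_2}(\Gamma_h^-\times(-M,M))^3$ with $\alpha_1,\alpha_2,\beta_1,\beta_2\in(0,1)$ (in particular $\mathbf f_i\in H^{1/2}$ and $\mathbf g_i\in L^2$), all independent of $x_3$; values and gradients at the edge point $\mathbf 0$ are those of the continuous extensions, and $\nabla\mathbf f_i$ denotes the tangential gradient on the face. Then $$\mathbf f_1(\mathbf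 0)=\mathbf f_2(\mathbf 0).$$ If moreover $\nabla\mathbf f_1(\mathbf 0)=\nabla\mathbf f_2(\mathbf 0)=\mathbf 0$, then, writing $\mathbf g_i=(\mathbf g_i^{(1,2)},g_i^3)^t$, $$\mathbf g_1^{(1,2)}(\mathbf 0)=\Theta\,\mathbf g_2^{(1,2)}(\mathbf 0)\quad\text{and}\quad g_1^3(\mathbf 0)=g_2^3(\mathbf 0)=0,$$ $$\Theta=\begin{bmatrix}-\cos(\theta_{\max}-\theta_{\min})&-\sin(\theta_{\max}-\theta_{\min})\\-\sin(\theta_{\max}-\theta_{\min})&\cos(\theta_{\max}-\theta_{\min})\end{bmatrix}.$$ -/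

import Mathlib

open Set Filter Topology MeasureTheory
open scoped NNReal ENNReal ContDiff

noncomputable section

namespace EdgeCorner

/-- Physical space `ℝ³` with its Euclidean metric; coordinates are numbered `0, 1, 2`. -/
abbrev E3 : Type := EuclideanSpace ℝ (Fin 3)

/-- The truncated wedge `S_h × (-M, M)`, where `S_h` is the open planar sector of radius `h`
between the polar angles `θmin` and `θmax`. -/
def wedge (θmin θmax h M : ℝ) : Set E3 :=
  {x | (∃ r ∈ Ioo 0 h, ∃ θ ∈ Ioo θmin θmax, x 0 = r * Real.cos θ ∧ x 1 = r * Real.sin θ) ∧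
    x 2 ∈ Ioo (-M) M}

/-- The point `(r cos θ, r sin θ, t)`, with `p = (r, t)`. For fixed `θ` this is an isometric
parametrization of a half-plane bounded by the `x₃`-axis. -/
def facePoint (θ : ℝ) (p : ℝ × ℝ) : E3 :=
  !₂[p.1 * Real.cos θ, p.1 * Real.sin θ, p.2]

/-- The open face `{(r cos θ, r sin θ) : 0 < r < h} × (-M, M)`. -/
def openFace (θ h M : ℝ) : Set E3 :=
  facePoint θ '' (Ioo 0 h ×ˢ Ioo (-M) M)

/-- The face together with the edge `r = 0`. Hölder functions on the open face extend uniquely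
to this set, and their values at the origin are those of the extension. -/
def face (θ h M : ℝ) : Set E3 :=
  facePoint θ '' (Ico 0 h ×ˢ Ioo (-M) M)

/-- Surface measure on the (flat) face. -/
def faceMeasure (θ h M : ℝ) : Measure E3 :=
  (volume.restrict (Ioo 0 h ×ˢ Ioo (-M) M)).map (facePoint θ)

/-- Jacobian matrix of a differentiable field: `jac φ x i j = ∂ⱼ φᵢ (x)`. -/
def jac (φ : E3 → Fin 3 → ℂ) (x : E3) (i j : Fin 3) : ℂ :=
  fderiv ℝ φ x (EuclideanSpace.single j 1) i

/-- `u ∈ H¹(D)³` with weak gradient `G`, `G x i j = ∂ⱼ uᵢ (x)`. -/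
structure IsH1 (D : Set E3) (u : E3 → Fin 3 → ℂ) (G : E3 → Fin 3 → Fin 3 → ℂ) : Prop where
  memLp : ∀ i, MemLp (fun x => u x i) 2 (volume.restrict D)
  memLp_grad : ∀ i j, MemLp (fun x => G x i j) 2 (volume.restrict D)
  weak_grad : ∀ i j, ∀ ψ : E3 → ℂ, ContDiff ℝ ∞ ψ → HasCompactSupport ψ → tsupport ψ ⊆ D →
    ∫ x in D, u x i * fderiv ℝ ψ x (EuclideanSpace.single j 1) = - ∫ x in D, G x i j * ψ x

/-- `Δ* u + freq² u = 0` in `D` in the sense of distributions, where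
`Δ* u = μ Δ u + (lam + μ) ∇ (∇ · u)` and `G` is the weak gradient of `u`. -/
def IsLameSolution (lam μ freq : ℝ) (D : Set E3) (u : E3 → Fin 3 → ℂ)
    (G : E3 → Fin 3 → Fin 3 → ℂ) : Prop :=
  ∀ φ : E3 → Fin 3 → ℂ, ContDiff ℝ ∞ φ → HasCompactSupport φ → tsupport φ ⊆ D →
    ∫ x in D, ((μ : ℂ) * ∑ i, ∑ j, G x i j * jac φ x i j
        + ((lam : ℂ) + μ) * ((∑ k, G x k k) * ∑ k, jac φ x k k)
        - (freq : ℂ) ^ 2 * ∑ i, u x i * φ x i) = 0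

/-- The Sobolev trace of `u ∈ H¹(D)³` (weak gradient `G`) on the face at angle `θ` is `f`:
some smooth fields converge to `u` in `H¹(D)` and to `f` in `L²` of the face. -/
def HasTraceOnFace (D : Set E3) (θ h M : ℝ) (u : E3 → Fin 3 → ℂ)
    (G : E3 → Fin 3 → Fin 3 → ℂ) (f : E3 → Fin 3 → ℂ) : Prop :=
  ∃ a : ℕ → E3 → Fin 3 → ℂ, (∀ n, ContDiff ℝ ∞ (a n)) ∧
    (∀ i, Tendsto (fun n => eLpNorm (fun x => a n x i - u x i) 2 (volume.restrict D))
      atTop (𝓝 0)) ∧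
    (∀ i j, Tendsto (fun n => eLpNorm (fun x => jac (a n) x i j - G x i j) 2
      (volume.restrict D)) atTop (𝓝 0)) ∧
    (∀ i, Tendsto (fun n => eLpNorm (fun x => a n x i - f x i) 2 (faceMeasure θ h M))
      atTop (𝓝 0))

/-- The elastic stress `σ = lam (∇ · u) I + 2 μ ∇ˢu` of a displacement with gradient `A`; the
traction on a surface with unit normal `ν` is `T_ν u = σ ν`. -/
def stress (lam μ : ℝ) (A : Fin 3 → Fin 3 → ℂ) (i j : Fin 3) : ℂ :=
  (lam : ℂ) * (∑ k, A k k) * (if i = j then 1 else 0) + (μ : ℂ) * (A i j + A j i)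

/-- The weak traction (conormal derivative, exterior normal) of a solution `u` of
`Δ* u + freq² u = 0` in `D`, paired with a test field `φ`:
`∫_{∂D} T_ν u · φ dσ = ∫_D (σ(u) : ∇φ - freq² u · φ) dx`. -/
def weakTraction (lam μ freq : ℝ) (D : Set E3) (u : E3 → Fin 3 → ℂ)
    (G : E3 → Fin 3 → Fin 3 → ℂ) (φ : E3 → Fin 3 → ℂ) : ℂ :=
  ∫ x in D, ((∑ i, ∑ j, stress lam μ (G x) i j * jac φ x i j)
    - (freq : ℂ) ^ 2 * ∑ i, u x i * φ x i)

/-- `T_ν w - T_ν v = g` on the open face at angle `θ`, in the weak sense: test fields are smooth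
with compact support meeting `∂D` only inside that open face. -/
def HasTractionJumpOnFace (lam μ freq : ℝ) (D : Set E3) (θ h M : ℝ)
    (v : E3 → Fin 3 → ℂ) (Gv : E3 → Fin 3 → Fin 3 → ℂ)
    (w : E3 → Fin 3 → ℂ) (Gw : E3 → Fin 3 → Fin 3 → ℂ) (g : E3 → Fin 3 → ℂ) : Prop :=
  ∀ φ : E3 → Fin 3 → ℂ, ContDiff ℝ ∞ φ → HasCompactSupport φ →
    tsupport φ ∩ frontier D ⊆ openFace θ h M →
    weakTraction lam μ freq D w Gw φ - weakTraction lam μ freq D v Gv φ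
      = ∫ x, ∑ i, g x i * φ x i ∂(faceMeasure θ h M)

/-- `g ∈ C^β` on the set `s`. On a bounded `s` the Hölder bound implies boundedness. -/
def IsHolder (β : ℝ≥0) (s : Set E3) (g : E3 → Fin 3 → ℂ) : Prop :=
  ∃ C : ℝ≥0, HolderOnWith C β g s

/-- `f ∈ C^{1,α}` on the (flat) face `s`: `f` is differentiable within `s` with an `α`-Hölder
derivative. Only the tangential part of the derivative is determined by `f`. -/
def IsC1Holder (α : ℝ≥0) (s : Set E3) (f : E3 → Fin 3 → ℂ) : Prop :=
  ∃ Df : E3 → (E3 →L[ℝ] (Fin 3 → ℂ)),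
    (∀ x ∈ s, HasFDerivWithinAt f (Df x) s x) ∧ ∃ C : ℝ≥0, HolderOnWith C α Df s

/-- `f` does not depend on `x₃` on `s`. -/
def IndepOfX3 (s : Set E3) (f : E3 → Fin 3 → ℂ) : Prop :=
  ∀ x ∈ s, ∀ y ∈ s, x 0 = y 0 → x 1 = y 1 → f x = f y

/-- The (tangential) gradient of `f` along the flat face `s` vanishes at the origin. -/
def GradVanishesAtZero (s : Set E3) (f : E3 → Fin 3 → ℂ) : Prop :=
  HasFDerivWithinAt f (0 : E3 →L[ℝ] (Fin 3 → ℂ)) s 0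

/-- The matrix `Θ` for the opening angle `θ`. -/
def Theta (θ : ℝ) : Matrix (Fin 2) (Fin 2) ℂ :=
  !![-(Real.cos θ : ℂ), -(Real.sin θ : ℂ); -(Real.sin θ : ℂ), (Real.cos θ : ℂ)]

end EdgeCorner

end

namespace EdgeCorner

/-! Put `u = w - v`, an `H¹` field on the wedge whose trace on the faces is `fᵢ` and whose weak
traction is `gᵢ`. Everything is tested with `ξ(x) E(s x)`, where `ξ` is a cutoff at the origin and
`E` is independent of `x₃` and decays exponentially in the wedge, and then `s → ∞`. Such a function
lives within distance about `1/s` of the edge, a region of volume `s⁻²`. An `L²` function therefore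
pairs with it to `o(1/s)` (`tendsto_mul_integral_dilate`), whereas a face integral of continuous
data is asymptotic to `1/s` times the edge value times a ray integral of `E`
(`tendsto_mul_integral_face`). Hence only edge values of the data and first derivatives of `E`
survive (`HasWeakFlux.tendsto`). The weak traction conditions allow only test functions vanishing
near the edge; `hasWeakFlux_of_faces` removes this because the edge has zero `H¹` capacity.

For the traces, `∂₀u` is tested with `∂₁E` and `∂₁u` with `∂₀E`. The volume terms coincide since
derivatives commute. The difference of the boundary terms is the tangential derivative of `E`
integrated along the two rays in opposite senses, a nonzero multiple of `f₁(0) - f₂(0)`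
(`trace_eq_at_edge`).

For the tractions, `f₁(0)` is subtracted from `u`, so that vanishing gradients make the displacement
data `o(r)`. If `E` is a displacement in static equilibrium, Betti's reciprocity moves the stress
from `u` to `E`; what remains involves only displacement data and is of lower order, as is the
frequency term. So the edge tractions are orthogonal to the ray integrals of every such `E`
(`sum_traction_eq_zero`). With `z = x₀ ± i x₁`, the fields built from `exp(-ρ z)`, namely antiplane,
planar divergence free and Kolosov type, yield six linear equations for the six components of
`g₁(0)` and `g₂(0)`. The system is nonsingular (`traction_eq_zero`), so both tractions vanish at the
edge, which implies the relation with `Theta`. -/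

variable {θmin θmax h M δ : ℝ}

/-! ### Oblique coordinates and the geometry of the wedge. -/

/-- First oblique coordinate: `x = p e₊ + q e₋ + x₃ e₃` where `e₊`, `e₋` are the unit vectors at
the angles `θmax`, `θmin`. -/
noncomputable def obliqueP (θmin θmax : ℝ) : E3 →L[ℝ] ℝ :=
  (Real.sin (θmax - θmin))⁻¹ • (Real.cos θmin • EuclideanSpace.proj (1 : Fin 3)
    - Real.sin θmin • EuclideanSpace.proj (0 : Fin 3))

/-- Second oblique coordinate. -/
noncomputable def obliqueQ (θmin θmax : ℝ) : E3 →L[ℝ] ℝ :=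
  (Real.sin (θmax - θmin))⁻¹ • (Real.sin θmax • EuclideanSpace.proj (0 : Fin 3)
    - Real.cos θmax • EuclideanSpace.proj (1 : Fin 3))

theorem obliqueP_apply (θmin θmax : ℝ) (x : E3) : obliqueP θmin θmax x =
    (Real.sin (θmax - θmin))⁻¹ * (Real.cos θmin * x 1 - Real.sin θmin * x 0) := by
  simp [obliqueP]

theorem obliqueQ_apply (θmin θmax : ℝ) (x : E3) : obliqueQ θmin θmax x =
    (Real.sin (θmax - θmin))⁻¹ * (Real.sin θmax * x 0 - Real.cos θmax * x 1) := by
  simp [obliqueQ]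

/-- The oblique coordinate system. -/
noncomputable def oblique (θmin θmax : ℝ) (hs : Real.sin (θmax - θmin) ≠ 0) :
    (ℝ × ℝ × ℝ) ≃L[ℝ] E3 :=
  LinearEquiv.toContinuousLinearEquiv
    { toFun := fun a => !₂[a.1 * Real.cos θmax + a.2.1 * Real.cos θmin,
        a.1 * Real.sin θmax + a.2.1 * Real.sin θmin, a.2.2]
      map_add' := by
        intro a b; ext i; fin_cases i <;> simp <;> ring
      map_smul' := by
        intro a b; ext i; fin_cases i <;> simp <;> ring
      invFun := fun x => (obliqueP θmin θmax x, obliqueQ θmin θmax x, x 2)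
      left_inv := by
        intro a
        ext
        · simp [obliqueP_apply]
          field_simp
          rw [Real.sin_sub]; ring
        · simp [obliqueQ_apply]
          field_simp
          rw [Real.sin_sub]; ring
        · simp
      right_inv := by
        intro x
        ext i
        fin_cases i
        · simp [obliqueP_apply, obliqueQ_apply]
          field_simp
          rw [Real.sin_sub]; ring
        · simp [obliqueP_apply, obliqueQ_apply]
          field_simp
          rw [Real.sin_sub]; ring
        · simp }


theorem oblique_apply (hs : Real.sin (θmax - θmin) ≠ 0) (a : ℝ × ℝ × ℝ) :
    oblique θmin θmax hs a = !₂[a.1 * Real.cos θmax + a.2.1 * Real.cos θmin,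
        a.1 * Real.sin θmax + a.2.1 * Real.sin θmin, a.2.2] := rfl

theorem oblique_symm_apply (hs : Real.sin (θmax - θmin) ≠ 0) (x : E3) :
    (oblique θmin θmax hs).symm x = (obliqueP θmin θmax x, obliqueQ θmin θmax x, x 2) := rfl

theorem obliqueP_oblique (hs : Real.sin (θmax - θmin) ≠ 0) (a : ℝ × ℝ × ℝ) :
    obliqueP θmin θmax (oblique θmin θmax hs a) = a.1 :=
  congrArg Prod.fst ((oblique θmin θmax hs).symm_apply_apply a)

theorem obliqueQ_oblique (hs : Real.sin (θmax - θmin) ≠ 0) (a : ℝ × ℝ × ℝ) :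
    obliqueQ θmin θmax (oblique θmin θmax hs a) = a.2.1 :=
  congrArg (fun b => b.2.1) ((oblique θmin θmax hs).symm_apply_apply a)

theorem facePoint_max_eq (hs : Real.sin (θmax - θmin) ≠ 0) (p : ℝ × ℝ) :
    facePoint θmax p = oblique θmin θmax hs (p.1, 0, p.2) := by
  simp [facePoint, oblique_apply]

theorem facePoint_min_eq (hs : Real.sin (θmax - θmin) ≠ 0) (p : ℝ × ℝ) :
    facePoint θmin p = oblique θmin θmax hs (0, p.1, p.2) := by
  simp [facePoint, oblique_apply]

/-- The infinite wedge. -/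
def cone (θmin θmax : ℝ) : Set E3 := {x | 0 < obliqueP θmin θmax x ∧ 0 < obliqueQ θmin θmax x}

theorem isOpen_cone : IsOpen (cone θmin θmax) :=
  (isOpen_lt continuous_const (obliqueP θmin θmax).continuous).inter
    (isOpen_lt continuous_const (obliqueQ θmin θmax).continuous)

/-- An opening below `π` makes the sector an intersection of two half-planes. Linear inequalities
then give openness, boundary points and the reduction of integrals to an octant. -/
theorem wedge_eq (hθ : θmin < θmax) (hangle : θmax - θmin < Real.pi) (hh : 0 < h) :
    wedge θmin θmax h M = cone θmin θmax ∩
      ({x | x 0 ^ 2 + x 1 ^ 2 < h ^ 2} ∩ {x | x 2 ∈ Ioo (-M) M}) := by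
  have hs : 0 < Real.sin (θmax - θmin) := Real.sin_pos_of_pos_of_lt_pi (by linarith) hangle
  ext x
  simp only [wedge, cone, obliqueP_apply, obliqueQ_apply, mem_ofPred_eq, mem_inter_iff]
  constructor
  · rintro ⟨⟨r, ⟨hr0, hrh⟩, θ, ⟨h1, h2⟩, hx0, hx1⟩, hx2⟩
    have e1 : Real.cos θmin * x 1 - Real.sin θmin * x 0 = r * Real.sin (θ - θmin) := by
      rw [hx0, hx1, Real.sin_sub]; ring
    have e2 : Real.sin θmax * x 0 - Real.cos θmax * x 1 = r * Real.sin (θmax - θ) := by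
      rw [hx0, hx1, Real.sin_sub]; ring
    have p1 : 0 < Real.sin (θ - θmin) :=
      Real.sin_pos_of_pos_of_lt_pi (by linarith) (by linarith)
    have p2 : 0 < Real.sin (θmax - θ) :=
      Real.sin_pos_of_pos_of_lt_pi (by linarith) (by linarith)
    refine ⟨⟨?_, ?_⟩, ?_, hx2⟩
    · rw [e1]; positivity
    · rw [e2]; positivity
    · rw [hx0, hx1]
      have : (r * Real.cos θ) ^ 2 + (r * Real.sin θ) ^ 2 = r ^ 2 := by
        linear_combination r ^ 2 * Real.cos_sq_add_sin_sq θ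
      rw [this]
      exact pow_lt_pow_left₀ hrh hr0.le two_ne_zero
  · rintro ⟨⟨hp, hq⟩, hr, hx2⟩
    refine ⟨?_, hx2⟩
    have hp' : 0 < Real.cos θmin * x 1 - Real.sin θmin * x 0 :=
      pos_of_mul_pos_right hp (inv_pos.2 hs).le
    have hq' : 0 < Real.sin θmax * x 0 - Real.cos θmax * x 1 :=
      pos_of_mul_pos_right hq (inv_pos.2 hs).le
    -- `ζ` is `x₀ + i x₁` rotated by `-θmin`. The sector then becomes `0 < arg < θmax - θmin < π`,
    -- away from the branch cut of `Complex.arg`.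
    set ζ : ℂ := ⟨x 0 * Real.cos θmin + x 1 * Real.sin θmin,
      Real.cos θmin * x 1 - Real.sin θmin * x 0⟩ with hζ
    have hζ0 : ζ ≠ 0 := fun h0 => by
      have : ζ.im = 0 := by rw [h0]; rfl
      exact hp'.ne' this
    have hnorm : ‖ζ‖ ^ 2 = x 0 ^ 2 + x 1 ^ 2 := by
      rw [Complex.sq_norm, Complex.normSq_apply]
      simp only [hζ]
      linear_combination (x 0 ^ 2 + x 1 ^ 2) * Real.cos_sq_add_sin_sq θmin
    have hre : ‖ζ‖ * Real.cos ζ.arg = x 0 * Real.cos θmin + x 1 * Real.sin θmin :=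
      Complex.norm_mul_cos_arg ζ
    have him : ‖ζ‖ * Real.sin ζ.arg = Real.cos θmin * x 1 - Real.sin θmin * x 0 :=
      Complex.norm_mul_sin_arg ζ
    have hpos : 0 < ‖ζ‖ := norm_pos_iff.2 hζ0
    have hsin : 0 < Real.sin ζ.arg := pos_of_mul_pos_right (him ▸ hp') hpos.le
    have harg0 : 0 < ζ.arg := by
      by_contra hneg
      have := Real.sin_nonpos_of_nonpos_of_neg_pi_le (not_lt.1 hneg) (Complex.neg_pi_lt_arg ζ).le
      linarith
    have hsin2 : ‖ζ‖ * Real.sin (θmax - θmin - ζ.arg)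
        = Real.sin θmax * x 0 - Real.cos θmax * x 1 := by
      rw [Real.sin_sub, mul_sub, ← mul_assoc, ← mul_assoc, mul_comm ‖ζ‖, mul_comm ‖ζ‖, mul_assoc,
        mul_assoc, hre, him, Real.sin_sub, Real.cos_sub]
      linear_combination (Real.sin θmax * x 0 - Real.cos θmax * x 1) *
        Real.cos_sq_add_sin_sq θmin
    have hsin3 : 0 < Real.sin (θmax - θmin - ζ.arg) :=
      pos_of_mul_pos_right (hsin2 ▸ hq') hpos.le
    have harg1 : ζ.arg < θmax - θmin := by
      by_contra hneg
      have := Real.sin_nonpos_of_nonpos_of_neg_pi_le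
        (x := θmax - θmin - ζ.arg) (by linarith) (by linarith [Complex.arg_le_pi ζ])
      linarith
    refine ⟨‖ζ‖, ⟨hpos, ?_⟩, θmin + ζ.arg, ⟨by linarith, by linarith⟩, ?_, ?_⟩
    · exact lt_of_pow_lt_pow_left₀ 2 hh.le (by rw [hnorm]; exact hr)
    · rw [Real.cos_add]
      linear_combination (-Real.cos θmin) * hre + Real.sin θmin * him
        - x 0 * Real.cos_sq_add_sin_sq θmin
    · rw [Real.sin_add]
      linear_combination (-Real.sin θmin) * hre - Real.cos θmin * him
        - x 1 * Real.cos_sq_add_sin_sq θmin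

theorem isOpen_wedge (hθ : θmin < θmax) (hangle : θmax - θmin < Real.pi) (hh : 0 < h) :
    IsOpen (wedge θmin θmax h M) := by
  rw [wedge_eq hθ hangle hh]
  refine isOpen_cone.inter (IsOpen.inter ?_ ?_)
  · exact isOpen_lt (by fun_prop) continuous_const
  · exact isOpen_Ioo.preimage (by fun_prop)

theorem wedge_subset_cone (hθ : θmin < θmax) (hangle : θmax - θmin < Real.pi) (hh : 0 < h) :
    wedge θmin θmax h M ⊆ cone θmin θmax := by
  rw [wedge_eq hθ hangle hh]; exact inter_subset_left

theorem norm_sq_eq (x : E3) : ‖x‖ ^ 2 = x 0 ^ 2 + x 1 ^ 2 + x 2 ^ 2 := by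
  rw [EuclideanSpace.norm_sq_eq, Fin.sum_univ_three]; simp

theorem wedge_subset_ball (hθ : θmin < θmax) (hangle : θmax - θmin < Real.pi) (hh : 0 < h) :
    wedge θmin θmax h M ⊆ Metric.ball 0 (h + |M|) := by
  rw [wedge_eq hθ hangle hh]
  rintro x ⟨-, hx, h1, h2⟩
  rw [mem_ball_zero_iff]
  refine lt_of_pow_lt_pow_left₀ 2 (by positivity) ?_
  rw [norm_sq_eq]
  simp only [mem_ofPred_eq] at hx
  have h3 : x 2 ^ 2 ≤ |M| ^ 2 := by
    rw [← sq_abs (x 2)]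
    exact pow_le_pow_left₀ (abs_nonneg _) (by rw [abs_le]; constructor <;> linarith [le_abs_self M]) 2
  nlinarith [abs_nonneg M]

theorem volume_wedge_lt_top (hθ : θmin < θmax) (hangle : θmax - θmin < Real.pi) (hh : 0 < h) :
    volume (wedge θmin θmax h M) < ⊤ :=
  (measure_mono (wedge_subset_ball hθ hangle hh)).trans_lt measure_ball_lt_top

theorem mem_wedge_of_mem_cone (hθ : θmin < θmax) (hangle : θmax - θmin < Real.pi) (hh : 0 < h)
    {x : E3} (hx : x ∈ cone θmin θmax) (hxh : ‖x‖ < h) (hxM : ‖x‖ < M) :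
    x ∈ wedge θmin θmax h M := by
  rw [wedge_eq hθ hangle hh]
  have h0 := norm_sq_eq x
  refine ⟨hx, ?_, ?_⟩
  · simp only [mem_ofPred_eq]
    nlinarith [sq_nonneg (x 2), norm_nonneg x]
  · have : |x 2| ≤ ‖x‖ := by
      simpa using EuclideanSpace.norm_eq x ▸ PiLp.norm_apply_le x 2
    exact abs_lt.1 (this.trans_lt hxM)

theorem frontier_wedge (hθ : θmin < θmax) (hangle : θmax - θmin < Real.pi) (hh : 0 < h)
    {x : E3} (hx : x ∈ frontier (wedge θmin θmax h M)) (hxh : ‖x‖ < h) (hxM : ‖x‖ < M) :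
    0 ≤ obliqueP θmin θmax x ∧ 0 ≤ obliqueQ θmin θmax x ∧
      (obliqueP θmin θmax x = 0 ∨ obliqueQ θmin θmax x = 0) := by
  have hcl : x ∈ {x | 0 ≤ obliqueP θmin θmax x} ∩ {x | 0 ≤ obliqueQ θmin θmax x} := by
    refine closure_minimal (s := wedge θmin θmax h M) ?_ ?_ hx.1
    · intro y hy
      exact ⟨(wedge_subset_cone hθ hangle hh hy).1.le, (wedge_subset_cone hθ hangle hh hy).2.le⟩
    · exact (isClosed_le continuous_const (obliqueP θmin θmax).continuous).inter
        (isClosed_le continuous_const (obliqueQ θmin θmax).continuous)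
  refine ⟨hcl.1, hcl.2, ?_⟩
  by_contra! hne
  apply hx.2
  rw [(isOpen_wedge hθ hangle hh).interior_eq]
  exact mem_wedge_of_mem_cone hθ hangle hh
    ⟨lt_of_le_of_ne hcl.1 hne.1.symm, lt_of_le_of_ne hcl.2 hne.2.symm⟩ hxh hxM

/-- Lebesgue measure in oblique coordinates, up to a positive constant. -/
theorem exists_volume_eq_map_oblique (hs : Real.sin (θmax - θmin) ≠ 0) :
    ∃ c : ℝ≥0, 0 < c ∧ (volume : Measure E3) =
      c • (volume : Measure (ℝ × ℝ × ℝ)).map (oblique θmin θmax hs) := by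
  have : (volume : Measure (ℝ × ℝ)).IsAddHaarMeasure := Measure.prod.instIsAddHaarMeasure _ _
  have : (volume : Measure (ℝ × ℝ × ℝ)).IsAddHaarMeasure :=
    Measure.prod.instIsAddHaarMeasure _ _
  have : ((volume : Measure (ℝ × ℝ × ℝ)).map (oblique θmin θmax hs)).IsAddHaarMeasure :=
    (oblique θmin θmax hs).isAddHaarMeasure_map _
  -- Uniqueness of Haar measure. Only positivity of the factor matters, since it multiplies the
  -- terms of both faces alike.
  refine ⟨_, ?_, Measure.isAddLeftInvariant_eq_smul (volume : Measure E3)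
    ((volume : Measure (ℝ × ℝ × ℝ)).map (oblique θmin θmax hs))⟩
  exact Measure.addHaarScalarFactor_pos_of_isAddHaarMeasure _ _

theorem continuous_facePoint (θ : ℝ) : Continuous (facePoint θ) := by
  unfold facePoint
  apply (PiLp.continuous_toLp 2 _).comp
  refine continuous_pi fun i => ?_
  fin_cases i <;> simp <;> fun_prop

theorem norm_facePoint_sq (θ : ℝ) (p : ℝ × ℝ) : ‖facePoint θ p‖ ^ 2 = p.1 ^ 2 + p.2 ^ 2 := by
  rw [norm_sq_eq]
  simp [facePoint]
  linear_combination p.1 ^ 2 * Real.cos_sq_add_sin_sq θ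

theorem injective_facePoint (θ : ℝ) : Function.Injective (facePoint θ) := by
  intro p q hpq
  have h0 := congrArg (fun x : E3 => x 0) hpq
  have h1 := congrArg (fun x : E3 => x 1) hpq
  have h2 := congrArg (fun x : E3 => x 2) hpq
  simp only [facePoint, PiLp.toLp_apply, Matrix.cons_val_zero, Matrix.cons_val_one,
    Matrix.cons_val] at h0 h1 h2
  ext
  · linear_combination Real.cos θ * h0 + Real.sin θ * h1
      - (p.1 - q.1) * Real.cos_sq_add_sin_sq θ
  · exact h2

theorem measurableEmbedding_facePoint (θ : ℝ) : MeasurableEmbedding (facePoint θ) :=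
  (continuous_facePoint θ).measurableEmbedding (injective_facePoint θ)

theorem integral_faceMeasure (θ h M : ℝ) (F : E3 → ℂ) :
    ∫ x, F x ∂faceMeasure θ h M = ∫ p in Ioo 0 h ×ˢ Ioo (-M) M, F (facePoint θ p) :=
  (measurableEmbedding_facePoint θ).integral_map F

theorem integrable_faceMeasure_iff {θ h M : ℝ} {F : E3 → ℂ} :
    Integrable F (faceMeasure θ h M) ↔
      IntegrableOn (fun p => F (facePoint θ p)) (Ioo 0 h ×ˢ Ioo (-M) M) :=
  (measurableEmbedding_facePoint θ).integrable_map_iff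

instance isFiniteMeasure_faceMeasure (θ h M : ℝ) : IsFiniteMeasure (faceMeasure θ h M) := by
  have : IsFiniteMeasure ((volume : Measure (ℝ × ℝ)).restrict (Ioo 0 h ×ˢ Ioo (-M) M)) := by
    refine ⟨?_⟩
    rw [Measure.restrict_apply_univ, Measure.volume_eq_prod, Measure.prod_prod]
    simp [ENNReal.mul_lt_top]
  unfold faceMeasure
  infer_instance

/-! ### The divergence theorem on the wedge. -/

theorem integrable_of_contDiff_fderiv {Ψ : ℝ × ℝ × ℝ → ℂ} (hΨ : ContDiff ℝ 1 Ψ)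
    (hc : HasCompactSupport Ψ) (e : ℝ × ℝ × ℝ) : Integrable fun a => fderiv ℝ Ψ a e := by
  refine Continuous.integrable_of_hasCompactSupport ?_ (hc.fderiv_apply ℝ e)
  exact (hΨ.continuous_fderiv one_ne_zero).clm_apply continuous_const

theorem integral_octant_fderiv_fst {Ψ : ℝ × ℝ × ℝ → ℂ} (hΨ : ContDiff ℝ 1 Ψ)
    (hc : HasCompactSupport Ψ) :
    ∫ a in Ioi (0 : ℝ) ×ˢ (Ioi (0 : ℝ) ×ˢ (univ : Set ℝ)), fderiv ℝ Ψ a (1, 0, 0)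
      = - ∫ b in Ioi (0 : ℝ) ×ˢ (univ : Set ℝ), Ψ (0, b.1, b.2) := by
  have hint := integrable_of_contDiff_fderiv hΨ hc (1, 0, 0)
  have hint' := hint.integrableOn (s := Ioi (0 : ℝ) ×ˢ (Ioi (0 : ℝ) ×ˢ (univ : Set ℝ)))
  rw [IntegrableOn, Measure.volume_eq_prod, ← Measure.prod_restrict] at hint'
  rw [Measure.volume_eq_prod, ← Measure.prod_restrict, integral_prod_symm _ hint', ← integral_neg]
  congr 1 with b
  have hline : ContDiff ℝ 1 fun p : ℝ => Ψ (p, b) := hΨ.comp (contDiff_id.prodMk contDiff_const)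
  have hcl : HasCompactSupport fun p : ℝ => Ψ (p, b) :=
    hc.comp_isClosedEmbedding (Isometry.isClosedEmbedding fun p q => by simp [Prod.edist_eq])
  rw [← hcl.integral_Ioi_deriv_eq hline 0]
  congr 1 with p
  have h1 : HasDerivAt (fun p : ℝ => (p, b)) ((1 : ℝ), ((0 : ℝ), (0 : ℝ))) p :=
    (hasDerivAt_id p).prodMk (hasDerivAt_const p b)
  exact (((hΨ.differentiable one_ne_zero (p, b)).hasFDerivAt.comp_hasDerivAt p h1).deriv).symm

theorem integral_octant_fderiv_snd {Ψ : ℝ × ℝ × ℝ → ℂ} (hΨ : ContDiff ℝ 1 Ψ)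
    (hc : HasCompactSupport Ψ) :
    ∫ a in Ioi (0 : ℝ) ×ˢ (Ioi (0 : ℝ) ×ˢ (univ : Set ℝ)), fderiv ℝ Ψ a (0, 1, 0)
      = - ∫ b in Ioi (0 : ℝ) ×ˢ (univ : Set ℝ), Ψ (b.1, 0, b.2) := by
  let σ : (ℝ × ℝ × ℝ) ≃L[ℝ] (ℝ × ℝ × ℝ) :=
    LinearEquiv.toContinuousLinearEquiv
      { toFun := fun a => (a.2.1, a.1, a.2.2)
        map_add' := fun _ _ => rfl
        map_smul' := fun _ _ => rfl
        invFun := fun a => (a.2.1, a.1, a.2.2)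
        left_inv := fun _ => rfl
        right_inv := fun _ => rfl }
  have hσ : MeasurePreserving σ := by
    have h1 : MeasurePreserving (MeasurableEquiv.prodAssoc (α := ℝ) (β := ℝ) (γ := ℝ)) :=
      volume_preserving_prodAssoc
    have h2 : MeasurePreserving (Prod.map (Prod.swap : ℝ × ℝ → ℝ × ℝ) (id : ℝ → ℝ)) :=
      (Measure.measurePreserving_swap (μ := (volume : Measure ℝ)) (ν := (volume : Measure ℝ))).prod
        (MeasurePreserving.id (volume : Measure ℝ))
    exact h1.comp (h2.comp h1.symm)
  have hme : MeasurableEmbedding σ := σ.toHomeomorph.measurableEmbedding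
  have hpre : σ ⁻¹' (Ioi (0 : ℝ) ×ˢ (Ioi (0 : ℝ) ×ˢ (univ : Set ℝ)))
      = Ioi (0 : ℝ) ×ˢ (Ioi (0 : ℝ) ×ˢ (univ : Set ℝ)) := by
    ext a
    simp [σ, mem_prod]
    tauto
  rw [← hσ.setIntegral_preimage_emb hme, hpre]
  have := integral_octant_fderiv_fst (Ψ := Ψ ∘ σ) (hΨ.comp σ.contDiff)
    (hc.comp_isClosedEmbedding σ.toHomeomorph.isClosedEmbedding)
  refine Eq.trans ?_ this
  congr 1 with a
  rw [σ.comp_right_fderiv]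
  rfl

theorem integral_octant_fderiv_trd {Ψ : ℝ × ℝ × ℝ → ℂ} (hΨ : ContDiff ℝ 1 Ψ)
    (hc : HasCompactSupport Ψ) :
    ∫ a in Ioi (0 : ℝ) ×ˢ (Ioi (0 : ℝ) ×ˢ (univ : Set ℝ)), fderiv ℝ Ψ a (0, 0, 1) = 0 := by
  have hint := integrable_of_contDiff_fderiv hΨ hc (0, 0, 1)
  have hind : ∫ a in Ioi (0 : ℝ) ×ˢ (Ioi (0 : ℝ) ×ˢ (univ : Set ℝ)), fderiv ℝ Ψ a (0, 0, 1)
      = ∫ b in (Ioi (0 : ℝ) ×ˢ Ioi (0 : ℝ)) ×ˢ (univ : Set ℝ),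
        fderiv ℝ Ψ (b.1.1, b.1.2, b.2) (0, 0, 1) := by
    have h1 : MeasurePreserving (MeasurableEquiv.prodAssoc (α := ℝ) (β := ℝ) (γ := ℝ)) :=
      volume_preserving_prodAssoc
    rw [← h1.setIntegral_preimage_emb (MeasurableEquiv.measurableEmbedding _)]
    congr 2
    ext a
    simp [mem_prod, MeasurableEquiv.prodAssoc]
  have h1 : MeasurePreserving (MeasurableEquiv.prodAssoc (α := ℝ) (β := ℝ) (γ := ℝ)) :=
    volume_preserving_prodAssoc
  have hint' : Integrable fun b : (ℝ × ℝ) × ℝ => fderiv ℝ Ψ (b.1.1, b.1.2, b.2) (0, 0, 1) :=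
    (h1.integrable_comp_emb (MeasurableEquiv.measurableEmbedding _)).2 hint
  rw [hind, Measure.volume_eq_prod, setIntegral_prod _ (by
    rw [← Measure.volume_eq_prod]; exact hint'.integrableOn)]
  rw [integral_eq_zero_of_ae]
  refine Eventually.of_forall fun b => ?_
  simp only [Measure.restrict_univ, Pi.zero_apply]
  have hemb : IsClosedEmbedding fun t : ℝ => (b.1, b.2, t) :=
    Isometry.isClosedEmbedding fun t u => by simp [Prod.edist_eq]
  have hcl : HasCompactSupport fun t : ℝ => Ψ (b.1, b.2, t) := hc.comp_isClosedEmbedding hemb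
  have hline : ContDiff ℝ 1 fun t : ℝ => Ψ (b.1, b.2, t) :=
    hΨ.comp (contDiff_const.prodMk (contDiff_const.prodMk contDiff_id))
  have hd : ∀ t, HasDerivAt (fun t : ℝ => Ψ (b.1, b.2, t))
      (fderiv ℝ Ψ (b.1, b.2, t) (0, 0, 1)) t := fun t => by
    have h1 : HasDerivAt (fun t : ℝ => (b.1, b.2, t)) ((0 : ℝ), ((0 : ℝ), (1 : ℝ))) t :=
      (hasDerivAt_const t b.1).prodMk ((hasDerivAt_const t b.2).prodMk (hasDerivAt_id t))
    exact (hΨ.differentiable one_ne_zero _).hasFDerivAt.comp_hasDerivAt t h1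
  have hi : Integrable fun t : ℝ => fderiv ℝ Ψ (b.1, b.2, t) (0, 0, 1) := by
    have : (fun t : ℝ => fderiv ℝ Ψ (b.1, b.2, t) (0, 0, 1))
        = deriv fun t : ℝ => Ψ (b.1, b.2, t) := funext fun t => (hd t).deriv.symm
    rw [this]
    exact (hline.continuous_deriv le_rfl).integrable_of_hasCompactSupport hcl.deriv
  have hzero := hcl.is_zero_at_infty
  rw [cocompact_eq_atBot_atTop] at hzero
  have := integral_of_hasDerivAt_of_tendsto hd hi
    (hzero.mono_left le_sup_left) (hzero.mono_left le_sup_right)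
  simpa using this

/-- The direction is split along the axes. The octant is a full line in the third variable, so that
component contributes nothing. -/
theorem integral_octant_fderiv {Ψ : ℝ × ℝ × ℝ → ℂ} (hΨ : ContDiff ℝ 1 Ψ)
    (hc : HasCompactSupport Ψ) (e : ℝ × ℝ × ℝ) :
    ∫ a in Ioi (0 : ℝ) ×ˢ (Ioi (0 : ℝ) ×ˢ (univ : Set ℝ)), fderiv ℝ Ψ a e
      = - (e.1 : ℂ) * (∫ b in Ioi (0 : ℝ) ×ˢ (univ : Set ℝ), Ψ (0, b.1, b.2))
        - (e.2.1 : ℂ) * ∫ b in Ioi (0 : ℝ) ×ˢ (univ : Set ℝ), Ψ (b.1, 0, b.2) := by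
  have he : e = e.1 • ((1 : ℝ), (0 : ℝ), (0 : ℝ)) + e.2.1 • ((0 : ℝ), (1 : ℝ), (0 : ℝ))
      + e.2.2 • ((0 : ℝ), (0 : ℝ), (1 : ℝ)) := by
    ext <;> simp
  have hd : ∀ a, fderiv ℝ Ψ a e = (e.1 : ℂ) * fderiv ℝ Ψ a (1, 0, 0)
      + (e.2.1 : ℂ) * fderiv ℝ Ψ a (0, 1, 0) + (e.2.2 : ℂ) * fderiv ℝ Ψ a (0, 0, 1) := fun a => by
    conv_lhs => rw [he]
    rw [map_add, map_add, map_smul, map_smul, map_smul]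
    simp only [Complex.real_smul]
  have i1 := ((integrable_of_contDiff_fderiv hΨ hc (1, 0, 0)).const_mul (e.1 : ℂ)).integrableOn
    (s := Ioi (0 : ℝ) ×ˢ (Ioi (0 : ℝ) ×ˢ (univ : Set ℝ)))
  have i2 := ((integrable_of_contDiff_fderiv hΨ hc (0, 1, 0)).const_mul (e.2.1 : ℂ)).integrableOn
    (s := Ioi (0 : ℝ) ×ˢ (Ioi (0 : ℝ) ×ˢ (univ : Set ℝ)))
  have i3 := ((integrable_of_contDiff_fderiv hΨ hc (0, 0, 1)).const_mul (e.2.2 : ℂ)).integrableOn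
    (s := Ioi (0 : ℝ) ×ˢ (Ioi (0 : ℝ) ×ˢ (univ : Set ℝ)))
  simp only [hd]
  rw [integral_add (by exact i1.add i2) i3, integral_add i1 i2, integral_const_mul, integral_const_mul,
    integral_const_mul, integral_octant_fderiv_fst hΨ hc, integral_octant_fderiv_snd hΨ hc,
    integral_octant_fderiv_trd hΨ hc]
  ring

/-- Change to oblique coordinates in set integrals. -/
theorem setIntegral_oblique (hs : Real.sin (θmax - θmin) ≠ 0) {c : ℝ≥0}
    (hc : (volume : Measure E3) = c • (volume : Measure (ℝ × ℝ × ℝ)).map (oblique θmin θmax hs))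
    {V : Type*} [NormedAddCommGroup V] [NormedSpace ℝ V] (S : Set E3) (F : E3 → V) :
    ∫ x in S, F x = (c : ℝ) • ∫ a in oblique θmin θmax hs ⁻¹' S, F (oblique θmin θmax hs a) := by
  have hme : MeasurableEmbedding (oblique θmin θmax hs) :=
    (oblique θmin θmax hs).toHomeomorph.measurableEmbedding
  conv_lhs => rw [hc]
  rw [Measure.restrict_smul, integral_smul_nnreal_measure, hme.setIntegral_map]
  rfl

theorem oblique_preimage_cone (hs : Real.sin (θmax - θmin) ≠ 0) :
    oblique θmin θmax hs ⁻¹' cone θmin θmax = Ioi (0 : ℝ) ×ˢ (Ioi (0 : ℝ) ×ˢ (univ : Set ℝ)) := by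
  ext a
  simp [cone, obliqueP_oblique, obliqueQ_oblique, mem_prod]

theorem integral_faceMeasure_eq {θ δ : ℝ} (hδh : δ ≤ h) (hδM : δ ≤ M) {ψ : E3 → ℂ}
    (hψ : tsupport ψ ⊆ Metric.ball 0 δ) :
    ∫ x, ψ x ∂faceMeasure θ h M = ∫ p in Ioi 0 ×ˢ univ, ψ (facePoint θ p) := by
  rw [integral_faceMeasure]
  refine (setIntegral_eq_of_subset_of_forall_sdiff_eq_zero
    (measurableSet_Ioi.prod MeasurableSet.univ) ?_ ?_).symm
  · exact prod_mono (fun r hr => hr.1) (subset_univ _)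
  · rintro p ⟨⟨hp0, -⟩, hp⟩
    by_contra hne
    have hb : facePoint θ p ∈ Metric.ball (0 : E3) δ := hψ (subset_tsupport _ hne)
    rw [mem_ball_zero_iff] at hb
    have hsq := norm_facePoint_sq θ p
    have hn := norm_nonneg (facePoint θ p)
    apply hp
    have h1 : |p.1| < δ := by
      exact lt_of_le_of_lt (abs_le_of_sq_le_sq (by nlinarith [sq_nonneg p.1, sq_nonneg p.2]) hn) hb
    have h2 : |p.2| < δ := by
      exact lt_of_le_of_lt (abs_le_of_sq_le_sq (by nlinarith [sq_nonneg p.1, sq_nonneg p.2]) hn) hb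
    rw [abs_lt] at h1 h2
    exact ⟨⟨hp0, by linarith⟩, by constructor <;> linarith⟩

theorem wedge_inter_ball (hθ : θmin < θmax) (hangle : θmax - θmin < Real.pi) (hh : 0 < h)
    {δ : ℝ} (hδh : δ ≤ h) (hδM : δ ≤ M) {F : E3 → ℂ} (hF : tsupport F ⊆ Metric.ball 0 δ) :
    ∫ x in wedge θmin θmax h M, F x = ∫ x in cone θmin θmax, F x := by
  refine (setIntegral_eq_of_subset_of_forall_sdiff_eq_zero isOpen_cone.measurableSet
    (wedge_subset_cone hθ hangle hh) ?_).symm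
  rintro x ⟨hx, hxw⟩
  by_contra hne
  have hb : x ∈ Metric.ball (0 : E3) δ := hF (subset_tsupport _ hne)
  rw [mem_ball_zero_iff] at hb
  exact hxw (mem_wedge_of_mem_cone hθ hangle hh hx (by linarith) (by linarith))

theorem hasCompactSupport_of_subset_ball {V : Type*} [Zero V] {δ : ℝ} {φ : E3 → V}
    (hφ : tsupport φ ⊆ Metric.ball 0 δ) : HasCompactSupport φ :=
  (isCompact_closedBall (0 : E3) δ).of_isClosed_subset (isClosed_tsupport φ)
    (hφ.trans Metric.ball_subset_closedBall)

/-- The divergence theorem on the wedge for functions supported near the origin. -/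
theorem exists_integral_wedge_fderiv (hθ : θmin < θmax) (hangle : θmax - θmin < Real.pi)
    (hh : 0 < h) : ∃ c : ℝ, 0 < c ∧ ∀ δ ≤ h, δ ≤ M → ∀ ψ : E3 → ℂ, ContDiff ℝ 1 ψ →
      tsupport ψ ⊆ Metric.ball 0 δ → ∀ e : E3,
      ∫ x in wedge θmin θmax h M, fderiv ℝ ψ x e =
        ((-c * obliqueQ θmin θmax e : ℝ) : ℂ) * ∫ x, ψ x ∂faceMeasure θmax h M
        + ((-c * obliqueP θmin θmax e : ℝ) : ℂ) * ∫ x, ψ x ∂faceMeasure θmin h M := by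
  have hs : Real.sin (θmax - θmin) ≠ 0 :=
    (Real.sin_pos_of_pos_of_lt_pi (by linarith) hangle).ne'
  obtain ⟨c, hc0, hc⟩ := exists_volume_eq_map_oblique hs
  refine ⟨c, hc0, fun δ hδh hδM ψ hψ hsupp e => ?_⟩
  set L := oblique θmin θmax hs
  have hF : tsupport (fun x => fderiv ℝ ψ x e) ⊆ Metric.ball 0 δ :=
    (tsupport_fderiv_apply_subset ℝ e).trans hsupp
  have hcs := hasCompactSupport_of_subset_ball hsupp
  -- The support lies inside the ball of radius `δ`, so wedge and faces may be replaced by the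
  -- infinite cone and half-planes; no terms arise at `r = h` or `x₃ = ±M`. The face at `θmax` is `q
  -- = 0`, hence its coefficient is the `q`-component of `e`.
  rw [wedge_inter_ball hθ hangle hh hδh hδM hF, setIntegral_oblique hs hc,
    oblique_preimage_cone hs, integral_faceMeasure_eq hδh hδM hsupp,
    integral_faceMeasure_eq hδh hδM hsupp]
  have key := integral_octant_fderiv (Ψ := ψ ∘ L) (hψ.comp L.contDiff)
    (hcs.comp_isClosedEmbedding L.toHomeomorph.isClosedEmbedding) (L.symm e)
  have e1 : ∀ a, fderiv ℝ (ψ ∘ L) a (L.symm e) = fderiv ℝ ψ (L a) e := fun a => by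
    rw [L.comp_right_fderiv]
    simp
  simp only [e1] at key
  rw [key]
  simp only [facePoint_max_eq hs, facePoint_min_eq hs, Function.comp_apply, Complex.real_smul]
  simp only [L, oblique_symm_apply]
  push_cast
  ring

/-! ### Concentration at the edge. -/

/-- The exponential weight in oblique coordinates. -/
noncomputable def obliqueExp (θmin θmax s : ℝ) (x : E3) : ℝ :=
  Real.exp (-(s * (obliqueP θmin θmax x + obliqueQ θmin θmax x)))

theorem continuous_obliqueExp (s : ℝ) : Continuous (obliqueExp θmin θmax s) := by
  unfold obliqueExp; fun_prop

theorem obliqueExp_le_one {s : ℝ} (hs : 0 ≤ s) {x : E3} (hx : x ∈ cone θmin θmax) :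
    obliqueExp θmin θmax s x ≤ 1 := by
  unfold obliqueExp
  have : 0 ≤ s * (obliqueP θmin θmax x + obliqueQ θmin θmax x) :=
    mul_nonneg hs (add_pos hx.1 hx.2).le
  exact Real.exp_le_one_iff.2 (by linarith)

theorem obliqueExp_pos (s : ℝ) (x : E3) : 0 < obliqueExp θmin θmax s x := Real.exp_pos _

/-- Each of the two transverse directions contributes `1/s`, and the edge direction its length `2M`.
-/
theorem exists_integral_obliqueExp_le (hθ : θmin < θmax) (hangle : θmax - θmin < Real.pi)
    (hh : 0 < h) (hM : 0 < M) : ∃ C : ℝ, 0 ≤ C ∧ ∀ s : ℝ, 0 < s →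
      s ^ 2 * ∫ x in wedge θmin θmax h M, obliqueExp θmin θmax s x ≤ C := by
  have hs : Real.sin (θmax - θmin) ≠ 0 :=
    (Real.sin_pos_of_pos_of_lt_pi (by linarith) hangle).ne'
  obtain ⟨c, hc0, hc⟩ := exists_volume_eq_map_oblique hs
  refine ⟨c * (2 * M), by positivity, fun s hs0 => ?_⟩
  rw [setIntegral_oblique hs hc]
  set L := oblique θmin θmax hs with hL
  have he : ∀ a : ℝ × ℝ × ℝ, obliqueExp θmin θmax s (L a)
      = Real.exp (-s * a.1) * (Real.exp (-s * a.2.1) * 1) := fun a => by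
    rw [obliqueExp, obliqueP_oblique, obliqueQ_oblique, mul_one, ← Real.exp_add]
    congr 1; ring
  have i0 : IntegrableOn (fun p : ℝ => Real.exp (-s * p)) (Ioi 0) :=
    integrableOn_exp_mul_Ioi (by linarith) 0
  have hint : IntegrableOn (fun a : ℝ × ℝ × ℝ => obliqueExp θmin θmax s (L a))
      (Ioi 0 ×ˢ (Ioi 0 ×ˢ Ioo (-M) M)) := by
    simp only [he]
    rw [IntegrableOn, Measure.volume_eq_prod, ← Measure.prod_restrict, Measure.volume_eq_prod,
      ← Measure.prod_restrict]
    have i1 : Integrable (fun _ : ℝ => (1 : ℝ)) (volume.restrict (Ioo (-M) M)) :=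
      integrable_const _
    exact Integrable.mul_prod i0 (Integrable.mul_prod i0 i1)
  have hsub : L ⁻¹' wedge θmin θmax h M ⊆ Ioi 0 ×ˢ (Ioi 0 ×ˢ Ioo (-M) M) := by
    intro a ha
    have h1 := wedge_subset_cone hθ hangle hh ha
    have h2 := ha.2
    refine ⟨?_, ?_, ?_⟩
    · simpa only [obliqueP_oblique, hL, mem_Ioi] using h1.1
    · simpa only [obliqueQ_oblique, hL, mem_Ioi] using h1.2
    · exact h2
  have hle : ∫ a in L ⁻¹' wedge θmin θmax h M, obliqueExp θmin θmax s (L a)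
      ≤ ∫ a in Ioi 0 ×ˢ (Ioi 0 ×ˢ Ioo (-M) M), obliqueExp θmin θmax s (L a) :=
    setIntegral_mono_set hint (Eventually.of_forall fun a => (obliqueExp_pos _ _).le)
      (LE.le.eventuallyLE hsub)
  have hval : ∫ a in Ioi 0 ×ˢ (Ioi 0 ×ˢ Ioo (-M) M), obliqueExp θmin θmax s (L a)
      = (1 / s) * ((1 / s) * (2 * M)) := by
    simp only [he]
    have j0 : ∫ p in Ioi (0 : ℝ), Real.exp (-s * p) = 1 / s := by
      rw [integral_exp_mul_Ioi (by linarith) 0]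
      simp
    have j1 : ∫ _ in Ioo (-M) M, (1 : ℝ) = 2 * M := by
      rw [setIntegral_const, Measure.real, Real.volume_Ioo, ENNReal.toReal_ofReal (by linarith)]
      simp; ring
    rw [Measure.volume_eq_prod, setIntegral_prod_mul (fun p : ℝ => Real.exp (-s * p))
      (fun b : ℝ × ℝ => Real.exp (-s * b.1) * 1), Measure.volume_eq_prod,
      setIntegral_prod_mul (fun p : ℝ => Real.exp (-s * p)) (fun _ : ℝ => (1 : ℝ)), j0, j1]
  calc s ^ 2 * ((c : ℝ) • ∫ a in L ⁻¹' wedge θmin θmax h M, obliqueExp θmin θmax s (L a))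
      ≤ s ^ 2 * ((c : ℝ) • ((1 / s) * ((1 / s) * (2 * M)))) := by
        rw [smul_eq_mul, smul_eq_mul]; gcongr; rw [← hval]; exact hle
    _ = c * (2 * M) := by rw [smul_eq_mul]; field_simp

theorem isFiniteMeasure_wedge (hθ : θmin < θmax) (hangle : θmax - θmin < Real.pi) (hh : 0 < h) :
    IsFiniteMeasure ((volume : Measure E3).restrict (wedge θmin θmax h M)) :=
  ⟨by rw [Measure.restrict_apply_univ]; exact volume_wedge_lt_top hθ hangle hh⟩

/-- This is Cauchy–Schwarz for the weighted measure: `∫ |F|²` against the weight tends to zero by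
dominated convergence, and the mass of the weight is `O(s⁻²)`. The proof uses a weighted
arithmetic-geometric mean inequality instead of square roots. -/
theorem tendsto_mul_integral_obliqueExp (hθ : θmin < θmax) (hangle : θmax - θmin < Real.pi)
    (hh : 0 < h) (hM : 0 < M) {F : E3 → ℂ}
    (hF : MemLp F 2 (volume.restrict (wedge θmin θmax h M))) :
    Tendsto (fun s : ℝ => s * ∫ x in wedge θmin θmax h M, ‖F x‖ * obliqueExp θmin θmax s x)
      atTop (𝓝 0) := by
  have := isFiniteMeasure_wedge (M := M) hθ hangle hh
  obtain ⟨C, hC0, hC⟩ := exists_integral_obliqueExp_le hθ hangle hh hM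
  set D := wedge θmin θmax h M
  have hmeas : MeasurableSet D := (isOpen_wedge hθ hangle hh).measurableSet
  have hcone : ∀ᵐ x ∂volume.restrict D, x ∈ cone θmin θmax :=
    (ae_restrict_mem hmeas).mono fun x hx => wedge_subset_cone hθ hangle hh hx
  have hF2 : Integrable (fun x => ‖F x‖ ^ 2) (volume.restrict D) :=
    hF.integrable_norm_pow (by norm_num)
  have hF1 : Integrable (fun x => ‖F x‖) (volume.restrict D) :=
    (hF.integrable (by norm_num)).norm
  have hw : ∀ s : ℝ, AEStronglyMeasurable (obliqueExp θmin θmax s) (volume.restrict D) :=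
    fun s => (continuous_obliqueExp s).aestronglyMeasurable
  have hbd : ∀ s : ℝ, 0 ≤ s → ∀ᵐ x ∂volume.restrict D, ‖obliqueExp θmin θmax s x‖ ≤ 1 :=
    fun s hs => hcone.mono fun x hx => by
      rw [Real.norm_of_nonneg (obliqueExp_pos _ _).le]; exact obliqueExp_le_one hs hx
  have hT : Tendsto (fun s : ℝ => ∫ x in D, ‖F x‖ ^ 2 * obliqueExp θmin θmax s x)
      atTop (𝓝 0) := by
    have : Tendsto (fun s : ℝ => ∫ x in D, ‖F x‖ ^ 2 * obliqueExp θmin θmax s x)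
        atTop (𝓝 (∫ x in D, (0 : ℝ))) := by
      refine tendsto_integral_filter_of_dominated_convergence (fun x => ‖F x‖ ^ 2) ?_ ?_ hF2 ?_
      · exact Eventually.of_forall fun s => hF2.aestronglyMeasurable.mul (hw s)
      · filter_upwards [eventually_ge_atTop 0] with s hs
        filter_upwards [hbd s hs] with x hx
        rw [norm_mul, norm_pow, norm_norm]
        exact mul_le_of_le_one_right (by positivity) hx
      · filter_upwards [hcone] with x hx
        have hpos := add_pos hx.1 hx.2
        have h1 : Tendsto (fun s : ℝ => obliqueExp θmin θmax s x) atTop (𝓝 0) :=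
          Real.tendsto_exp_neg_atTop_nhds_zero.comp (tendsto_id.atTop_mul_const hpos)
        simpa using h1.const_mul (‖F x‖ ^ 2)
    simpa using this
  rw [Metric.tendsto_nhds]
  intro ε hε
  -- This weight makes the mass term at most `η C / 2 ≤ ε / 2`; the `L²` term is then less than `ε /
  -- 2` once its integral is below `ε η`.
  set η : ℝ := ε / (C + 1) with hη
  have hη0 : 0 < η := by positivity
  have hTη := (Metric.tendsto_nhds.1 hT) (ε * η) (by positivity)
  filter_upwards [hTη, eventually_gt_atTop 0] with s hsT hs0
  have hi1 : Integrable (fun x => ‖F x‖ ^ 2 * obliqueExp θmin θmax s x) (volume.restrict D) :=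
    hF2.mul_bdd (hw s) (hbd s hs0.le)
  have hi2 : Integrable (obliqueExp θmin θmax s) (volume.restrict D) :=
    Integrable.of_bound (hw s) 1 (hbd s hs0.le)
  have hnn : 0 ≤ ∫ x in D, ‖F x‖ * obliqueExp θmin θmax s x :=
    integral_nonneg fun x => mul_nonneg (norm_nonneg _) (obliqueExp_pos _ _).le
  have hTn : ∫ x in D, ‖F x‖ ^ 2 * obliqueExp θmin θmax s x < ε * η := by
    have := abs_lt.1 (by simpa [Real.dist_eq] using hsT)
    exact this.2
  have hamgm : s * ∫ x in D, ‖F x‖ * obliqueExp θmin θmax s x ≤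
      (2 * η)⁻¹ * (∫ x in D, ‖F x‖ ^ 2 * obliqueExp θmin θmax s x)
        + (η / 2) * (s ^ 2 * ∫ x in D, obliqueExp θmin θmax s x) := by
    rw [← mul_assoc (η / 2), ← integral_const_mul, ← integral_const_mul, ← integral_const_mul,
      ← integral_add (hi1.const_mul _) (hi2.const_mul _)]
    refine integral_mono ((hF1.mul_bdd (hw s) (hbd s hs0.le)).const_mul s)
      ((hi1.const_mul _).add (hi2.const_mul _)) fun x => ?_
    have he := (obliqueExp_pos (θmin := θmin) (θmax := θmax) s x).le
    have : s * ‖F x‖ ≤ (2 * η)⁻¹ * ‖F x‖ ^ 2 + η / 2 * s ^ 2 := by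
      have h0 := sq_nonneg (‖F x‖ - η * s)
      rw [← sub_nonneg]
      have : (2 * η)⁻¹ * ‖F x‖ ^ 2 + η / 2 * s ^ 2 - s * ‖F x‖
        = (2 * η)⁻¹ * (‖F x‖ - η * s) ^ 2 := by field_simp; ring
      rw [this]; positivity
    calc s * (‖F x‖ * obliqueExp θmin θmax s x) = (s * ‖F x‖) * obliqueExp θmin θmax s x := by ring
      _ ≤ ((2 * η)⁻¹ * ‖F x‖ ^ 2 + η / 2 * s ^ 2) * obliqueExp θmin θmax s x := by gcongr
      _ = _ := by ring
  rw [Real.dist_eq, sub_zero, abs_of_nonneg (mul_nonneg hs0.le hnn)]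
  have h1 : (2 * η)⁻¹ * (∫ x in D, ‖F x‖ ^ 2 * obliqueExp θmin θmax s x) < ε / 2 := by
    calc _ < (2 * η)⁻¹ * (ε * η) := by gcongr
      _ = ε / 2 := by field_simp
  have h2 : (η / 2) * (s ^ 2 * ∫ x in D, obliqueExp θmin θmax s x) ≤ ε / 2 := by
    calc _ ≤ (η / 2) * C := by gcongr; exact hC s hs0
      _ ≤ (η / 2) * (C + 1) := by gcongr; linarith
      _ = ε / 2 := by rw [hη]; field_simp
  linarith

/-- A kernel concentrating at the edge under dilation integrates to `o(1/s)` against `L²`. -/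
theorem tendsto_mul_integral_dilate (hθ : θmin < θmax) (hangle : θmax - θmin < Real.pi)
    (hh : 0 < h) (hM : 0 < M) {F K : E3 → ℂ}
    (hF : MemLp F 2 (volume.restrict (wedge θmin θmax h M))) {C k : ℝ} (hk : 0 < k)
    (hKb : ∀ x ∈ cone θmin θmax, ‖K x‖ ≤ C * obliqueExp θmin θmax k x) :
    Tendsto (fun s : ℝ => (s : ℂ) * ∫ x in wedge θmin θmax h M, F x * K (s • x))
      atTop (𝓝 0) := by
  have := isFiniteMeasure_wedge (M := M) hθ hangle hh
  have hmeas : MeasurableSet (wedge θmin θmax h M) := (isOpen_wedge hθ hangle hh).measurableSet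
  have hF1 : Integrable (fun x => ‖F x‖) (volume.restrict (wedge θmin θmax h M)) :=
    (hF.integrable (by norm_num)).norm
  have base := ((tendsto_mul_integral_obliqueExp hθ hangle hh hM hF).comp
    (tendsto_id.const_mul_atTop hk)).const_mul (C / k)
  rw [mul_zero] at base
  refine squeeze_zero_norm' ?_ base
  filter_upwards [eventually_gt_atTop 0] with s hs
  have hint : Integrable (fun x => ‖F x‖ * obliqueExp θmin θmax (k * s) x)
      (volume.restrict (wedge θmin θmax h M)) := by
    refine hF1.mul_bdd (c := 1) (continuous_obliqueExp _).aestronglyMeasurable ?_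
    filter_upwards [ae_restrict_mem hmeas] with x hx
    rw [Real.norm_of_nonneg (obliqueExp_pos _ _).le]
    exact obliqueExp_le_one (by positivity) (wedge_subset_cone hθ hangle hh hx)
  have h1 : ‖∫ x in wedge θmin θmax h M, F x * K (s • x)‖
      ≤ ∫ x in wedge θmin θmax h M, C * (‖F x‖ * obliqueExp θmin θmax (k * s) x) := by
    refine norm_integral_le_of_norm_le (hint.const_mul C) ?_
    filter_upwards [ae_restrict_mem hmeas] with x hx
    have hc := wedge_subset_cone hθ hangle hh hx
    have := hKb (s • x) ⟨by rw [map_smul]; exact mul_pos hs hc.1,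
      by rw [map_smul]; exact mul_pos hs hc.2⟩
    have he : obliqueExp θmin θmax k (s • x) = obliqueExp θmin θmax (k * s) x := by
      simp only [obliqueExp, map_smul, smul_eq_mul]; congr 1; ring
    rw [he] at this
    rw [norm_mul]
    calc ‖F x‖ * ‖K (s • x)‖ ≤ ‖F x‖ * (C * obliqueExp θmin θmax (k * s) x) := by gcongr
      _ = _ := by ring
  rw [integral_const_mul] at h1
  rw [norm_mul, Complex.norm_real, Real.norm_of_nonneg hs.le]
  calc s * ‖∫ x in wedge θmin θmax h M, F x * K (s • x)‖
      ≤ s * (C * ∫ x in wedge θmin θmax h M, ‖F x‖ * obliqueExp θmin θmax (k * s) x) := by gcongr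
    _ = _ := by simp only [Function.comp_apply, id_eq]; field_simp

/-! ### Weak flux identities and removal of the edge. -/

/-- `∫_D (A φ + B · ∇φ)` equals a pair of face integrals, for all test functions supported near
the origin. -/
def HasWeakFlux (θmin θmax h M δ : ℝ) (A : E3 → ℂ) (B : Fin 3 → E3 → ℂ) (hp hm : E3 → ℂ) : Prop :=
  ∀ φ : E3 → ℂ, ContDiff ℝ ∞ φ → tsupport φ ⊆ Metric.ball 0 δ →
    ∫ x in wedge θmin θmax h M,
      (A x * φ x + ∑ j, B j x * fderiv ℝ φ x (EuclideanSpace.single j 1)) =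
    (∫ x, hp x * φ x ∂faceMeasure θmax h M) + ∫ x, hm x * φ x ∂faceMeasure θmin h M

theorem integrable_mul_of_memLp {μ : Measure E3} [IsFiniteMeasure μ] {F b : E3 → ℂ}
    (hF : MemLp F 2 μ) (hb : Continuous b) (hc : HasCompactSupport b) :
    Integrable (fun x => F x * b x) μ := by
  obtain ⟨C, hC⟩ := hc.exists_bound_of_continuous hb
  exact (hF.integrable (by norm_num)).mul_bdd hb.aestronglyMeasurable (Eventually.of_forall hC)

theorem memLp_mul_of_memLp {μ : Measure E3} {F b : E3 → ℂ}
    (hF : MemLp F 2 μ) (hb : Continuous b) (hc : HasCompactSupport b) :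
    MemLp (fun x => F x * b x) 2 μ := by
  obtain ⟨C, hC⟩ := hc.exists_bound_of_continuous hb
  refine MemLp.of_le_mul (c := C) hF (hF.aestronglyMeasurable.mul hb.aestronglyMeasurable)
    (Eventually.of_forall fun x => ?_)
  rw [norm_mul, mul_comm]
  gcongr
  exact hC x

theorem continuous_fderiv_single {φ : E3 → ℂ} (hφ : ContDiff ℝ ∞ φ) (e : E3) :
    Continuous fun x => fderiv ℝ φ x e :=
  (hφ.continuous_fderiv (by simp)).clm_apply continuous_const

theorem integrable_flux {μ : Measure E3} [IsFiniteMeasure μ] {A : E3 → ℂ} {B : Fin 3 → E3 → ℂ}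
    (hA : MemLp A 2 μ) (hB : ∀ j, MemLp (B j) 2 μ) {φ : E3 → ℂ} (hφ : ContDiff ℝ ∞ φ)
    (hc : HasCompactSupport φ) :
    Integrable (fun x => A x * φ x + ∑ j, B j x * fderiv ℝ φ x (EuclideanSpace.single j 1)) μ :=
  (integrable_mul_of_memLp hA hφ.continuous hc).add <| integrable_finsetSum _ fun j _ =>
    integrable_mul_of_memLp (hB j) (continuous_fderiv_single hφ _) (hc.fderiv_apply ℝ _)

theorem integrable_mul_of_integrableOn_ball {μ : Measure E3} {g φ : E3 → ℂ}
    (hg : IntegrableOn g (Metric.ball 0 δ) μ) (hφ : Continuous φ)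
    (hsupp : tsupport φ ⊆ Metric.ball 0 δ) : Integrable (fun x => g x * φ x) μ := by
  obtain ⟨C, hC⟩ := (hasCompactSupport_of_subset_ball hsupp).exists_bound_of_continuous hφ
  have h1 : IntegrableOn (fun x => g x * φ x) (Metric.ball 0 δ) μ :=
    Integrable.mul_bdd hg hφ.aestronglyMeasurable (Eventually.of_forall hC)
  refine h1.integrable_of_forall_notMem_eq_zero fun x hx => ?_
  rw [image_eq_zero_of_notMem_tsupport fun h0 => hx (hsupp h0), mul_zero]

theorem tendsto_integral_mul_dilate {μ : Measure E3} {G : E3 → ℂ} (hG : Integrable G μ)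
    {T : E3 → ℝ} (hT : Continuous T) (hT1 : ∀ x, ‖T x‖ ≤ 1)
    (hlim : ∀ᵐ x ∂μ, ∀ᶠ s : ℝ in atTop, T (s • x) = 1) :
    Tendsto (fun s : ℝ => ∫ x, G x * (T (s • x) : ℂ) ∂μ) atTop (𝓝 (∫ x, G x ∂μ)) := by
  refine tendsto_integral_filter_of_dominated_convergence (fun x => ‖G x‖) ?_ ?_ hG.norm ?_
  · refine Eventually.of_forall fun s => hG.aestronglyMeasurable.mul ?_
    exact (Complex.continuous_ofReal.comp
      (hT.comp (continuous_const_smul s))).aestronglyMeasurable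
  · refine Eventually.of_forall fun s => Eventually.of_forall fun x => ?_
    rw [norm_mul, Complex.norm_real]
    exact mul_le_of_le_one_right (norm_nonneg _) (hT1 _)
  · filter_upwards [hlim] with x hx
    refine tendsto_nhds_of_eventually_eq (hx.mono fun s hs => ?_)
    rw [hs]; simp

theorem ae_mem_openFace (θ : ℝ) : ∀ᵐ x ∂faceMeasure θ h M, x ∈ openFace θ h M := by
  unfold faceMeasure
  rw [(measurableEmbedding_facePoint θ).ae_map_iff]
  filter_upwards [ae_restrict_mem (measurableSet_Ioo.prod measurableSet_Ioo)] with p hp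
  exact mem_image_of_mem _ hp

/-- A cutoff vanishing near the edge of the wedge and equal to `1` away from it. -/
noncomputable def edgeCutoff (θmin θmax : ℝ) (x : E3) : ℝ :=
  Real.smoothTransition (obliqueP θmin θmax x + obliqueQ θmin θmax x - 1)

/-- A function that separates the two faces. -/
noncomputable def faceCutoff (θmin θmax : ℝ) (x : E3) : ℝ :=
  Real.smoothTransition (obliqueP θmin θmax x - obliqueQ θmin θmax x + 1 / 2)

theorem contDiff_edgeCutoff : ContDiff ℝ ∞ (edgeCutoff θmin θmax) := by
  unfold edgeCutoff
  exact Real.smoothTransition.contDiff.comp (by fun_prop)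

theorem contDiff_faceCutoff : ContDiff ℝ ∞ (faceCutoff θmin θmax) := by
  unfold faceCutoff
  exact Real.smoothTransition.contDiff.comp (by fun_prop)

theorem norm_smoothTransition_le (t : ℝ) : ‖Real.smoothTransition t‖ ≤ 1 := by
  rw [Real.norm_of_nonneg (Real.smoothTransition.nonneg t)]
  exact Real.smoothTransition.le_one t

/-- The derivative vanishes outside `1 ≤ t ≤ 2`, where `exp (-t) ≥ exp (-2)`. The exponential form
of the bound is the one `tendsto_mul_integral_dilate` expects. -/
theorem exists_deriv_smoothTransition_le :
    ∃ C, 0 ≤ C ∧ ∀ t : ℝ, ‖deriv Real.smoothTransition (t - 1)‖ ≤ C * Real.exp (-t) := by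
  have hd : Continuous (deriv Real.smoothTransition) :=
    (Real.smoothTransition.contDiff (n := 1)).continuous_deriv le_rfl
  obtain ⟨C, hC⟩ := (isCompact_Icc (a := (0 : ℝ)) (b := 1)).exists_bound_of_continuousOn
    hd.continuousOn
  have hC0 : 0 ≤ C := (norm_nonneg _).trans (hC 0 (by simp))
  refine ⟨C * Real.exp 2, by positivity, fun t => ?_⟩
  rw [mul_assoc, ← Real.exp_add]
  by_cases ht : t - 1 ∈ Icc (0 : ℝ) 1
  · refine (hC _ ht).trans (le_mul_of_one_le_right hC0 (Real.one_le_exp ?_))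
    linarith [ht.2]
  · have : deriv Real.smoothTransition (t - 1) = 0 := by
      rw [mem_Icc, not_and_or, not_le, not_le] at ht
      rcases ht with ht | ht
      · have : Real.smoothTransition =ᶠ[𝓝 (t - 1)] fun _ => 0 := by
          filter_upwards [Iio_mem_nhds ht] with y hy
          exact Real.smoothTransition.zero_of_nonpos (le_of_lt hy)
        rw [this.deriv_eq, deriv_const]
      · have : Real.smoothTransition =ᶠ[𝓝 (t - 1)] fun _ => 1 := by
          filter_upwards [Ioi_mem_nhds ht] with y hy
          exact Real.smoothTransition.one_of_one_le (le_of_lt hy)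
        rw [this.deriv_eq, deriv_const]
    rw [this, norm_zero]
    positivity

theorem exists_fderiv_edgeCutoff_le (e : E3) : ∃ C, ∀ x : E3,
    ‖((fderiv ℝ (edgeCutoff θmin θmax) x e : ℝ) : ℂ)‖ ≤ C * obliqueExp θmin θmax 1 x := by
  obtain ⟨C, hC0, hC⟩ := exists_deriv_smoothTransition_le
  refine ⟨C * ‖obliqueP θmin θmax e + obliqueQ θmin θmax e‖, fun x => ?_⟩
  have h1 : HasFDerivAt (fun x : E3 => obliqueP θmin θmax x + obliqueQ θmin θmax x - 1)
      (obliqueP θmin θmax + obliqueQ θmin θmax) x :=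
    ((obliqueP θmin θmax).hasFDerivAt.add (obliqueQ θmin θmax).hasFDerivAt).sub_const 1
  have h2 := (((Real.smoothTransition.contDiff (n := 1)).differentiable one_ne_zero
    (obliqueP θmin θmax x + obliqueQ θmin θmax x - 1)).hasDerivAt).comp_hasFDerivAt x h1
  have h3 : fderiv ℝ (edgeCutoff θmin θmax) x = _ := h2.fderiv
  rw [h3, Complex.norm_real]
  simp only [FunLike.coe_smul, Pi.smul_apply, add_apply, smul_eq_mul, norm_mul]
  have := hC (obliqueP θmin θmax x + obliqueQ θmin θmax x)
  calc _ ≤ (C * Real.exp (-(obliqueP θmin θmax x + obliqueQ θmin θmax x))) *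
        ‖obliqueP θmin θmax e + obliqueQ θmin θmax e‖ := by gcongr
    _ = _ := by rw [obliqueExp, one_mul]; ring

theorem eventually_smoothTransition_eq_one {a : ℝ} (ha : 0 < a) (b : ℝ) :
    ∀ᶠ s : ℝ in atTop, Real.smoothTransition (s * a + b) = 1 := by
  have : Tendsto (fun s : ℝ => s * a + b) atTop atTop :=
    tendsto_atTop_add_const_right _ _ (tendsto_id.atTop_mul_const ha)
  filter_upwards [this.eventually_ge_atTop 1] with s hs
  exact Real.smoothTransition.one_of_one_le hs

theorem eventually_edgeCutoff_eq_one {x : E3}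
    (hx : 0 < obliqueP θmin θmax x + obliqueQ θmin θmax x) :
    ∀ᶠ s : ℝ in atTop, edgeCutoff θmin θmax (s • x) = 1 := by
  filter_upwards [eventually_smoothTransition_eq_one hx (-1)] with s hs
  rw [← hs, edgeCutoff, map_smul, map_smul, smul_eq_mul, smul_eq_mul]
  congr 1; ring

theorem mul_dilate_contDiff {φ : E3 → ℂ} (hφ : ContDiff ℝ ∞ φ) {T : E3 → ℝ} (hT : ContDiff ℝ ∞ T)
    (s : ℝ) : ContDiff ℝ ∞ fun x => φ x * (T (s • x) : ℂ) :=
  hφ.mul (Complex.ofRealCLM.contDiff.comp (hT.comp (contDiff_const_smul s)))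

theorem fderiv_mul_dilate {φ : E3 → ℂ} (hφ : ContDiff ℝ ∞ φ) {T : E3 → ℝ} (hT : ContDiff ℝ ∞ T)
    (s : ℝ) (x e : E3) : fderiv ℝ (fun x => φ x * (T (s • x) : ℂ)) x e =
      fderiv ℝ φ x e * (T (s • x) : ℂ) + s * (φ x * (fderiv ℝ T (s • x) e : ℝ)) := by
  have h1 : HasFDerivAt φ (fderiv ℝ φ x) x := (hφ.differentiable (by simp) x).hasFDerivAt
  have h2 : HasFDerivAt (fun x : E3 => s • x) (s • ContinuousLinearMap.id ℝ E3) x :=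
    (hasFDerivAt_id x).const_smul s
  have h3 : HasFDerivAt T (fderiv ℝ T (s • x)) (s • x) :=
    (hT.differentiable (by simp) _).hasFDerivAt
  have h4 := h1.mul (Complex.ofRealCLM.hasFDerivAt.comp x (h3.comp x h2))
  have h5 : fderiv ℝ (fun x => φ x * (T (s • x) : ℂ)) x = _ := h4.fderiv
  rw [h5]
  simp
  ring

theorem tsupport_dilate_subset {T : E3 → ℝ} {s : ℝ} {S : Set E3} (hS : IsClosed S)
    (h : ∀ x, T (s • x) ≠ 0 → x ∈ S) (φ : E3 → ℂ) :
    tsupport (fun x => φ x * (T (s • x) : ℂ)) ⊆ tsupport φ ∩ S := by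
  refine subset_inter (tsupport_mul_subset_left) (closure_minimal (fun x hx => ?_) hS)
  refine h x fun h0 => ?_
  apply hx
  simp [h0]

theorem mem_openFace_max (hs : Real.sin (θmax - θmin) ≠ 0) {x : E3} (hx : ‖x‖ < h)
    (hxM : ‖x‖ < M) (hp : 0 < obliqueP θmin θmax x) (hq : obliqueQ θmin θmax x = 0) :
    x ∈ openFace θmax h M := by
  have hx' : facePoint θmax (obliqueP θmin θmax x, x 2) = x := by
    rw [facePoint_max_eq hs, ← hq]
    exact (oblique θmin θmax hs).apply_symm_apply x
  have hsq := norm_facePoint_sq θmax (obliqueP θmin θmax x, x 2)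
  rw [hx'] at hsq
  simp only at hsq
  refine ⟨_, ⟨⟨hp, ?_⟩, abs_lt.1 ?_⟩, hx'⟩
  · exact lt_of_le_of_lt 
      ((le_abs_self _).trans (abs_le_of_sq_le_sq (by nlinarith [sq_nonneg (x 2)]) (norm_nonneg x))) hx
  · exact lt_of_le_of_lt (abs_le_of_sq_le_sq (by nlinarith) (norm_nonneg x)) hxM

theorem mem_openFace_min (hs : Real.sin (θmax - θmin) ≠ 0) {x : E3} (hx : ‖x‖ < h)
    (hxM : ‖x‖ < M) (hp : obliqueP θmin θmax x = 0) (hq : 0 < obliqueQ θmin θmax x) :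
    x ∈ openFace θmin h M := by
  have hx' : facePoint θmin (obliqueQ θmin θmax x, x 2) = x := by
    rw [facePoint_min_eq hs, ← hp]
    exact (oblique θmin θmax hs).apply_symm_apply x
  have hsq := norm_facePoint_sq θmin (obliqueQ θmin θmax x, x 2)
  rw [hx'] at hsq
  simp only at hsq
  refine ⟨_, ⟨⟨hq, ?_⟩, abs_lt.1 ?_⟩, hx'⟩
  · exact lt_of_le_of_lt
      ((le_abs_self _).trans (abs_le_of_sq_le_sq (by nlinarith [sq_nonneg (x 2)]) (norm_nonneg x))) hx
  · exact lt_of_le_of_lt (abs_le_of_sq_le_sq (by nlinarith) (norm_nonneg x)) hxM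

theorem obliqueP_facePoint_max (hs : Real.sin (θmax - θmin) ≠ 0) (p : ℝ × ℝ) :
    obliqueP θmin θmax (facePoint θmax p) = p.1 := by
  rw [facePoint_max_eq hs, obliqueP_oblique]

theorem obliqueQ_facePoint_max (hs : Real.sin (θmax - θmin) ≠ 0) (p : ℝ × ℝ) :
    obliqueQ θmin θmax (facePoint θmax p) = 0 := by
  rw [facePoint_max_eq hs, obliqueQ_oblique]

theorem obliqueP_facePoint_min (hs : Real.sin (θmax - θmin) ≠ 0) (p : ℝ × ℝ) :
    obliqueP θmin θmax (facePoint θmin p) = 0 := by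
  rw [facePoint_min_eq hs, obliqueP_oblique]

theorem obliqueQ_facePoint_min (hs : Real.sin (θmax - θmin) ≠ 0) (p : ℝ × ℝ) :
    obliqueQ θmin θmax (facePoint θmin p) = p.1 := by
  rw [facePoint_min_eq hs, obliqueQ_oblique]

/-- Test functions need not vanish near the edge: it has zero capacity. -/
theorem hasWeakFlux_of_faces (hθ : θmin < θmax) (hangle : θmax - θmin < Real.pi)
    (hh : 0 < h) (hM : 0 < M) (hδh : δ ≤ h) (hδM : δ ≤ M)
    {A : E3 → ℂ} {B : Fin 3 → E3 → ℂ} {hp hm : E3 → ℂ}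
    (hA : MemLp A 2 (volume.restrict (wedge θmin θmax h M)))
    (hB : ∀ j, MemLp (B j) 2 (volume.restrict (wedge θmin θmax h M)))
    (hip : IntegrableOn hp (Metric.ball 0 δ) (faceMeasure θmax h M))
    (him : IntegrableOn hm (Metric.ball 0 δ) (faceMeasure θmin h M))
    (hplus : ∀ φ : E3 → ℂ, ContDiff ℝ ∞ φ → tsupport φ ⊆ Metric.ball 0 δ →
      tsupport φ ∩ frontier (wedge θmin θmax h M) ⊆ openFace θmax h M →
      ∫ x in wedge θmin θmax h M,
        (A x * φ x + ∑ j, B j x * fderiv ℝ φ x (EuclideanSpace.single j 1)) =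
      ∫ x, hp x * φ x ∂faceMeasure θmax h M)
    (hminus : ∀ φ : E3 → ℂ, ContDiff ℝ ∞ φ → tsupport φ ⊆ Metric.ball 0 δ →
      tsupport φ ∩ frontier (wedge θmin θmax h M) ⊆ openFace θmin h M →
      ∫ x in wedge θmin θmax h M,
        (A x * φ x + ∑ j, B j x * fderiv ℝ φ x (EuclideanSpace.single j 1)) =
      ∫ x, hm x * φ x ∂faceMeasure θmin h M) :
    HasWeakFlux θmin θmax h M δ A B hp hm := by
  intro φ hφ hsupp
  have hs : Real.sin (θmax - θmin) ≠ 0 :=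
    (Real.sin_pos_of_pos_of_lt_pi (by linarith) hangle).ne'
  have hfin := isFiniteMeasure_wedge (M := M) hθ hangle hh
  have hmeas : MeasurableSet (wedge θmin θmax h M) := (isOpen_wedge hθ hangle hh).measurableSet
  have hcφ := hasCompactSupport_of_subset_ball hsupp
  set W := wedge θmin θmax h M
  set κ := edgeCutoff θmin θmax with hκ
  set τ := faceCutoff θmin θmax with hτ
  have hκc : ContDiff ℝ ∞ κ := contDiff_edgeCutoff
  have hτc : ContDiff ℝ ∞ τ := contDiff_faceCutoff
  set Tp : E3 → ℝ := fun x => κ x * τ x with hTp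
  set Tm : E3 → ℝ := fun x => κ x * (1 - τ x) with hTm
  have hTpc : ContDiff ℝ ∞ Tp := hκc.mul hτc
  have hTmc : ContDiff ℝ ∞ Tm := hκc.mul (contDiff_const.sub hτc)
  -- With `p`, `q` the oblique coordinates, the support of `κ (s • x)` lies in `s (p + q) ≥ 1`, and
  -- that of `τ (s • x)` in `s (q - p) ≤ 1 / 2`. Together these exclude `p = 0`, leaving only the
  -- face at `θmax` on the boundary; `1 - τ` behaves symmetrically. Both conditions are closed, so
  -- they pass to `tsupport`.
  have hsupport : ∀ s : ℝ, 0 < s →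
      tsupport (fun x => φ x * (Tp (s • x) : ℂ)) ∩ frontier W ⊆ openFace θmax h M ∧
      tsupport (fun x => φ x * (Tm (s • x) : ℂ)) ∩ frontier W ⊆ openFace θmin h M := by
    intro s hs0
    have hPc := (obliqueP θmin θmax).continuous
    have hQc := (obliqueQ θmin θmax).continuous
    have hedge : ∀ x, κ (s • x) ≠ 0 → 1 ≤ s * obliqueP θmin θmax x + s * obliqueQ θmin θmax x := by
      intro x hx
      by_contra! hlt
      apply hx
      rw [hκ, edgeCutoff, map_smul, map_smul, smul_eq_mul, smul_eq_mul]
      exact Real.smoothTransition.zero_of_nonpos (by linarith)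
    constructor
    · rintro x ⟨hx, hxf⟩
      have h1 := tsupport_dilate_subset (T := Tp) (s := s)
        (S := {x | 1 ≤ s * obliqueP θmin θmax x + s * obliqueQ θmin θmax x} ∩
          {x | s * obliqueQ θmin θmax x - s * obliqueP θmin θmax x ≤ 1 / 2})
        ((isClosed_le continuous_const (by fun_prop)).inter
          (isClosed_le (by fun_prop) continuous_const)) (fun x hx => by
          refine ⟨hedge x (left_ne_zero_of_mul hx), ?_⟩
          have h2 := right_ne_zero_of_mul hx
          by_contra hlt
          simp only [mem_ofPred_eq, not_le] at hlt
          apply h2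
          rw [hτ, faceCutoff, map_smul, map_smul, smul_eq_mul, smul_eq_mul]
          exact Real.smoothTransition.zero_of_nonpos (by linarith)) φ hx
      obtain ⟨h2, h3, h4⟩ := h1
      simp only [mem_ofPred_eq] at h3 h4
      have hb := mem_ball_zero_iff.1 (hsupp h2)
      have hf := frontier_wedge hθ hangle hh hxf (hb.trans_le hδh) (hb.trans_le hδM)
      have hq : obliqueQ θmin θmax x = 0 := by
        rcases hf.2.2 with h0 | h0
        · rw [h0] at h3 h4; linarith
        · exact h0
      rw [hq, mul_zero, add_zero] at h3
      exact mem_openFace_max hs (hb.trans_le hδh) (hb.trans_le hδM)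
        (pos_of_mul_pos_right (by linarith) hs0.le) hq
    · rintro x ⟨hx, hxf⟩
      have h1 := tsupport_dilate_subset (T := Tm) (s := s)
        (S := {x | 1 ≤ s * obliqueP θmin θmax x + s * obliqueQ θmin θmax x} ∩
          {x | s * obliqueP θmin θmax x - s * obliqueQ θmin θmax x ≤ 1 / 2})
        ((isClosed_le continuous_const (by fun_prop)).inter
          (isClosed_le (by fun_prop) continuous_const)) (fun x hx => by
          refine ⟨hedge x (left_ne_zero_of_mul hx), ?_⟩
          have h2 := right_ne_zero_of_mul hx
          by_contra hlt
          simp only [mem_ofPred_eq, not_le] at hlt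
          apply h2
          rw [hτ, faceCutoff, map_smul, map_smul, smul_eq_mul, smul_eq_mul, sub_eq_zero]
          exact (Real.smoothTransition.one_of_one_le (by linarith)).symm) φ hx
      obtain ⟨h2, h3, h4⟩ := h1
      simp only [mem_ofPred_eq] at h3 h4
      have hb := mem_ball_zero_iff.1 (hsupp h2)
      have hf := frontier_wedge hθ hangle hh hxf (hb.trans_le hδh) (hb.trans_le hδM)
      have hp0 : obliqueP θmin θmax x = 0 := by
        rcases hf.2.2 with h0 | h0
        · exact h0
        · rw [h0] at h3 h4; linarith
      rw [hp0, mul_zero, zero_add] at h3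
      exact mem_openFace_min hs (hb.trans_le hδh) (hb.trans_le hδM) hp0
        (pos_of_mul_pos_right (by linarith) hs0.le)
  -- the identity for the test function cut off near the edge
  have hcut : ∀ s : ℝ, 0 < s →
      (∫ x in W, (A x * φ x + ∑ j, B j x * fderiv ℝ φ x (EuclideanSpace.single j 1))
          * (κ (s • x) : ℂ))
        + ∑ j, (s : ℂ) * ∫ x in W, (B j x * φ x) *
          ((fderiv ℝ κ (s • x) (EuclideanSpace.single j 1) : ℝ) : ℂ)
      = (∫ x, (hp x * φ x) * (Tp (s • x) : ℂ) ∂faceMeasure θmax h M)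
        + ∫ x, (hm x * φ x) * (Tm (s • x) : ℂ) ∂faceMeasure θmin h M := by
    intro s hs0
    have hφp := mul_dilate_contDiff hφ hTpc s
    have hφm := mul_dilate_contDiff hφ hTmc s
    have hsp : tsupport (fun x => φ x * (Tp (s • x) : ℂ)) ⊆ Metric.ball 0 δ :=
      tsupport_mul_subset_left.trans hsupp
    have hsm : tsupport (fun x => φ x * (Tm (s • x) : ℂ)) ⊆ Metric.ball 0 δ :=
      tsupport_mul_subset_left.trans hsupp
    have e1 := hplus _ hφp hsp (hsupport s hs0).1
    have e2 := hminus _ hφm hsm (hsupport s hs0).2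
    have i1 := integrable_flux hA hB hφp (hasCompactSupport_of_subset_ball hsp)
    have i2 := integrable_flux hA hB hφm (hasCompactSupport_of_subset_ball hsm)
    simp only [mul_assoc]
    simp only [← mul_assoc] at e1 e2
    simp only [mul_assoc] at e1 e2
    rw [← e1, ← e2, ← integral_add i1 i2]
    have j1 : Integrable (fun x => (A x * φ x + ∑ j, B j x *
        fderiv ℝ φ x (EuclideanSpace.single j 1)) * (κ (s • x) : ℂ)) (volume.restrict W) := by
      refine (integrable_flux hA hB hφ hcφ).mul_bdd (c := 1) ?_ ?_
      · exact (Complex.continuous_ofReal.comp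
          (hκc.continuous.comp (continuous_const_smul s))).aestronglyMeasurable
      · exact Eventually.of_forall fun x => by
          rw [Complex.norm_real]; exact norm_smoothTransition_le _
    have j2 : ∀ j, Integrable (fun x => B j x * (φ x *
          ((fderiv ℝ κ (s • x) (EuclideanSpace.single j 1) : ℝ) : ℂ))) (volume.restrict W) := by
      intro j
      refine integrable_mul_of_memLp (hB j) (hφ.continuous.mul (Complex.continuous_ofReal.comp
        (((hκc.continuous_fderiv (by simp)).clm_apply continuous_const).comp
          (continuous_const_smul s)))) ?_
      exact hcφ.mul_right
    rw [← Finset.mul_sum, ← integral_finsetSum _ fun j _ => j2 j, ← integral_const_mul,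
      ← integral_add j1 ((integrable_finsetSum _ fun j _ => j2 j).const_mul _)]
    congr 1 with x
    have hsum : ∀ e : E3, fderiv ℝ (fun x => φ x * (Tp (s • x) : ℂ)) x e +
        fderiv ℝ (fun x => φ x * (Tm (s • x) : ℂ)) x e =
        fderiv ℝ φ x e * (κ (s • x) : ℂ) + s * (φ x * (fderiv ℝ κ (s • x) e : ℝ)) := by
      intro e
      rw [← fderiv_mul_dilate hφ hκc, ← add_apply,
        ← fderiv_add (hφp.differentiable (by simp) x) (hφm.differentiable (by simp) x)]
      congr 2
      ext y
      simp only [Pi.add_apply, hTp, hTm]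
      push_cast; ring
    have hT : ((Tp (s • x) : ℝ) : ℂ) + (Tm (s • x) : ℝ) = (κ (s • x) : ℝ) := by
      simp only [hTp, hTm]; push_cast; ring
    rw [add_mul, Finset.sum_mul, Finset.mul_sum, add_add_add_comm, ← Finset.sum_add_distrib,
      add_assoc, ← Finset.sum_add_distrib]
    congr 1
    · rw [← hT]; ring
    · refine Finset.sum_congr rfl fun j _ => ?_
      rw [← mul_add, hsum]; ring
  -- passage to the limit
  have hcone : ∀ᵐ x ∂volume.restrict W, x ∈ cone θmin θmax :=
    (ae_restrict_mem hmeas).mono fun x hx => wedge_subset_cone hθ hangle hh hx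
  have l1 := tendsto_integral_mul_dilate (integrable_flux hA hB hφ hcφ) hκc.continuous
    (fun x => norm_smoothTransition_le _)
    (hcone.mono fun x hx => eventually_edgeCutoff_eq_one (add_pos hx.1 hx.2))
  -- This is the zero capacity of the edge: differentiating the cutoff costs a factor `s`, which the
  -- `o(1/s)` of a concentrated kernel against an `L²` function compensates.
  have l2 : Tendsto (fun s : ℝ => ∑ j, (s : ℂ) * ∫ x in W, (B j x * φ x) *
      ((fderiv ℝ κ (s • x) (EuclideanSpace.single j 1) : ℝ) : ℂ)) atTop (𝓝 0) := by
    have : (0 : ℂ) = ∑ j : Fin 3, 0 := by simp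
    rw [this]
    refine tendsto_finsetSum _ fun j _ => ?_
    obtain ⟨C, hC⟩ := exists_fderiv_edgeCutoff_le (θmin := θmin) (θmax := θmax)
      (EuclideanSpace.single j 1)
    exact tendsto_mul_integral_dilate hθ hangle hh hM
      (K := fun x => ((fderiv ℝ κ x (EuclideanSpace.single j 1) : ℝ) : ℂ))
      (memLp_mul_of_memLp (hB j) hφ.continuous hcφ) one_pos (fun x _ => hC x)
  have hnorm : ∀ a b : ℝ, ‖a‖ ≤ 1 → ‖b‖ ≤ 1 → ‖a * b‖ ≤ 1 := fun a b ha hb => by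
    rw [norm_mul]; exact mul_le_one₀ ha (norm_nonneg _) hb
  have hτ01 : ∀ x, 0 ≤ τ x ∧ τ x ≤ 1 := fun x =>
    ⟨Real.smoothTransition.nonneg _, Real.smoothTransition.le_one _⟩
  have l3 := tendsto_integral_mul_dilate (integrable_mul_of_integrableOn_ball hip hφ.continuous
    hsupp) hTpc.continuous
    (fun x => hnorm _ _ (norm_smoothTransition_le _) (norm_smoothTransition_le _)) (by
      filter_upwards [ae_mem_openFace (h := h) (M := M) θmax] with x hx
      obtain ⟨p, hp, rfl⟩ := hx
      have hp1 : 0 < p.1 := hp.1.1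
      have hP := obliqueP_facePoint_max hs p
      have hQ := obliqueQ_facePoint_max hs p
      filter_upwards [eventually_edgeCutoff_eq_one (x := facePoint θmax p)
        (by rw [hP, hQ]; linarith), eventually_smoothTransition_eq_one hp1 (1 / 2)] with s h1 h2
      simp only [hTp, hκ, hτ, h1, faceCutoff, map_smul, hP, hQ, smul_eq_mul, mul_zero, sub_zero,
        h2, one_mul])
  have l4 := tendsto_integral_mul_dilate (integrable_mul_of_integrableOn_ball him hφ.continuous
    hsupp) hTmc.continuous
    (fun x => hnorm _ _ (norm_smoothTransition_le _) (by
      rw [Real.norm_eq_abs, abs_le]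
      constructor <;> linarith [(hτ01 x).1, (hτ01 x).2])) (by
      filter_upwards [ae_mem_openFace (h := h) (M := M) θmin] with x hx
      obtain ⟨p, hp, rfl⟩ := hx
      have hp1 : 0 < p.1 := hp.1.1
      have hP := obliqueP_facePoint_min hs p
      have hQ := obliqueQ_facePoint_min hs p
      have hgt : ∀ᶠ s : ℝ in atTop, 1 / 2 ≤ s * p.1 :=
        (tendsto_id.atTop_mul_const hp1).eventually_ge_atTop _
      filter_upwards [eventually_edgeCutoff_eq_one (x := facePoint θmin p)
        (by rw [hP, hQ]; linarith), hgt] with s h1 h2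
      have h3 : Real.smoothTransition (s * 0 - s * p.1 + 1 / 2) = 0 :=
        Real.smoothTransition.zero_of_nonpos (by linarith)
      simp only [hTm, hκ, hτ, h1, faceCutoff, map_smul, hP, hQ, smul_eq_mul, h3, one_mul,
        sub_zero])
  have l5 := l1.add l2
  rw [add_zero] at l5
  refine tendsto_nhds_unique l5 ((l3.add l4).congr' ?_)
  filter_upwards [eventually_gt_atTop 0] with s hs0
  exact (hcut s hs0).symm

/-! ### Face data, and the flux identities for traces and tractions. -/

/-- On the open face at angle `θ`, `k` depends only on the distance `r` to the edge, through the
function `kt`, which is continuous, bounded for `r < δ`, and tends to `k0` at the edge. -/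
structure IsFaceProfile (θ h M δ : ℝ) (k : E3 → ℂ) (kt : ℝ → ℂ) (k0 : ℂ) : Prop where
  eq : ∀ r ∈ Ioo 0 h, ∀ t ∈ Ioo (-M) M, k (facePoint θ (r, t)) = kt r
  cont : ContinuousOn kt (Ioo 0 h)
  lim : Tendsto kt (𝓝[>] 0) (𝓝 k0)
  bdd : ∃ C, ∀ r ∈ Ioo 0 δ, ‖kt r‖ ≤ C

theorem IsFaceProfile.const_mul {θ : ℝ} {k : E3 → ℂ} {kt : ℝ → ℂ} {k0 : ℂ}
    (hk : IsFaceProfile θ h M δ k kt k0) (c : ℂ) :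
    IsFaceProfile θ h M δ (fun x => c * k x) (fun r => c * kt r) (c * k0) where
  eq r hr t ht := by rw [hk.eq r hr t ht]
  cont := continuousOn_const.mul hk.cont
  lim := hk.lim.const_mul c
  bdd := by
    obtain ⟨C, hC⟩ := hk.bdd
    exact ⟨‖c‖ * C, fun r hr => by rw [norm_mul]; gcongr; exact hC r hr⟩

theorem IsFaceProfile.aestronglyMeasurable {θ : ℝ} {k : E3 → ℂ} {kt : ℝ → ℂ} {k0 : ℂ}
    (hk : IsFaceProfile θ h M δ k kt k0) : AEStronglyMeasurable k (faceMeasure θ h M) := by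
  unfold faceMeasure
  rw [(measurableEmbedding_facePoint θ).aestronglyMeasurable_map_iff]
  have hm : MeasurableSet (Ioo 0 h ×ˢ Ioo (-M) M) := measurableSet_Ioo.prod measurableSet_Ioo
  have h1 : ContinuousOn (fun p : ℝ × ℝ => kt p.1) (Ioo 0 h ×ˢ Ioo (-M) M) :=
    hk.cont.comp continuous_fst.continuousOn fun p hp => hp.1
  refine (h1.aestronglyMeasurable hm).congr ?_
  filter_upwards [ae_restrict_mem hm] with p hp
  exact (hk.eq p.1 hp.1 p.2 hp.2).symm

theorem fst_le_norm_facePoint (θ : ℝ) (p : ℝ × ℝ) : p.1 ≤ ‖facePoint θ p‖ :=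
  (le_abs_self _).trans (abs_le_of_sq_le_sq
    (by nlinarith [sq_nonneg p.2, norm_facePoint_sq θ p]) (norm_nonneg _))

theorem IsFaceProfile.integrableOn {θ : ℝ} {k : E3 → ℂ} {kt : ℝ → ℂ} {k0 : ℂ}
    (hk : IsFaceProfile θ h M δ k kt k0) :
    IntegrableOn k (Metric.ball 0 δ) (faceMeasure θ h M) := by
  obtain ⟨C, hC⟩ := hk.bdd
  refine Integrable.of_bound hk.aestronglyMeasurable.restrict C ?_
  filter_upwards [ae_restrict_of_ae (ae_mem_openFace θ), ae_restrict_mem Metric.isOpen_ball.measurableSet]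
    with x hx hb
  obtain ⟨p, hp, rfl⟩ := hx
  have := hk.eq p.1 hp.1 p.2 hp.2
  rw [this]
  exact hC _ ⟨hp.1.1, (fst_le_norm_facePoint θ p).trans_lt (mem_ball_zero_iff.1 hb)⟩

/-- On a finite measure space `L²` convergence gives `L¹` convergence, and the test function is
bounded. It serves both for the volume and for the face terms in Green's formula. -/
theorem tendsto_integral_mul_of_eLpNorm {μ : Measure E3} [IsFiniteMeasure μ] {a : ℕ → E3 → ℂ}
    {u b : E3 → ℂ} (hu : AEStronglyMeasurable u μ) (ha : ∀ n, Continuous (a n))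
    (hlim : Tendsto (fun n => eLpNorm (fun x => a n x - u x) 2 μ) atTop (𝓝 0))
    (hb : Continuous b) (hc : HasCompactSupport b) (hub : Integrable (fun x => u x * b x) μ) :
    Tendsto (fun n => ∫ x, a n x * b x ∂μ) atTop (𝓝 (∫ x, u x * b x ∂μ)) := by
  obtain ⟨C, hC⟩ := hc.exists_bound_of_continuous hb
  refine tendsto_integral_of_L1' _ hub.aestronglyMeasurable (Eventually.of_forall fun n => ?_) ?_
  · exact ((ha n).mul hb).integrable_of_hasCompactSupport hc.mul_left
  · set K : ℝ≥0∞ := ENNReal.ofReal C * (μ univ) ^ (1 / (1 : ℝ≥0∞).toReal - 1 / (2 : ℝ≥0∞).toReal)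
    have hK : K ≠ ⊤ := ENNReal.mul_ne_top ENNReal.ofReal_ne_top
      (ENNReal.rpow_ne_top_of_nonneg (by norm_num) (measure_ne_top μ _))
    have h0 : Tendsto (fun n => K * eLpNorm (fun x => a n x - u x) 2 μ) atTop (𝓝 0) := by
      simpa using ENNReal.Tendsto.const_mul hlim (Or.inr hK)
    refine tendsto_of_tendsto_of_tendsto_of_le_of_le tendsto_const_nhds h0
      (fun _ => zero_le) fun n => ?_
    have hmeas : AEStronglyMeasurable (fun x => a n x - u x) μ :=
      (ha n).aestronglyMeasurable.sub hu
    calc eLpNorm ((fun x => a n x * b x) - fun x => u x * b x) 1 μ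
        ≤ ENNReal.ofReal C * eLpNorm (fun x => a n x - u x) 1 μ := by
          refine eLpNorm_le_mul_eLpNorm_of_ae_le_mul (Eventually.of_forall fun x => ?_) 1
          simp only [Pi.sub_apply]
          rw [← sub_mul, norm_mul, mul_comm]
          gcongr
          exact hC x
      _ ≤ ENNReal.ofReal C * (eLpNorm (fun x => a n x - u x) 2 μ *
            (μ univ) ^ (1 / (1 : ℝ≥0∞).toReal - 1 / (2 : ℝ≥0∞).toReal)) := by
          gcongr
          exact eLpNorm_le_eLpNorm_mul_rpow_measure_univ (by norm_num) hmeas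
      _ = K * eLpNorm (fun x => a n x - u x) 2 μ := by simp only [K]; ring

/-- Such a point is reached from inside along `e₊ + e₋`, the vector with oblique coordinates `(1, 1,
0)`. -/
theorem mem_frontier_of_cone_direction (hθ : θmin < θmax) (hangle : θmax - θmin < Real.pi)
    (hh : 0 < h) {x : E3} (hxh : ‖x‖ < h) (hxM : ‖x‖ < M) (hp : 0 ≤ obliqueP θmin θmax x)
    (hq : 0 ≤ obliqueQ θmin θmax x) (hpq : obliqueP θmin θmax x = 0 ∨ obliqueQ θmin θmax x = 0) :
    x ∈ frontier (wedge θmin θmax h M) := by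
  have hs : Real.sin (θmax - θmin) ≠ 0 :=
    (Real.sin_pos_of_pos_of_lt_pi (by linarith) hangle).ne'
  refine ⟨?_, fun hx => ?_⟩
  · set e : E3 := oblique θmin θmax hs (1, 1, 0)
    have hcont : Continuous fun s : ℝ => x + s • e := by fun_prop
    have hlim : Tendsto (fun s : ℝ => x + s • e) (𝓝[>] 0) (𝓝 x) := by
      have := (hcont.tendsto 0).mono_left (nhdsWithin_le_nhds (s := Ioi (0 : ℝ)))
      simpa using this
    refine mem_closure_of_tendsto hlim ?_
    filter_upwards [hlim.norm.eventually_lt_const hxh, hlim.norm.eventually_lt_const hxM,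
      self_mem_nhdsWithin] with s h1 h2 h3
    refine mem_wedge_of_mem_cone hθ hangle hh ⟨?_, ?_⟩ h1 h2
    · rw [map_add, map_smul, obliqueP_oblique, smul_eq_mul, mul_one]
      exact add_pos_of_nonneg_of_pos hp h3
    · rw [map_add, map_smul, obliqueQ_oblique, smul_eq_mul, mul_one]
      exact add_pos_of_nonneg_of_pos hq h3
  · have := wedge_subset_cone hθ hangle hh (interior_subset hx)
    rcases hpq with h0 | h0
    · exact this.1.ne' h0
    · exact this.2.ne' h0

/-- The opposite open face consists of boundary points with positive second oblique coordinate,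
which is zero on the face at `θmax`. A support touching the boundary only in the latter thus misses
the former. -/
theorem integral_face_min_eq_zero (hθ : θmin < θmax) (hangle : θmax - θmin < Real.pi)
    (hh : 0 < h) (hδh : δ ≤ h) (hδM : δ ≤ M) {φ : E3 → ℂ} (hsupp : tsupport φ ⊆ Metric.ball 0 δ)
    (hf : tsupport φ ∩ frontier (wedge θmin θmax h M) ⊆ openFace θmax h M) (b : E3 → ℂ) :
    ∫ x, b x * φ x ∂faceMeasure θmin h M = 0 := by
  have hs : Real.sin (θmax - θmin) ≠ 0 :=
    (Real.sin_pos_of_pos_of_lt_pi (by linarith) hangle).ne'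
  refine integral_eq_zero_of_ae ?_
  filter_upwards [ae_mem_openFace θmin] with x hx
  suffices hxs : x ∉ tsupport φ by
    rw [Pi.zero_apply, image_eq_zero_of_notMem_tsupport hxs, mul_zero]
  intro hxs
  have hb := mem_ball_zero_iff.1 (hsupp hxs)
  obtain ⟨p, hp, rfl⟩ := hx
  have hp0 : 0 < p.1 := hp.1.1
  obtain ⟨p', hp', he⟩ := hf ⟨hxs, mem_frontier_of_cone_direction hθ hangle hh (hb.trans_le hδh)
    (hb.trans_le hδM) (obliqueP_facePoint_min hs p).ge
    (by rw [obliqueQ_facePoint_min hs]; exact hp0.le) (Or.inl (obliqueP_facePoint_min hs p))⟩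
  have h1 := obliqueQ_facePoint_max hs p'
  rw [he, obliqueQ_facePoint_min hs] at h1
  exact hp0.ne' h1

theorem integral_face_max_eq_zero (hθ : θmin < θmax) (hangle : θmax - θmin < Real.pi)
    (hh : 0 < h) (hδh : δ ≤ h) (hδM : δ ≤ M) {φ : E3 → ℂ} (hsupp : tsupport φ ⊆ Metric.ball 0 δ)
    (hf : tsupport φ ∩ frontier (wedge θmin θmax h M) ⊆ openFace θmin h M) (b : E3 → ℂ) :
    ∫ x, b x * φ x ∂faceMeasure θmax h M = 0 := by
  have hs : Real.sin (θmax - θmin) ≠ 0 :=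
    (Real.sin_pos_of_pos_of_lt_pi (by linarith) hangle).ne'
  refine integral_eq_zero_of_ae ?_
  filter_upwards [ae_mem_openFace θmax] with x hx
  suffices hxs : x ∉ tsupport φ by
    rw [Pi.zero_apply, image_eq_zero_of_notMem_tsupport hxs, mul_zero]
  intro hxs
  have hb := mem_ball_zero_iff.1 (hsupp hxs)
  obtain ⟨p, hp, rfl⟩ := hx
  have hp0 : 0 < p.1 := hp.1.1
  obtain ⟨p', hp', he⟩ := hf ⟨hxs, mem_frontier_of_cone_direction hθ hangle hh (hb.trans_le hδh)
    (hb.trans_le hδM) (by rw [obliqueP_facePoint_max hs]; exact hp0.le)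
    (obliqueQ_facePoint_max hs p).ge (Or.inr (obliqueQ_facePoint_max hs p))⟩
  have h1 := obliqueP_facePoint_min hs p'
  rw [he, obliqueP_facePoint_max hs] at h1
  exact hp0.ne' h1

/-- Green's formula for an `L²`-limit of smooth functions. -/
theorem trace_identity {N : ℂ} {θ : ℝ} {D : Set E3} (hDfin : IsFiniteMeasure (volume.restrict D))
    {u : E3 → Fin 3 → ℂ} {G : E3 → Fin 3 → Fin 3 → ℂ} {f : E3 → Fin 3 → ℂ}
    (hu : ∀ i, MemLp (fun x => u x i) 2 (volume.restrict D))
    (hG : ∀ i j, MemLp (fun x => G x i j) 2 (volume.restrict D))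
    (htr : HasTraceOnFace D θ h M u G f) (i j : Fin 3)
    (hf : AEStronglyMeasurable (fun x => f x i) (faceMeasure θ h M)) {φ : E3 → ℂ}
    (hφ : ContDiff ℝ ∞ φ) (hc : HasCompactSupport φ)
    (hfφ : Integrable (fun x => f x i * φ x) (faceMeasure θ h M))
    (hdiv : ∀ a : E3 → ℂ, ContDiff ℝ ∞ a →
      ∫ x in D, fderiv ℝ (fun y => a y * φ y) x (EuclideanSpace.single j 1) =
        N * ∫ x, a x * φ x ∂faceMeasure θ h M) :
    (∫ x in D, G x i j * φ x) + ∫ x in D, u x i * fderiv ℝ φ x (EuclideanSpace.single j 1)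
      = N * ∫ x, f x i * φ x ∂faceMeasure θ h M := by
  obtain ⟨a, ha, hau, haG, haf⟩ := htr
  have hai : ∀ n k, ContDiff ℝ ∞ fun x => a n x k := fun n k => contDiff_pi.1 (ha n) k
  have hjac : ∀ n x, jac (a n) x i j = fderiv ℝ (fun y => a n y i) x (EuclideanSpace.single j 1) := by
    intro n x
    have h1 : HasFDerivAt (fun y => a n y i)
        ((ContinuousLinearMap.proj i).comp (fderiv ℝ (a n) x)) x :=
      (ContinuousLinearMap.proj (R := ℝ) (φ := fun _ : Fin 3 => ℂ) i).hasFDerivAt.comp x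
        ((ha n).differentiable (by simp) x).hasFDerivAt
    rw [h1.fderiv]
    rfl
  have hcd : HasCompactSupport fun x => fderiv ℝ φ x (EuclideanSpace.single j 1) :=
    hc.fderiv_apply ℝ _
  have hφd := continuous_fderiv_single hφ (EuclideanSpace.single j 1)
  have l1 := tendsto_integral_mul_of_eLpNorm (hG i j).aestronglyMeasurable (a := fun n x => jac (a n) x i j)
    (fun n => by simp only [hjac]; exact continuous_fderiv_single (hai n i) _) (haG i j)
    hφ.continuous hc (integrable_mul_of_memLp (hG i j) hφ.continuous hc)
  have l2 := tendsto_integral_mul_of_eLpNorm (hu i).aestronglyMeasurable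
    (fun n => (hai n i).continuous) (hau i) hφd hcd (integrable_mul_of_memLp (hu i) hφd hcd)
  have l3 := (tendsto_integral_mul_of_eLpNorm hf (fun n => (hai n i).continuous) (haf i)
    hφ.continuous hc hfφ).const_mul N
  refine tendsto_nhds_unique (l1.add l2) (l3.congr fun n => ?_)
  rw [← hdiv _ (hai n i), ← integral_add]
  · congr 1 with x
    have := (((hai n i).differentiable (by simp) x).hasFDerivAt.mul
      (hφ.differentiable (by simp) x).hasFDerivAt).fderiv
    rw [hjac]
    change fderiv ℝ ((fun y => a n y i) * φ) x _ = _
    rw [this]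
    simp
    ring
  · simp only [hjac]
    exact ((continuous_fderiv_single (hai n i) _).mul hφ.continuous).integrable_of_hasCompactSupport
      hc.mul_left
  · exact ((hai n i).continuous.mul hφd).integrable_of_hasCompactSupport hcd.mul_left

/-- Green's formula for `u ∈ H¹` with traces `f₁`, `f₂` on the two faces. -/
theorem exists_trace_flux (hθ : θmin < θmax) (hangle : θmax - θmin < Real.pi)
    (hh : 0 < h) (hM : 0 < M) (hδh : δ ≤ h) (hδM : δ ≤ M)
    {u : E3 → Fin 3 → ℂ} {G : E3 → Fin 3 → Fin 3 → ℂ} {f₁ f₂ : E3 → Fin 3 → ℂ}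
    (hu : ∀ i, MemLp (fun x => u x i) 2 (volume.restrict (wedge θmin θmax h M)))
    (hG : ∀ i j, MemLp (fun x => G x i j) 2 (volume.restrict (wedge θmin θmax h M)))
    (htr₁ : HasTraceOnFace (wedge θmin θmax h M) θmax h M u G f₁)
    (htr₂ : HasTraceOnFace (wedge θmin θmax h M) θmin h M u G f₂)
    {ft₁ ft₂ : Fin 3 → ℝ → ℂ} {f₁0 f₂0 : Fin 3 → ℂ}
    (hf₁ : ∀ i, IsFaceProfile θmax h M δ (fun x => f₁ x i) (ft₁ i) (f₁0 i))
    (hf₂ : ∀ i, IsFaceProfile θmin h M δ (fun x => f₂ x i) (ft₂ i) (f₂0 i)) :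
    ∃ c : ℝ, 0 < c ∧ ∀ i j, HasWeakFlux θmin θmax h M δ (fun x => G x i j)
      (fun m x => if m = j then u x i else 0)
      (fun x => ((-c * obliqueQ θmin θmax (EuclideanSpace.single j 1) : ℝ) : ℂ) * f₁ x i)
      (fun x => ((-c * obliqueP θmin θmax (EuclideanSpace.single j 1) : ℝ) : ℂ) * f₂ x i) := by
  obtain ⟨c, hc0, hdiv⟩ := exists_integral_wedge_fderiv (M := M) hθ hangle hh
  have hfin := isFiniteMeasure_wedge (M := M) hθ hangle hh
  refine ⟨c, hc0, fun i j => ?_⟩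
  set W := wedge θmin θmax h M
  have hB : ∀ m, MemLp (fun x => if m = j then u x i else 0) 2 (volume.restrict W) := by
    intro m
    by_cases hm : m = j
    · simpa [hm] using hu i
    · simp [hm]
  have hsplit : ∀ φ : E3 → ℂ, ContDiff ℝ ∞ φ → HasCompactSupport φ →
      ∫ x in W, (G x i j * φ x + ∑ m, (if m = j then u x i else 0) *
        fderiv ℝ φ x (EuclideanSpace.single m 1)) =
      (∫ x in W, G x i j * φ x) + ∫ x in W, u x i * fderiv ℝ φ x (EuclideanSpace.single j 1) := by
    intro φ hφ hc
    rw [← integral_add (integrable_mul_of_memLp (hG i j) hφ.continuous hc)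
      (integrable_mul_of_memLp (hu i) (continuous_fderiv_single hφ _) (hc.fderiv_apply ℝ _))]
    simp [ite_mul]
  refine hasWeakFlux_of_faces hθ hangle hh hM hδh hδM (hG i j) hB
    ((hf₁ i).const_mul _).integrableOn ((hf₂ i).const_mul _).integrableOn ?_ ?_
  · intro φ hφ hsupp hfr
    have hc := hasCompactSupport_of_subset_ball hsupp
    rw [hsplit φ hφ hc]
    simp only [mul_assoc]
    rw [integral_const_mul]
    refine trace_identity hfin hu hG htr₁ i j (hf₁ i).aestronglyMeasurable hφ hc
      (integrable_mul_of_integrableOn_ball (hf₁ i).integrableOn hφ.continuous hsupp) ?_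
    intro a ha
    rw [hdiv δ hδh hδM _ ((ha.mul hφ).of_le (by simp)) (tsupport_mul_subset_right.trans hsupp),
      integral_face_min_eq_zero hθ hangle hh hδh hδM hsupp hfr, mul_zero, add_zero]
  · intro φ hφ hsupp hfr
    have hc := hasCompactSupport_of_subset_ball hsupp
    rw [hsplit φ hφ hc]
    simp only [mul_assoc]
    rw [integral_const_mul]
    refine trace_identity hfin hu hG htr₂ i j (hf₂ i).aestronglyMeasurable hφ hc
      (integrable_mul_of_integrableOn_ball (hf₂ i).integrableOn hφ.continuous hsupp) ?_
    intro a ha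
    rw [hdiv δ hδh hδM _ ((ha.mul hφ).of_le (by simp)) (tsupport_mul_subset_right.trans hsupp),
      integral_face_max_eq_zero hθ hangle hh hδh hδM hsupp hfr, mul_zero, zero_add]

theorem hasTraceOnFace_sub_const {D : Set E3} {θ : ℝ} {u : E3 → Fin 3 → ℂ}
    {G : E3 → Fin 3 → Fin 3 → ℂ} {f : E3 → Fin 3 → ℂ} (htr : HasTraceOnFace D θ h M u G f)
    (c : Fin 3 → ℂ) :
    HasTraceOnFace D θ h M (fun x => u x - c) G (fun x => f x - c) := by
  obtain ⟨a, ha, hau, haG, haf⟩ := htr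
  refine ⟨fun n x => a n x - c, fun n => (ha n).sub contDiff_const, fun i => ?_, fun i j => ?_,
    fun i => ?_⟩
  · simpa using hau i
  · have : ∀ n x, jac (fun x => a n x - c) x i j = jac (a n) x i j := fun n x => by
      simp [jac, fderiv_sub_const]
    simpa only [this] using haG i j
  · simpa using haf i

/-- The traction jumps as fluxes of the stress rows. -/
theorem traction_flux {lam μ freq : ℝ} (hθ : θmin < θmax) (hangle : θmax - θmin < Real.pi)
    (hh : 0 < h) (hM : 0 < M) (hδh : δ ≤ h) (hδM : δ ≤ M)
    {v w : E3 → Fin 3 → ℂ} {Gv Gw : E3 → Fin 3 → Fin 3 → ℂ} {g₁ g₂ : E3 → Fin 3 → ℂ}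
    (hv : IsH1 (wedge θmin θmax h M) v Gv) (hw : IsH1 (wedge θmin θmax h M) w Gw)
    (htr₁ : HasTractionJumpOnFace lam μ freq (wedge θmin θmax h M) θmax h M v Gv w Gw g₁)
    (htr₂ : HasTractionJumpOnFace lam μ freq (wedge θmin θmax h M) θmin h M v Gv w Gw g₂)
    {gt₁ gt₂ : Fin 3 → ℝ → ℂ} {g₁0 g₂0 : Fin 3 → ℂ}
    (hg₁ : ∀ i, IsFaceProfile θmax h M δ (fun x => g₁ x i) (gt₁ i) (g₁0 i))
    (hg₂ : ∀ i, IsFaceProfile θmin h M δ (fun x => g₂ x i) (gt₂ i) (g₂0 i)) (i : Fin 3) :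
    HasWeakFlux θmin θmax h M δ (fun x => -(freq : ℂ) ^ 2 * (w - v) x i)
      (fun j x => stress lam μ ((Gw - Gv) x) i j) (fun x => g₁ x i) (fun x => g₂ x i) := by
  have hfin := isFiniteMeasure_wedge (M := M) hθ hangle hh
  set W := wedge θmin θmax h M
  have hstress : ∀ G : E3 → Fin 3 → Fin 3 → ℂ, (∀ i j, MemLp (fun x => G x i j) 2 (volume.restrict W)) →
      ∀ j, MemLp (fun x => stress lam μ (G x) i j) 2 (volume.restrict W) := by
    intro G hG j
    unfold stress
    refine MemLp.add ?_ (((hG i j).add (hG j i)).const_mul _)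
    exact ((memLp_finsetSum _ fun k _ => hG k k).const_mul _).mul_const _
  have hGsub : ∀ i j, MemLp (fun x => (Gw - Gv) x i j) 2 (volume.restrict W) :=
    fun i j => (hw.memLp_grad i j).sub (hv.memLp_grad i j)
  have husub : ∀ i, MemLp (fun x => (w - v) x i) 2 (volume.restrict W) :=
    fun i => (hw.memLp i).sub (hv.memLp i)
  have hjac : ∀ φ : E3 → ℂ, ContDiff ℝ ∞ φ → ∀ x k j, jac (fun x => Pi.single i (φ x)) x k j =
      if k = i then fderiv ℝ φ x (EuclideanSpace.single j 1) else 0 := by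
    intro φ hφ x k j
    have h1 : HasFDerivAt (fun x => (Pi.single i (φ x) : Fin 3 → ℂ))
        ((ContinuousLinearMap.single ℝ (fun _ : Fin 3 => ℂ) i).comp (fderiv ℝ φ x)) x :=
      (ContinuousLinearMap.single ℝ (fun _ : Fin 3 => ℂ) i).hasFDerivAt.comp x
        (hφ.differentiable (by simp) x).hasFDerivAt
    rw [jac, h1.fderiv]
    simp [Pi.single_apply]
  -- The test field `φ eᵢ` extracts the `i`-th row of the stress, which turns the vector identity
  -- into a scalar flux. Linearity of the stress then combines the two solutions into their
  -- difference.
  have hform : ∀ φ : E3 → ℂ, ContDiff ℝ ∞ φ → HasCompactSupport φ →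
      weakTraction lam μ freq W w Gw (fun x => Pi.single i (φ x))
        - weakTraction lam μ freq W v Gv (fun x => Pi.single i (φ x)) =
      ∫ x in W, (-(freq : ℂ) ^ 2 * (w - v) x i * φ x
        + ∑ j, stress lam μ ((Gw - Gv) x) i j * fderiv ℝ φ x (EuclideanSpace.single j 1)) := by
    intro φ hφ hc
    have hone : ∀ (u : E3 → Fin 3 → ℂ) (G : E3 → Fin 3 → Fin 3 → ℂ),
        weakTraction lam μ freq W u G (fun x => Pi.single i (φ x)) =
        ∫ x in W, (-(freq : ℂ) ^ 2 * u x i * φ x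
        + ∑ j, stress lam μ (G x) i j * fderiv ℝ φ x (EuclideanSpace.single j 1)) := by
      intro u G
      unfold weakTraction
      congr 1 with x
      simp only [hjac φ hφ, mul_ite, mul_zero, Pi.single_apply]
      rw [Finset.sum_comm]
      simp
      ring
    rw [hone, hone, ← integral_sub]
    · congr 1 with x
      simp only [stress, Pi.sub_apply, Fin.sum_univ_three]
      ring
    · exact integrable_flux ((hw.memLp i).const_mul _) (hstress _ hw.memLp_grad) hφ hc
    · exact integrable_flux ((hv.memLp i).const_mul _) (hstress _ hv.memLp_grad) hφ hc
  have hfield : ∀ φ : E3 → ℂ, ContDiff ℝ ∞ φ → ContDiff ℝ ∞ fun x => (Pi.single i (φ x) : Fin 3 → ℂ) :=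
    fun φ hφ => (ContinuousLinearMap.single ℝ (fun _ : Fin 3 => ℂ) i).contDiff.comp hφ
  have hfsupp : ∀ φ : E3 → ℂ, tsupport (fun x => (Pi.single i (φ x) : Fin 3 → ℂ)) ⊆ tsupport φ :=
    fun φ => tsupport_comp_subset (g := fun z : ℂ => (Pi.single i z : Fin 3 → ℂ)) (by simp) φ
  have hpair : ∀ (g : E3 → Fin 3 → ℂ) (φ : E3 → ℂ) (x : E3),
      ∑ k, g x k * (Pi.single i (φ x) : Fin 3 → ℂ) k = g x i * φ x := fun g φ x => by
    simp [Pi.single_apply]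
  refine hasWeakFlux_of_faces hθ hangle hh hM hδh hδM ((husub i).const_mul _) (hstress _ hGsub)
    (hg₁ i).integrableOn (hg₂ i).integrableOn ?_ ?_
  · intro φ hφ hsupp hfr
    have hc := hasCompactSupport_of_subset_ball hsupp
    rw [← hform φ hφ hc, htr₁ _ (hfield φ hφ)
      (hc.of_isClosed_subset (isClosed_tsupport _) (hfsupp φ))
      ((inter_subset_inter_left _ (hfsupp φ)).trans hfr)]
    simp only [hpair]
  · intro φ hφ hsupp hfr
    have hc := hasCompactSupport_of_subset_ball hsupp
    rw [← hform φ hφ hc, htr₂ _ (hfield φ hφ)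
      (hc.of_isClosed_subset (isClosed_tsupport _) (hfsupp φ))
      ((inter_subset_inter_left _ (hfsupp φ)).trans hfr)]
    simp only [hpair]

/-! ### Polynomial-exponential test functions and their decay. -/

/-- With `z = x₀ + ι x₁` and `z' = x₀ - ι x₁`, the function `(c₁ + c₂ z') exp (-ρ z)`. -/
noncomputable def expPoly (ι ρ : ℂ) (c : ℂ × ℂ) (x : E3) : ℂ :=
  (c.1 + c.2 * ((x 0 : ℂ) - ι * x 1)) * Complex.exp (-(ρ * ((x 0 : ℂ) + ι * x 1)))

/-- The coefficients of the partial derivatives of `expPoly`. -/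
noncomputable def expPolyDeriv (ι ρ : ℂ) (c : ℂ × ℂ) : Fin 3 → ℂ × ℂ :=
  ![(c.2 - ρ * c.1, -(ρ * c.2)), (-(ι * c.2) - ρ * ι * c.1, -(ρ * ι * c.2)), 0]

theorem hasFDerivAt_ofReal_coord (i : Fin 3) (x : E3) :
    HasFDerivAt (fun y : E3 => ((y i : ℝ) : ℂ))
      (Complex.ofRealCLM.comp (EuclideanSpace.proj (𝕜 := ℝ) i : E3 →L[ℝ] ℝ)) x :=
  (Complex.ofRealCLM.comp (EuclideanSpace.proj (𝕜 := ℝ) i : E3 →L[ℝ] ℝ)).hasFDerivAt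

theorem contDiff_ofReal_coord (i : Fin 3) : ContDiff ℝ ∞ fun y : E3 => ((y i : ℝ) : ℂ) :=
  (Complex.ofRealCLM.comp (EuclideanSpace.proj (𝕜 := ℝ) i : E3 →L[ℝ] ℝ)).contDiff

theorem contDiff_expPoly (ι ρ : ℂ) (c : ℂ × ℂ) : ContDiff ℝ ∞ (expPoly ι ρ c) := by
  unfold expPoly
  have h0 := contDiff_ofReal_coord 0
  have h1 := contDiff_ofReal_coord 1
  exact (contDiff_const.add (contDiff_const.mul (h0.sub (contDiff_const.mul h1)))).mul
    (contDiff_const.mul (h0.add (contDiff_const.mul h1))).neg.cexp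

theorem fderiv_expPoly (ι ρ : ℂ) (c : ℂ × ℂ) (x : E3) (j : Fin 3) :
    fderiv ℝ (expPoly ι ρ c) x (EuclideanSpace.single j 1) =
      expPoly ι ρ (expPolyDeriv ι ρ c j) x := by
  have h0 := hasFDerivAt_ofReal_coord 0 x
  have h1 := hasFDerivAt_ofReal_coord 1 x
  have hd := (((h0.sub (h1.const_mul ι)).const_mul c.2).const_add c.1).mul
    ((h0.add (h1.const_mul ι)).const_mul ρ).neg.cexp
  have he : fderiv ℝ (expPoly ι ρ c) x = _ := hd.fderiv
  rw [he]
  fin_cases j <;> simp [expPoly, expPolyDeriv] <;> ring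

theorem contDiff_mul_expPoly {ξ : E3 → ℂ} (hξ : ContDiff ℝ ∞ ξ) (ι ρ : ℂ) (c : ℂ × ℂ) (s : ℝ) :
    ContDiff ℝ ∞ fun x => ξ x * expPoly ι ρ c (s • x) :=
  hξ.mul ((contDiff_expPoly ι ρ c).comp (contDiff_const_smul s))

theorem fderiv_mul_expPoly {ξ : E3 → ℂ} (hξ : ContDiff ℝ ∞ ξ) (ι ρ : ℂ) (c : ℂ × ℂ) (s : ℝ)
    (x : E3) (j : Fin 3) :
    fderiv ℝ (fun x => ξ x * expPoly ι ρ c (s • x)) x (EuclideanSpace.single j 1) =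
      fderiv ℝ ξ x (EuclideanSpace.single j 1) * expPoly ι ρ c (s • x)
        + s * (ξ x * expPoly ι ρ (expPolyDeriv ι ρ c j) (s • x)) := by
  have h1 : HasFDerivAt ξ (fderiv ℝ ξ x) x := (hξ.differentiable (by simp) x).hasFDerivAt
  have h2 : HasFDerivAt (fun x : E3 => s • x) (s • ContinuousLinearMap.id ℝ E3) x :=
    (hasFDerivAt_id x).const_smul s
  have h3 : HasFDerivAt (expPoly ι ρ c) (fderiv ℝ (expPoly ι ρ c) (s • x)) (s • x) :=
    ((contDiff_expPoly ι ρ c).differentiable (by simp) _).hasFDerivAt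
  have h5 : fderiv ℝ (fun x => ξ x * expPoly ι ρ c (s • x)) x = _ := (h1.mul (h3.comp x h2)).fderiv
  rw [h5, ← fderiv_expPoly]
  simp
  ring

/-- The real part of the exponent is the same for both signs of `ι`: it is the inner product with
the unit vector at angle `θ`. This lets one decay estimate serve the holomorphic and antiholomorphic
exponentials. -/
theorem re_rate_mul {ι : ℂ} (hι : ι = Complex.I ∨ ι = -Complex.I) (θ a b : ℝ) :
    (((Real.cos θ : ℂ) - ι * Real.sin θ) * ((a : ℂ) + ι * b)).re
      = Real.cos θ * a + Real.sin θ * b := by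
  rcases hι with rfl | rfl <;>
  simp [Complex.cos_ofReal_re, Complex.sin_ofReal_re, Complex.cos_ofReal_im,
    Complex.sin_ofReal_im]

theorem eq_of_oblique (hs : Real.sin (θmax - θmin) ≠ 0) (x : E3) :
    x 0 = obliqueP θmin θmax x * Real.cos θmax + obliqueQ θmin θmax x * Real.cos θmin ∧
    x 1 = obliqueP θmin θmax x * Real.sin θmax + obliqueQ θmin θmax x * Real.sin θmin := by
  have h1 := (oblique θmin θmax hs).apply_symm_apply x
  rw [oblique_symm_apply, oblique_apply] at h1
  exact ⟨(congrArg (fun y : E3 => y 0) h1).symm, (congrArg (fun y : E3 => y 1) h1).symm⟩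

/-- On the wedge `expPoly` decays exponentially if `ρ` is the rotation by the bisecting angle. -/
theorem exists_expPoly_le (hθ : θmin < θmax) (hangle : θmax - θmin < Real.pi)
    {ι : ℂ} (hι : ι = Complex.I ∨ ι = -Complex.I) (c : ℂ × ℂ) :
    ∃ C k : ℝ, 0 < k ∧ ∀ x ∈ cone θmin θmax,
      ‖expPoly ι ((Real.cos ((θmin + θmax) / 2) : ℂ) - ι * Real.sin ((θmin + θmax) / 2)) c x‖
        ≤ C * obliqueExp θmin θmax k x := by
  have hs : Real.sin (θmax - θmin) ≠ 0 :=
    (Real.sin_pos_of_pos_of_lt_pi (by linarith) hangle).ne'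
  -- The half-opening is below `π / 2`, so its cosine is positive. The exponential decays at rate
  -- `2k` in `P + Q`; half of that rate absorbs the linear growth of the polynomial factor.
  set k : ℝ := Real.cos ((θmax - θmin) / 2) / 2 with hk
  have hk0 : 0 < k := half_pos (Real.cos_pos_of_mem_Ioo ⟨by linarith, by linarith⟩)
  have hιn : ‖ι‖ = 1 := by rcases hι with rfl | rfl <;> simp
  refine ⟨‖c.1‖ + ‖c.2‖ * (2 / k), k, hk0, fun x hx => ?_⟩
  obtain ⟨e0, e1⟩ := eq_of_oblique hs x
  set P := obliqueP θmin θmax x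
  set Q := obliqueQ θmin θmax x
  have hP : 0 < P := hx.1
  have hQ : 0 < Q := hx.2
  have hre : Real.cos ((θmin + θmax) / 2) * x 0 + Real.sin ((θmin + θmax) / 2) * x 1
      = 2 * k * (P + Q) := by
    have c1 : Real.cos ((θmax - θmin) / 2) = Real.cos ((θmin + θmax) / 2) * Real.cos θmax
        + Real.sin ((θmin + θmax) / 2) * Real.sin θmax := by
      rw [← Real.cos_sub, ← Real.cos_neg]; congr 1; ring
    have c2 : Real.cos ((θmax - θmin) / 2) = Real.cos ((θmin + θmax) / 2) * Real.cos θmin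
        + Real.sin ((θmin + θmax) / 2) * Real.sin θmin := by
      rw [← Real.cos_sub]; congr 1; ring
    rw [hk, e0, e1]
    linear_combination (-P) * c1 - Q * c2
  have hx0 : |x 0| ≤ P + Q := by
    rw [e0]
    refine (abs_add_le _ _).trans ?_
    rw [abs_mul, abs_mul, abs_of_pos hP, abs_of_pos hQ]
    exact add_le_add (mul_le_of_le_one_right hP.le (Real.abs_cos_le_one _))
      (mul_le_of_le_one_right hQ.le (Real.abs_cos_le_one _))
  have hx1 : |x 1| ≤ P + Q := by
    rw [e1]
    refine (abs_add_le _ _).trans ?_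
    rw [abs_mul, abs_mul, abs_of_pos hP, abs_of_pos hQ]
    exact add_le_add (mul_le_of_le_one_right hP.le (Real.abs_sin_le_one _))
      (mul_le_of_le_one_right hQ.le (Real.abs_sin_le_one _))
  have hz : ‖(x 0 : ℂ) - ι * x 1‖ ≤ 2 * (P + Q) := by
    refine (norm_sub_le _ _).trans ?_
    rw [norm_mul, hιn, one_mul, Complex.norm_real, Complex.norm_real, Real.norm_eq_abs,
      Real.norm_eq_abs]
    linarith
  have hexp : 2 * (P + Q) ≤ 2 / k * Real.exp (k * (P + Q)) := by
    have := Real.add_one_le_exp (k * (P + Q))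
    rw [div_mul_eq_mul_div, le_div_iff₀ hk0]
    nlinarith
  have hge1 : 1 ≤ Real.exp (k * (P + Q)) := Real.one_le_exp (by positivity)
  rw [expPoly, norm_mul, Complex.norm_exp, Complex.neg_re, re_rate_mul hι, hre]
  have h1 : ‖c.1 + c.2 * ((x 0 : ℂ) - ι * x 1)‖
      ≤ (‖c.1‖ + ‖c.2‖ * (2 / k)) * Real.exp (k * (P + Q)) := by
    refine (norm_add_le _ _).trans ?_
    rw [norm_mul, add_mul, mul_assoc]
    refine add_le_add (le_mul_of_one_le_right (norm_nonneg _) hge1) ?_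
    gcongr
    exact hz.trans hexp
  calc ‖c.1 + c.2 * ((x 0 : ℂ) - ι * x 1)‖ * Real.exp (-(2 * k * (P + Q)))
      ≤ (‖c.1‖ + ‖c.2‖ * (2 / k)) * Real.exp (k * (P + Q)) * Real.exp (-(2 * k * (P + Q))) := by
        gcongr
    _ = _ := by
        rw [mul_assoc, ← Real.exp_add, obliqueExp]
        congr 2; ring

/-! ### Ray integrals and leading asymptotics of face and flux terms. -/

theorem integrableOn_pow_mul_cexp {w : ℂ} (hw : 0 < w.re) (n : ℕ) :
    IntegrableOn (fun r : ℝ => (r : ℂ) ^ n * Complex.exp (-(w * r))) (Ioi 0) := by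
  -- Half of the decay rate pays for `r ^ n`, through `x ^ n / n! ≤ exp x` with `x = r w.re / 2`.
  have hb : IntegrableOn (fun r : ℝ => (n.factorial / (w.re / 2) ^ n) *
      Real.exp (-(w.re / 2) * r)) (Ioi 0) :=
    (integrableOn_exp_mul_Ioi (by linarith) 0).const_mul _
  refine Integrable.mono' hb (Continuous.aestronglyMeasurable (by fun_prop)) ?_
  filter_upwards [ae_restrict_mem measurableSet_Ioi] with r hr
  have hr0 : (0 : ℝ) < r := hr
  have h1 := Real.pow_div_factorial_le_exp (w.re / 2 * r) (by positivity) n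
  rw [norm_mul, norm_pow, Complex.norm_real, Real.norm_of_nonneg hr0.le, Complex.norm_exp]
  have h2 : (-(w * (r : ℂ))).re = -(w.re / 2) * r - w.re / 2 * r := by simp; ring
  rw [div_le_iff₀ (by positivity), mul_pow] at h1
  have h3 : r ^ n ≤ n.factorial / (w.re / 2) ^ n * Real.exp (w.re / 2 * r) := by
    rw [div_mul_eq_mul_div, le_div_iff₀ (by positivity)]
    linarith
  calc r ^ n * Real.exp (-(w * (r : ℂ))).re
      ≤ n.factorial / (w.re / 2) ^ n * Real.exp (w.re / 2 * r) *
        Real.exp (-(w * (r : ℂ))).re := by gcongr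
    _ = _ := by rw [mul_assoc, ← Real.exp_add, h2]; congr 2; ring

theorem integral_cexp_Ioi {w : ℂ} (hw : 0 < w.re) :
    ∫ r in Ioi (0 : ℝ), Complex.exp (-(w * r)) = 1 / w := by
  have := integral_exp_mul_complex_Ioi (a := -w) (by simpa using hw) 0
  simp only [neg_mul] at this
  rw [this]
  simp

theorem integral_mul_cexp_Ioi {w : ℂ} (hw : 0 < w.re) :
    ∫ r in Ioi (0 : ℝ), (r : ℂ) * Complex.exp (-(w * r)) = 1 / w ^ 2 := by
  have hw0 : w ≠ 0 := fun h0 => by simp [h0] at hw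
  have hre : ∀ x : ℝ, (-(w * (x : ℂ))).re = -(x * w.re) := fun x => by simp; ring
  have hd : ∀ x : ℝ, HasDerivAt (fun r : ℝ => -((r : ℂ) / w + 1 / w ^ 2) * Complex.exp (-(w * r)))
      ((x : ℂ) * Complex.exp (-(w * x))) x := by
    intro x
    have h0 : HasDerivAt (fun r : ℝ => (r : ℂ)) 1 x := Complex.ofRealCLM.hasDerivAt
    have h1 := ((h0.div_const w).add_const (1 / w ^ 2)).neg.mul (h0.const_mul w).neg.cexp
    convert! h1 using 1
    simp only [Pi.neg_apply]
    field_simp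
    ring
  have hlim : Tendsto (fun r : ℝ => -((r : ℂ) / w + 1 / w ^ 2) * Complex.exp (-(w * r))) atTop
      (𝓝 0) := by
    have t1 : Tendsto (fun r : ℝ => (r : ℂ) * Complex.exp (-(w * r))) atTop (𝓝 0) := by
      rw [tendsto_zero_iff_norm_tendsto_zero]
      have := Real.tendsto_pow_mul_exp_neg_atTop_nhds_zero 1
      have h2 := (this.comp (tendsto_id.atTop_mul_const hw)).const_mul (1 / w.re)
      rw [mul_zero] at h2
      refine h2.congr' ?_
      filter_upwards [eventually_ge_atTop 0] with r hr
      rw [norm_mul, Complex.norm_real, Real.norm_of_nonneg hr, Complex.norm_exp, hre]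
      simp only [Function.comp_apply, id_eq, pow_one]
      field_simp
    have t2 : Tendsto (fun r : ℝ => Complex.exp (-(w * r))) atTop (𝓝 0) := by
      rw [tendsto_zero_iff_norm_tendsto_zero]
      refine (Real.tendsto_exp_neg_atTop_nhds_zero.comp (tendsto_id.atTop_mul_const hw)).congr ?_
      intro r
      rw [Complex.norm_exp, hre]
      rfl
    have := (t1.const_mul (-(1 / w))).add (t2.const_mul (-(1 / w ^ 2)))
    simp only [mul_zero, add_zero] at this
    refine this.congr fun r => ?_
    ring
  have hi : IntegrableOn (fun r : ℝ => (r : ℂ) * Complex.exp (-(w * r))) (Ioi 0) := by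
    simpa using integrableOn_pow_mul_cexp hw 1
  rw [integral_Ioi_of_hasDerivAt_of_tendsto' (fun x _ => hd x) hi hlim]
  simp

/-- Concentration at the end point of a half-line. -/
theorem tendsto_mul_integral_dilate_Ioo {κ H : ℝ → ℂ} {κ0 : ℂ} {C : ℝ}
    (hκ : ContinuousOn κ (Ioo 0 h)) (hC : ∀ r ∈ Ioo 0 h, ‖κ r‖ ≤ C) (hh : 0 < h)
    (hlim : Tendsto κ (𝓝[>] 0) (𝓝 κ0)) (hH : IntegrableOn H (Ioi 0)) :
    Tendsto (fun s : ℝ => (s : ℂ) * ∫ r in Ioo 0 h, κ r * H (s * r)) atTop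
      (𝓝 (κ0 * ∫ r in Ioi (0 : ℝ), H r)) := by
  classical
  have hC0 : 0 ≤ C := (norm_nonneg _).trans (hC (h / 2) ⟨by linarith, by linarith⟩)
  set κ' : ℝ → ℂ := (Ioo 0 h).piecewise κ 0 with hκ'
  have hκm : Measurable κ' := hκ.measurable_piecewise continuousOn_const measurableSet_Ioo
  have hκC : ∀ r, ‖κ' r‖ ≤ C := fun r => by
    by_cases hr : r ∈ Ioo 0 h
    · rw [hκ', piecewise_eq_of_mem _ _ _ hr]; exact hC r hr
    · rw [hκ', piecewise_eq_of_notMem _ _ _ hr]; simpa using hC0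
  have hκl : Tendsto κ' (𝓝[>] 0) (𝓝 κ0) := by
    refine hlim.congr' ?_
    filter_upwards [Ioo_mem_nhdsGT hh] with r hr
    rw [hκ', piecewise_eq_of_mem _ _ _ hr]
  -- The substitution `t = s r` freezes `H` and moves the dilation onto `κ'`, the extension of `κ`
  -- by zero; dominated convergence then applies on a fixed domain.
  have key : Tendsto (fun s : ℝ => ∫ t in Ioi (0 : ℝ), κ' (s⁻¹ * t) * H t) atTop
      (𝓝 (∫ t in Ioi (0 : ℝ), κ0 * H t)) := by
    refine tendsto_integral_filter_of_dominated_convergence (fun t => C * ‖H t‖) ?_ ?_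
      (hH.norm.const_mul C) ?_
    · exact Eventually.of_forall fun s =>
        (hκm.comp (measurable_const_mul _)).aestronglyMeasurable.mul hH.aestronglyMeasurable
    · exact Eventually.of_forall fun s => Eventually.of_forall fun t => by
        rw [norm_mul]; gcongr; exact hκC _
    · filter_upwards [ae_restrict_mem measurableSet_Ioi] with t ht
      have h0 : Tendsto (fun s : ℝ => s⁻¹ * t) atTop (𝓝[>] 0) := by
        refine tendsto_nhdsWithin_iff.2 ⟨?_, ?_⟩
        · simpa using tendsto_inv_atTop_zero.mul_const t
        · filter_upwards [eventually_gt_atTop 0] with s hs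
          exact mul_pos (inv_pos.2 hs) ht
      exact (hκl.comp h0).mul_const _
  rw [integral_const_mul] at key
  refine key.congr' ?_
  filter_upwards [eventually_gt_atTop 0] with s hs
  have h1 := integral_comp_mul_left_Ioi (fun t => κ' (s⁻¹ * t) * H t) 0 hs
  simp only [inv_mul_cancel_left₀ hs.ne', mul_zero] at h1
  have h2 : ∫ r in Ioo 0 h, κ r * H (s * r) = ∫ r in Ioi (0 : ℝ), κ' r * H (s * r) := by
    rw [setIntegral_eq_of_subset_of_forall_sdiff_eq_zero measurableSet_Ioi
      (fun r (hr : r ∈ Ioo 0 h) => hr.1)]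
    · refine setIntegral_congr_fun measurableSet_Ioo fun r hr => ?_
      simp only [hκ', piecewise_eq_of_mem _ _ _ hr]
    · rintro r ⟨-, hr⟩
      rw [hκ', piecewise_eq_of_notMem _ _ _ hr]; simp
  rw [h2, h1, Complex.real_smul, ← mul_assoc, ← Complex.ofReal_mul, mul_inv_cancel₀ hs.ne']
  simp

/-- The integral of `expPoly ι ρ c` along the ray at angle `θ`. -/
noncomputable def rayIntegral (ι ρ : ℂ) (θ : ℝ) (c : ℂ × ℂ) : ℂ :=
  c.1 / (ρ * (Real.cos θ + ι * Real.sin θ))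
    + c.2 * (Real.cos θ - ι * Real.sin θ) / (ρ * (Real.cos θ + ι * Real.sin θ)) ^ 2

/-- The integral of a cutoff along the edge. -/
noncomputable def edgeIntegral (M : ℝ) (ξ : E3 → ℂ) : ℂ :=
  ∫ t in Icc (-M) M, ξ (facePoint 0 (0, t))

theorem expPoly_facePoint (ι ρ : ℂ) (θ : ℝ) (c : ℂ × ℂ) (p : ℝ × ℝ) (s : ℝ) :
    expPoly ι ρ c (s • facePoint θ p) =
      (c.1 + c.2 * (Real.cos θ - ι * Real.sin θ) * ((s * p.1 : ℝ) : ℂ)) *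
        Complex.exp (-(ρ * (Real.cos θ + ι * Real.sin θ) * ((s * p.1 : ℝ) : ℂ))) := by
  simp only [expPoly, facePoint, PiLp.smul_apply, Matrix.cons_val_zero,
    Matrix.cons_val_one, smul_eq_mul]
  push_cast
  congr 2 <;> ring

theorem integrableOn_ray {w : ℂ} (hw : 0 < w.re) (a b : ℂ) :
    IntegrableOn (fun r : ℝ => (a + b * (r : ℂ)) * Complex.exp (-(w * r))) (Ioi 0) := by
  have h0 := (integrableOn_pow_mul_cexp hw 0).const_mul a
  have h1 := (integrableOn_pow_mul_cexp hw 1).const_mul b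
  refine (h0.add h1).congr (Eventually.of_forall fun r => ?_)
  simp only [Pi.add_apply, pow_zero, pow_one]
  ring

theorem integrableOn_mul_ray {w : ℂ} (hw : 0 < w.re) (a b : ℂ) :
    IntegrableOn (fun r : ℝ => (r : ℂ) * ((a + b * (r : ℂ)) * Complex.exp (-(w * r)))) (Ioi 0) := by
  have h0 := (integrableOn_pow_mul_cexp hw 1).const_mul a
  have h1 := (integrableOn_pow_mul_cexp hw 2).const_mul b
  refine (h0.add h1).congr (Eventually.of_forall fun r => ?_)
  simp only [Pi.add_apply, pow_one]
  ring

theorem integral_ray {w : ℂ} (hw : 0 < w.re) (a b : ℂ) :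
    ∫ r in Ioi (0 : ℝ), (a + b * (r : ℂ)) * Complex.exp (-(w * r)) = a / w + b / w ^ 2 := by
  have h0 := (integrableOn_pow_mul_cexp hw 0).const_mul a
  have h1 := (integrableOn_pow_mul_cexp hw 1).const_mul b
  simp only [pow_zero, one_mul, pow_one] at h0 h1
  calc _ = ∫ r in Ioi (0 : ℝ), (a * Complex.exp (-(w * r)) + b * ((r : ℂ) * Complex.exp (-(w * r)))) := by
        congr 1 with r; ring
    _ = _ := by
        rw [integral_add h0 h1, integral_const_mul, integral_const_mul, integral_cexp_Ioi hw,
          integral_mul_cexp_Ioi hw]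
        ring

theorem continuous_edge_average {ξ : E3 → ℂ} (hξ : Continuous ξ) (θ : ℝ) :
    Continuous fun r : ℝ => ∫ t in Icc (-M) M, ξ (facePoint θ (r, t)) :=
  continuous_parametric_integral_of_continuous (f := fun r t => ξ (facePoint θ (r, t)))
    (hξ.comp (continuous_facePoint θ)) isCompact_Icc

/-- Neither the data nor the exponential depends on `x₃`, so Fubini confines the third variable to
an average of the cutoff and leaves a one-dimensional integral. -/
theorem integral_face_mul_expPoly {θ : ℝ} {k : E3 → ℂ} {kt : ℝ → ℂ} {k0 : ℂ}
    (hk : IsFaceProfile θ h M δ k kt k0) {ξ : E3 → ℂ} (hξ : Continuous ξ)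
    (hsupp : tsupport ξ ⊆ Metric.ball 0 δ) (ι ρ : ℂ) (c : ℂ × ℂ) (s : ℝ) :
    ∫ x, k x * (ξ x * expPoly ι ρ c (s • x)) ∂faceMeasure θ h M =
      ∫ r in Ioo 0 h, (kt r * ∫ t in Icc (-M) M, ξ (facePoint θ (r, t))) *
        ((c.1 + c.2 * (Real.cos θ - ι * Real.sin θ) * ((s * r : ℝ) : ℂ)) *
        Complex.exp (-(ρ * (Real.cos θ + ι * Real.sin θ) * ((s * r : ℝ) : ℂ)))) := by
  have hint := integrable_mul_of_integrableOn_ball hk.integrableOn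
    (hξ.mul ((contDiff_expPoly ι ρ c).continuous.comp (continuous_const_smul s)))
    (tsupport_mul_subset_left.trans hsupp)
  rw [integrable_faceMeasure_iff, Measure.volume_eq_prod] at hint
  rw [integral_faceMeasure, Measure.volume_eq_prod, setIntegral_prod _ (by exact hint)]
  refine setIntegral_congr_fun measurableSet_Ioo fun r hr => ?_
  rw [← integral_const_mul, ← integral_mul_const,
    integral_Icc_eq_integral_Ioo]
  refine setIntegral_congr_fun measurableSet_Ioo fun t ht => ?_
  simp only [expPoly_facePoint]
  rw [hk.eq r hr t ht]
  ring

/-- The profile is controlled only for `r < δ`; for larger `r` the cutoff vanishes. -/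
theorem exists_edge_average_bound {θ : ℝ} {ξ : E3 → ℂ} (hξ : Continuous ξ)
    (hsupp : tsupport ξ ⊆ Metric.ball 0 δ) {kt : ℝ → ℂ} {C : ℝ} (hC0 : 0 ≤ C)
    (hC : ∀ r ∈ Ioo 0 δ, ‖kt r‖ ≤ C) :
    ∃ C', ∀ r ∈ Ioo 0 h, ‖kt r * ∫ t in Icc (-M) M, ξ (facePoint θ (r, t))‖ ≤ C' := by
  obtain ⟨X, hX⟩ := (isCompact_Icc (a := (0 : ℝ)) (b := h)).exists_bound_of_continuousOn
    (continuous_edge_average (M := M) hξ θ).continuousOn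
  refine ⟨C * X, fun r hr => ?_⟩
  have hX' := hX r ⟨hr.1.le, hr.2.le⟩
  by_cases hrδ : r < δ
  · rw [norm_mul]
    exact mul_le_mul (hC r ⟨hr.1, hrδ⟩) hX' (norm_nonneg _) hC0
  · have h0 : ∀ t, ξ (facePoint θ (r, t)) = 0 := fun t =>
      image_eq_zero_of_notMem_tsupport fun hmem => hrδ
        ((fst_le_norm_facePoint θ (r, t)).trans_lt (mem_ball_zero_iff.1 (hsupp hmem)))
    simp only [h0, integral_zero, mul_zero, norm_zero]
    exact mul_nonneg hC0 ((norm_nonneg _).trans hX')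

theorem facePoint_zero_fst (θ t : ℝ) : facePoint θ (0, t) = facePoint 0 (0, t) := by
  simp [facePoint]

theorem tendsto_edge_average {θ : ℝ} {ξ : E3 → ℂ} (hξ : Continuous ξ) :
    Tendsto (fun r : ℝ => ∫ t in Icc (-M) M, ξ (facePoint θ (r, t))) (𝓝[>] 0)
      (𝓝 (edgeIntegral M ξ)) := by
  have := ((continuous_edge_average (M := M) hξ θ).tendsto 0).mono_left
    (nhdsWithin_le_nhds (s := Ioi (0 : ℝ)))
  simpa only [edgeIntegral, facePoint_zero_fst θ] using this

/-- The leading term of the face integrals against a concentrating test function. -/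
theorem tendsto_mul_integral_face {θ : ℝ} {k : E3 → ℂ} {kt : ℝ → ℂ} {k0 : ℂ} (hh : 0 < h)
    (hk : IsFaceProfile θ h M δ k kt k0) {ξ : E3 → ℂ} (hξ : Continuous ξ)
    (hsupp : tsupport ξ ⊆ Metric.ball 0 δ) {ι ρ : ℂ}
    (hw : 0 < (ρ * ((Real.cos θ : ℂ) + ι * Real.sin θ)).re) (c : ℂ × ℂ) :
    Tendsto (fun s : ℝ => (s : ℂ) * ∫ x, k x * (ξ x * expPoly ι ρ c (s • x)) ∂faceMeasure θ h M)
      atTop (𝓝 (k0 * edgeIntegral M ξ * rayIntegral ι ρ θ c)) := by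
  obtain ⟨C, hC⟩ := hk.bdd
  obtain ⟨C', hC'⟩ := exists_edge_average_bound (h := h) (M := M) (θ := θ) hξ hsupp
    (kt := kt) (le_max_right C 0) fun r hr => (hC r hr).trans (le_max_left _ _)
  have := tendsto_mul_integral_dilate_Ioo
    (hk.cont.mul (continuous_edge_average (M := M) hξ θ).continuousOn) hC' hh
    (hk.lim.mul (tendsto_edge_average hξ))
    (integrableOn_ray hw c.1 (c.2 * (Real.cos θ - ι * Real.sin θ)))
  rw [integral_ray hw] at this
  simpa only [integral_face_mul_expPoly hk hξ hsupp, Pi.mul_apply] using! this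

/-- Face data of order `o(r)` contribute a lower order term. -/
theorem tendsto_sq_mul_integral_face {θ : ℝ} {k : E3 → ℂ} {kt : ℝ → ℂ} {k0 : ℂ} (hh : 0 < h)
    (hk : IsFaceProfile θ h M δ k kt k0) {C : ℝ} (hC0 : 0 ≤ C)
    (hC : ∀ r ∈ Ioo 0 δ, ‖kt r / r‖ ≤ C)
    (hlim : Tendsto (fun r : ℝ => kt r / r) (𝓝[>] 0) (𝓝 0)) {ξ : E3 → ℂ} (hξ : Continuous ξ)
    (hsupp : tsupport ξ ⊆ Metric.ball 0 δ) {ι ρ : ℂ}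
    (hw : 0 < (ρ * ((Real.cos θ : ℂ) + ι * Real.sin θ)).re) (c : ℂ × ℂ) :
    Tendsto (fun s : ℝ => (s : ℂ) ^ 2 *
      ∫ x, k x * (ξ x * expPoly ι ρ c (s • x)) ∂faceMeasure θ h M) atTop (𝓝 0) := by
  obtain ⟨C', hC'⟩ := exists_edge_average_bound (h := h) (M := M) (θ := θ) hξ hsupp
    (kt := fun r => kt r / r) hC0 hC
  have hcont : ContinuousOn (fun r : ℝ => kt r / (r : ℂ)) (Ioo 0 h) :=
    hk.cont.div Complex.continuous_ofReal.continuousOn fun r hr =>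
      Complex.ofReal_ne_zero.2 hr.1.ne'
  -- The integrand is rewritten as `(kt r / r)` times a kernel containing the extra factor `s r`.
  -- This trades the `o(r)` decay for one more power of `s`.
  have := tendsto_mul_integral_dilate_Ioo
    (hcont.mul (continuous_edge_average (M := M) hξ θ).continuousOn) hC' hh
    (hlim.mul (tendsto_edge_average hξ))
    (integrableOn_mul_ray hw c.1 (c.2 * (Real.cos θ - ι * Real.sin θ)))
  rw [zero_mul, zero_mul] at this
  refine this.congr fun s => ?_
  rw [integral_face_mul_expPoly hk hξ hsupp, sq, mul_assoc (s : ℂ) (s : ℂ), ← integral_const_mul, ← integral_const_mul,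
    ← integral_const_mul]
  refine setIntegral_congr_fun (measurableSet_Ioo (a := (0 : ℝ)) (b := h)) fun r hr => ?_
  have hr0 : (r : ℂ) ≠ 0 := Complex.ofReal_ne_zero.2 hr.1.ne'
  simp only [Complex.ofReal_mul, Pi.mul_apply]
  field_simp

/-- The rate for which `expPoly` decays in the wedge: rotation by the bisecting angle. -/
noncomputable def wedgeRate (θmin θmax : ℝ) (ι : ℂ) : ℂ :=
  (Real.cos ((θmin + θmax) / 2) : ℂ) - ι * Real.sin ((θmin + θmax) / 2)

/-- Both real parts equal the cosine of the half-opening, because the rate points along the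
bisector. -/
theorem wedgeRate_re_pos (hθ : θmin < θmax) (hangle : θmax - θmin < Real.pi) {ι : ℂ}
    (hι : ι = Complex.I ∨ ι = -Complex.I) :
    0 < (wedgeRate θmin θmax ι * ((Real.cos θmax : ℂ) + ι * Real.sin θmax)).re ∧
    0 < (wedgeRate θmin θmax ι * ((Real.cos θmin : ℂ) + ι * Real.sin θmin)).re := by
  unfold wedgeRate
  rw [re_rate_mul hι, re_rate_mul hι, ← Real.cos_sub, ← Real.cos_sub]
  exact ⟨Real.cos_pos_of_mem_Ioo ⟨by linarith, by linarith⟩,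
    Real.cos_pos_of_mem_Ioo ⟨by linarith, by linarith⟩⟩

theorem integrable_mul_expPoly {μ : Measure E3} [IsFiniteMeasure μ] {F ξ : E3 → ℂ}
    (hF : MemLp F 2 μ) (hξ : Continuous ξ) (hc : HasCompactSupport ξ) (ι ρ : ℂ) (c : ℂ × ℂ)
    (s : ℝ) : Integrable (fun x => F x * ξ x * expPoly ι ρ c (s • x)) μ := by
  simp only [mul_assoc]
  exact integrable_mul_of_memLp hF
    (hξ.mul ((contDiff_expPoly ι ρ c).continuous.comp (continuous_const_smul s))) hc.mul_right

/-- A weak flux identity tested with `ξ · expPoly (s •)`. -/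
theorem HasWeakFlux.expPoly_identity (hθ : θmin < θmax) (hangle : θmax - θmin < Real.pi)
    (hh : 0 < h) {A : E3 → ℂ} {B : Fin 3 → E3 → ℂ} {hp hm : E3 → ℂ}
    (hflux : HasWeakFlux θmin θmax h M δ A B hp hm)
    (hA : MemLp A 2 (volume.restrict (wedge θmin θmax h M)))
    (hB : ∀ j, MemLp (B j) 2 (volume.restrict (wedge θmin θmax h M))) {ξ : E3 → ℂ}
    (hξ : ContDiff ℝ ∞ ξ) (hsupp : tsupport ξ ⊆ Metric.ball 0 δ) (ι ρ : ℂ) (c : ℂ × ℂ) (s : ℝ) :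
    (∫ x in wedge θmin θmax h M, A x * ξ x * expPoly ι ρ c (s • x))
      + (∑ j, ∫ x in wedge θmin θmax h M,
          B j x * fderiv ℝ ξ x (EuclideanSpace.single j 1) * expPoly ι ρ c (s • x))
      + s * ∑ j, ∫ x in wedge θmin θmax h M,
          B j x * ξ x * expPoly ι ρ (expPolyDeriv ι ρ c j) (s • x)
    = (∫ x, hp x * (ξ x * expPoly ι ρ c (s • x)) ∂faceMeasure θmax h M)
      + ∫ x, hm x * (ξ x * expPoly ι ρ c (s • x)) ∂faceMeasure θmin h M := by
  have hfin := isFiniteMeasure_wedge (M := M) hθ hangle hh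
  have hc := hasCompactSupport_of_subset_ball hsupp
  rw [← hflux _ (contDiff_mul_expPoly hξ ι ρ c s) (tsupport_mul_subset_left.trans hsupp)]
  have i1 := integrable_mul_expPoly hA hξ.continuous hc ι ρ c s
  have i2 := fun j => integrable_mul_expPoly (hB j)
    (continuous_fderiv_single hξ (EuclideanSpace.single j 1)) (hc.fderiv_apply ℝ _) ι ρ c s
  have i3 := fun j => integrable_mul_expPoly (hB j) hξ.continuous hc ι ρ (expPolyDeriv ι ρ c j) s
  rw [← integral_finsetSum _ fun j _ => i2 j, ← integral_finsetSum _ fun j _ => i3 j,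
    ← integral_const_mul, ← integral_add i1 (integrable_finsetSum _ fun j _ => i2 j),
    ← integral_add (by exact i1.add (integrable_finsetSum _ fun j _ => i2 j))
      ((integrable_finsetSum _ fun j _ => i3 j).const_mul _)]
  congr 1 with x
  simp only [fderiv_mul_expPoly hξ, mul_add, Finset.sum_add_distrib]
  rw [Finset.mul_sum, mul_assoc, add_assoc]
  congr 2
  · exact Finset.sum_congr rfl fun j _ => by ring
  · exact Finset.sum_congr rfl fun j _ => by ring

theorem tendsto_mul_integral_expPoly (hθ : θmin < θmax) (hangle : θmax - θmin < Real.pi)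
    (hh : 0 < h) (hM : 0 < M) {F ξ : E3 → ℂ}
    (hF : MemLp F 2 (volume.restrict (wedge θmin θmax h M))) (hξ : Continuous ξ)
    (hc : HasCompactSupport ξ) {ι : ℂ} (hι : ι = Complex.I ∨ ι = -Complex.I) (c : ℂ × ℂ) :
    Tendsto (fun s : ℝ => (s : ℂ) * ∫ x in wedge θmin θmax h M,
      F x * ξ x * expPoly ι (wedgeRate θmin θmax ι) c (s • x)) atTop (𝓝 0) := by
  obtain ⟨C, k, hk, hb⟩ := exists_expPoly_le hθ hangle hι c
  exact tendsto_mul_integral_dilate hθ hangle hh hM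
    (K := expPoly ι (wedgeRate θmin θmax ι) c) (memLp_mul_of_memLp hF hξ hc) hk hb

/-- The leading term of a flux through the edge. -/
theorem HasWeakFlux.tendsto (hθ : θmin < θmax) (hangle : θmax - θmin < Real.pi)
    (hh : 0 < h) (hM : 0 < M) {A : E3 → ℂ} {B : Fin 3 → E3 → ℂ} {hp hm : E3 → ℂ}
    (hflux : HasWeakFlux θmin θmax h M δ A B hp hm)
    (hA : MemLp A 2 (volume.restrict (wedge θmin θmax h M)))
    (hB : ∀ j, MemLp (B j) 2 (volume.restrict (wedge θmin θmax h M)))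
    {hpt hmt : ℝ → ℂ} {hp0 hm0 : ℂ} (hhp : IsFaceProfile θmax h M δ hp hpt hp0)
    (hhm : IsFaceProfile θmin h M δ hm hmt hm0) {ξ : E3 → ℂ}
    (hξ : ContDiff ℝ ∞ ξ) (hsupp : tsupport ξ ⊆ Metric.ball 0 δ) {ι : ℂ}
    (hι : ι = Complex.I ∨ ι = -Complex.I) (c : ℂ × ℂ) :
    Tendsto (fun s : ℝ => (s : ℂ) ^ 2 * ∑ j, ∫ x in wedge θmin θmax h M,
          B j x * ξ x * expPoly ι (wedgeRate θmin θmax ι)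
            (expPolyDeriv ι (wedgeRate θmin θmax ι) c j) (s • x)) atTop
      (𝓝 (edgeIntegral M ξ * (hp0 * rayIntegral ι (wedgeRate θmin θmax ι) θmax c
        + hm0 * rayIntegral ι (wedgeRate θmin θmax ι) θmin c))) := by
  have hc := hasCompactSupport_of_subset_ball hsupp
  obtain ⟨hw1, hw2⟩ := wedgeRate_re_pos hθ hangle hι
  have t1 := tendsto_mul_integral_face hh hhp hξ.continuous hsupp hw1 c
  have t2 := tendsto_mul_integral_face hh hhm hξ.continuous hsupp hw2 c
  have t3 := tendsto_mul_integral_expPoly hθ hangle hh hM hA hξ.continuous hc hι c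
  have t4 : Tendsto (fun s : ℝ => ∑ j, (s : ℂ) * ∫ x in wedge θmin θmax h M,
      B j x * fderiv ℝ ξ x (EuclideanSpace.single j 1) *
        expPoly ι (wedgeRate θmin θmax ι) c (s • x)) atTop (𝓝 (∑ _j : Fin 3, 0)) :=
    tendsto_finsetSum _ fun j _ => tendsto_mul_integral_expPoly hθ hangle hh hM (hB j)
      (continuous_fderiv_single hξ _) (hc.fderiv_apply ℝ _) hι c
  -- After multiplication by `s`, the term without derivatives and the terms differentiating the
  -- cutoff are `o(1)`. Only derivatives falling on the exponential balance the faces.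
  have t5 := ((t1.add t2).sub t3).sub t4
  have hval : edgeIntegral M ξ * (hp0 * rayIntegral ι (wedgeRate θmin θmax ι) θmax c
        + hm0 * rayIntegral ι (wedgeRate θmin θmax ι) θmin c) =
      hp0 * edgeIntegral M ξ * rayIntegral ι (wedgeRate θmin θmax ι) θmax c
      + hm0 * edgeIntegral M ξ * rayIntegral ι (wedgeRate θmin θmax ι) θmin c - 0
      - ∑ _j : Fin 3, 0 := by
    simp; ring
  rw [hval]
  refine t5.congr fun s => ?_
  rw [← Finset.mul_sum]
  linear_combination (-(s : ℂ)) *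
    hflux.expPoly_identity hθ hangle hh hA hB hξ hsupp ι (wedgeRate θmin θmax ι) c s

/-! ### Profiles of the given data and a cutoff charging the edge. -/

theorem exists_bound_of_tendsto {k : ℝ → ℂ} {k0 : ℂ} (hk : ContinuousOn k (Ioo 0 h))
    (hlim : Tendsto k (𝓝[>] 0) (𝓝 k0)) (hδh : δ < h) :
    ∃ C, 0 ≤ C ∧ ∀ r ∈ Ioo 0 δ, ‖k r‖ ≤ C := by
  have h1 : ∀ᶠ r in 𝓝[>] (0 : ℝ), ‖k r‖ < ‖k0‖ + 1 :=
    hlim.norm.eventually_lt_const (by linarith)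
  -- Near `0` the limit gives the bound; what remains is the compact interval from `a` to `δ`,
  -- inside the domain of continuity because `δ < h`.
  obtain ⟨a, ha0, ha⟩ := mem_nhdsGT_iff_exists_Ioo_subset.1 h1
  obtain ⟨C, hC⟩ := (isCompact_Icc (a := a) (b := δ)).exists_bound_of_continuousOn
    (hk.mono fun r hr => ⟨lt_of_lt_of_le ha0 hr.1, hr.2.trans_lt hδh⟩)
  refine ⟨max (‖k0‖ + 1) C, le_max_of_le_left (by positivity), fun r hr => ?_⟩
  rcases lt_or_ge r a with hra | hra
  · exact (le_of_lt (ha ⟨hr.1, hra⟩)).trans (le_max_left _ _)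
  · exact (hC r ⟨hra, hr.2.le⟩).trans (le_max_right _ _)

theorem facePoint_mem_face {θ r t : ℝ} (hr : r ∈ Ico 0 h) (ht : t ∈ Ioo (-M) M) :
    facePoint θ (r, t) ∈ face θ h M := mem_image_of_mem _ ⟨hr, ht⟩

theorem facePoint_zero (θ : ℝ) : facePoint θ (0, 0) = 0 := by
  ext i; fin_cases i <;> simp [facePoint]

theorem tendsto_facePoint (hh : 0 < h) (hM : 0 < M) (θ : ℝ) :
    Tendsto (fun r : ℝ => facePoint θ (r, 0)) (𝓝[>] 0) (𝓝[face θ h M] 0) := by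
  refine tendsto_nhdsWithin_iff.2 ⟨?_, ?_⟩
  · have : Continuous fun r : ℝ => facePoint θ (r, 0) :=
      (continuous_facePoint θ).comp (by fun_prop)
    simpa only [facePoint_zero] using (this.tendsto 0).mono_left nhdsWithin_le_nhds
  · filter_upwards [Ioo_mem_nhdsGT hh] with r hr
    exact facePoint_mem_face ⟨hr.1.le, hr.2⟩ ⟨by linarith, hM⟩

theorem isFaceProfile_of_continuousOn {θ : ℝ} (hh : 0 < h) (hM : 0 < M) (hδh : δ < h)
    {k : E3 → Fin 3 → ℂ} (hk : ContinuousOn k (face θ h M)) (hind : IndepOfX3 (face θ h M) k)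
    (i : Fin 3) :
    IsFaceProfile θ h M δ (fun x => k x i) (fun r => k (facePoint θ (r, 0)) i) (k 0 i) := by
  have h0 : (0 : ℝ) ∈ Ioo (-M) M := ⟨by linarith, hM⟩
  have hmap : MapsTo (fun r : ℝ => facePoint θ (r, 0)) (Ioo 0 h) (face θ h M) :=
    fun r hr => facePoint_mem_face ⟨hr.1.le, hr.2⟩ h0
  have hki : ContinuousOn (fun x => k x i) (face θ h M) := continuousOn_pi.1 hk i
  have hc : ContinuousOn (fun r : ℝ => k (facePoint θ (r, 0)) i) (Ioo 0 h) :=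
    hki.comp ((continuous_facePoint θ).comp (by fun_prop)).continuousOn hmap
  have hmem0 : (0 : E3) ∈ face θ h M := by
    rw [← facePoint_zero θ]; exact facePoint_mem_face ⟨le_rfl, hh⟩ h0
  have hl : Tendsto (fun r : ℝ => k (facePoint θ (r, 0)) i) (𝓝[>] 0) (𝓝 (k 0 i)) :=
    Tendsto.comp (hki 0 hmem0) (tendsto_facePoint hh hM θ)
  refine ⟨fun r hr t ht => ?_, hc, hl, ?_⟩
  · have := hind _ (facePoint_mem_face (θ := θ) ⟨hr.1.le, hr.2⟩ ht) _
      (facePoint_mem_face (θ := θ) ⟨hr.1.le, hr.2⟩ h0) (by simp [facePoint]) (by simp [facePoint])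
    rw [this]
  · obtain ⟨C, -, hC⟩ := exists_bound_of_tendsto hc hl hδh
    exact ⟨C, hC⟩

/-- Along the ray `x₃ = 0` the norm of the point is `|r|`, so the remainder in the definition of the
derivative is `o(r)`. -/
theorem GradVanishesAtZero.tendsto_div {θ : ℝ} (hh : 0 < h) (hM : 0 < M) {f : E3 → Fin 3 → ℂ}
    (hf : GradVanishesAtZero (face θ h M) f) (i : Fin 3) :
    Tendsto (fun r : ℝ => (f (facePoint θ (r, 0)) i - f 0 i) / r) (𝓝[>] 0) (𝓝 0) := by
  have h1 := (HasFDerivWithinAt.isLittleO hf).comp_tendsto (tendsto_facePoint hh hM θ)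
  have h2 : (fun r : ℝ => f (facePoint θ (r, 0)) i - f 0 i) =o[𝓝[>] 0] fun r : ℝ => (r : ℂ) := by
    refine Asymptotics.IsLittleO.trans_isBigO (Asymptotics.IsBigO.trans_isLittleO ?_ h1) ?_
    · refine Asymptotics.IsBigO.of_bound 1 (Eventually.of_forall fun r => ?_)
      have := norm_le_pi_norm (f (facePoint θ (r, 0)) - f 0) i
      simpa using this
    · refine Asymptotics.IsBigO.of_bound 1 (Eventually.of_forall fun r => ?_)
      have hn := norm_facePoint_sq θ (r, 0)
      simp only [Function.comp_apply, sub_zero, one_mul, Complex.norm_real, Real.norm_eq_abs]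
      refine le_of_eq ?_
      rw [← abs_of_nonneg (norm_nonneg (facePoint θ (r, 0))), ← sq_eq_sq_iff_abs_eq_abs, hn]
      ring
  exact h2.tendsto_div_nhds_zero

/-- A smooth cutoff near the origin whose integral along the edge does not vanish. -/
theorem exists_cutoff (hM : 0 < M) (hδ : 0 < δ) : ∃ ξ : E3 → ℂ, ContDiff ℝ ∞ ξ ∧
    tsupport ξ ⊆ Metric.ball 0 δ ∧ edgeIntegral M ξ ≠ 0 := by
  let b : ContDiffBump (0 : E3) := ⟨δ / 4, δ / 2, by positivity, by linarith⟩
  refine ⟨fun x => (b x : ℂ), Complex.ofRealCLM.contDiff.comp b.contDiff, ?_, ?_⟩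
  · refine (tsupport_comp_subset (g := ((↑) : ℝ → ℂ)) (by simp) b).trans ?_
    rw [b.tsupport_eq]
    exact Metric.closedBall_subset_ball (by change δ / 2 < δ; linarith)
  · have hcont : Continuous fun t : ℝ => b (facePoint 0 (0, t)) :=
      b.continuous.comp ((continuous_facePoint 0).comp (by fun_prop))
    have hpos : 0 < ∫ t in Icc (-M) M, b (facePoint 0 (0, t)) := by
      rw [setIntegral_pos_iff_support_of_nonneg_ae (Eventually.of_forall fun t => b.nonneg)
        (hcont.continuousOn.integrableOn_compact isCompact_Icc)]
      refine lt_of_lt_of_le ?_ (measure_mono (s := Ioo (-min (δ / 2) M) (min (δ / 2) M)) ?_)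
      · rw [Real.volume_Ioo, ENNReal.ofReal_pos]
        have : 0 < min (δ / 2) M := lt_min (by linarith) hM
        linarith
      · intro t ht
        have h1 : |t| < min (δ / 2) M := abs_lt.2 ht
        refine ⟨?_, ?_⟩
        · rw [Function.mem_support]
          refine (b.pos_of_mem_ball ?_).ne'
          rw [mem_ball_zero_iff]
          change _ < δ / 2
          refine lt_of_pow_lt_pow_left₀ 2 (by positivity) ?_
          rw [norm_facePoint_sq, ← sq_abs t]
          have := h1.trans_le (min_le_left _ _)
          nlinarith [abs_nonneg t]
        · have := abs_lt.1 (h1.trans_le (min_le_right _ _))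
          exact ⟨this.1.le, this.2.le⟩
    rw [edgeIntegral, integral_complex_ofReal]
    exact Complex.ofReal_ne_zero.2 hpos.ne'

/-! ### Agreement of the two traces at the edge. -/

theorem sum_ite_integral {D : Set E3} {u : E3 → ℂ} (l : Fin 3) (K : Fin 3 → E3 → ℂ) (ξ : E3 → ℂ) :
    ∑ j, ∫ x in D, (if j = l then u x else 0) * ξ x * K j x = ∫ x in D, u x * ξ x * K l x := by
  rw [Finset.sum_eq_single l]
  · simp
  · intro j _ hj
    simp [hj]
  · simp

theorem memLp_ite {μ : Measure E3} {u : E3 → ℂ} (hu : MemLp u 2 μ) (l : Fin 3) (j : Fin 3) :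
    MemLp (fun x => if j = l then u x else 0) 2 μ := by
  by_cases hj : j = l
  · simpa [hj] using hu
  · simp [hj]

theorem ne_zero_of_unit {ι : ℂ} (hι2 : ι ^ 2 = -1) (θ : ℝ) :
    ((Real.cos θ : ℂ) + ι * Real.sin θ) * (Real.cos θ - ι * Real.sin θ) = 1 := by
  have h1 : (Real.cos θ : ℂ) ^ 2 + (Real.sin θ : ℂ) ^ 2 = 1 := by
    exact_mod_cast Real.cos_sq_add_sin_sq θ
  linear_combination h1 - (Real.sin θ : ℂ) ^ 2 * hι2

/-- The two traces of an `H¹` function agree at the edge. -/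
theorem trace_eq_at_edge (hθ : θmin < θmax) (hangle : θmax - θmin < Real.pi)
    (hh : 0 < h) (hM : 0 < M) (hδ : 0 < δ) {u : E3 → ℂ} {G : Fin 3 → E3 → ℂ}
    (hu : MemLp u 2 (volume.restrict (wedge θmin θmax h M)))
    (hG : ∀ j, MemLp (G j) 2 (volume.restrict (wedge θmin θmax h M))) {f₁ f₂ : E3 → ℂ}
    {ft₁ ft₂ : ℝ → ℂ} {f₁0 f₂0 : ℂ} (hf₁ : IsFaceProfile θmax h M δ f₁ ft₁ f₁0)
    (hf₂ : IsFaceProfile θmin h M δ f₂ ft₂ f₂0) {c : ℝ} (hc0 : 0 < c)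
    (hflux : ∀ j, HasWeakFlux θmin θmax h M δ (G j) (fun m x => if m = j then u x else 0)
      (fun x => ((-c * obliqueQ θmin θmax (EuclideanSpace.single j 1) : ℝ) : ℂ) * f₁ x)
      (fun x => ((-c * obliqueP θmin θmax (EuclideanSpace.single j 1) : ℝ) : ℂ) * f₂ x)) :
    f₁0 = f₂0 := by
  obtain ⟨ξ, hξ, hsupp, hX⟩ := exists_cutoff hM hδ
  have hι : Complex.I = Complex.I ∨ Complex.I = -Complex.I := Or.inl rfl
  have hs : 0 < Real.sin (θmax - θmin) := Real.sin_pos_of_pos_of_lt_pi (by linarith) hangle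
  set ρ := wedgeRate θmin θmax Complex.I with hρ
  have key := fun (j : Fin 3) (d : ℂ × ℂ) => (hflux j).tendsto hθ hangle hh hM (hG j)
    (memLp_ite hu j) (hf₁.const_mul _) (hf₂.const_mul _) hξ hsupp hι d
  simp only [sum_ite_integral _ (fun j x => expPoly Complex.I (wedgeRate θmin θmax Complex.I)
            (expPolyDeriv Complex.I (wedgeRate θmin θmax Complex.I) _ j) (_ • x))] at key
  -- The test functions are `∂₁E` for the flux of `∂₀u` and `∂₀E` for the flux of `∂₁u`. Both volume
  -- terms are the pairing of `u` with `∂₀∂₁E`, so the two boundary limits must agree.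
  have k0 := key 0 (expPolyDeriv Complex.I ρ (1, 0) 1)
  have k1 := key 1 (expPolyDeriv Complex.I ρ (1, 0) 0)
  have hcomm : expPolyDeriv Complex.I ρ (expPolyDeriv Complex.I ρ (1, 0) 1) 0 =
      expPolyDeriv Complex.I ρ (expPolyDeriv Complex.I ρ (1, 0) 0) 1 := by
    simp [expPolyDeriv]; ring
  rw [← hρ, hcomm] at k0
  have heq := tendsto_nhds_unique k0 k1
  have h1 := mul_left_cancel₀ hX heq
  have hw := wedgeRate_re_pos hθ hangle hι
  have hw1 : ρ * ((Real.cos θmax : ℂ) + Complex.I * Real.sin θmax) ≠ 0 := fun h0 => by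
    have := hw.1; rw [← hρ, h0] at this; simp at this
  have hw2 : ρ * ((Real.cos θmin : ℂ) + Complex.I * Real.sin θmin) ≠ 0 := fun h0 => by
    have := hw.2; rw [← hρ, h0] at this; simp at this
  have hρ0 := left_ne_zero_of_mul hw1
  have hε1 := right_ne_zero_of_mul hw1
  have hε2 := right_ne_zero_of_mul hw2
  have hsC : (Real.sin (θmax - θmin) : ℂ) ≠ 0 := Complex.ofReal_ne_zero.2 hs.ne'
  have hcC : (c : ℂ) ≠ 0 := Complex.ofReal_ne_zero.2 hc0.ne'
  have p0 : obliqueP θmin θmax (EuclideanSpace.single 0 1) =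
      -(Real.sin θmin / Real.sin (θmax - θmin)) := by rw [obliqueP_apply]; simp; ring
  have p1 : obliqueP θmin θmax (EuclideanSpace.single 1 1) =
      Real.cos θmin / Real.sin (θmax - θmin) := by rw [obliqueP_apply]; simp; ring
  have q0 : obliqueQ θmin θmax (EuclideanSpace.single 0 1) =
      Real.sin θmax / Real.sin (θmax - θmin) := by rw [obliqueQ_apply]; simp; ring
  have q1 : obliqueQ θmin θmax (EuclideanSpace.single 1 1) =
      -(Real.cos θmax / Real.sin (θmax - θmin)) := by rw [obliqueQ_apply]; simp; ring
  simp only [rayIntegral, expPolyDeriv, p0, p1, q0, q1, Matrix.cons_val_zero,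
    Matrix.cons_val_one, ← hρ, mul_one, mul_zero, neg_zero, zero_mul, zero_div, add_zero,
    zero_sub] at h1
  push_cast at h1 hw1 hw2 hε1 hε2 hsC
  generalize Complex.sin ((θmax : ℂ) - θmin) = S at h1 hsC
  generalize Complex.cos (θmax : ℂ) = C1 at h1 hw1 hε1
  generalize Complex.sin (θmax : ℂ) = S1 at h1 hw1 hε1
  generalize Complex.cos (θmin : ℂ) = C2 at h1 hw2 hε2
  generalize Complex.sin (θmin : ℂ) = S2 at h1 hw2 hε2
  -- On each face this combination of normal components is the tangential derivative of `E`, whose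
  -- integral along the ray is `-E(0) = -1`. The two faces enter with opposite orientation.
  have e1 : -(c : ℂ) * (S1 / S) * f₁0 * (-(ρ * Complex.I) / (ρ * (C1 + Complex.I * S1)))
      - -(c : ℂ) * -(C1 / S) * f₁0 * (-ρ / (ρ * (C1 + Complex.I * S1))) = c / S * f₁0 := by
    obtain ⟨E, hE⟩ : ∃ E, C1 + Complex.I * S1 = E := ⟨_, rfl⟩
    rw [hE] at hε1 ⊢
    rw [show C1 = E - Complex.I * S1 by linear_combination hE]
    field_simp
    ring
  have e2 : -(c : ℂ) * -(S2 / S) * f₂0 * (-(ρ * Complex.I) / (ρ * (C2 + Complex.I * S2)))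
      - -(c : ℂ) * (C2 / S) * f₂0 * (-ρ / (ρ * (C2 + Complex.I * S2))) = -(c / S * f₂0) := by
    obtain ⟨E, hE⟩ : ∃ E, C2 + Complex.I * S2 = E := ⟨_, rfl⟩
    rw [hE] at hε2 ⊢
    rw [show C2 = E - Complex.I * S2 by linear_combination hE]
    field_simp
    ring
  have h3 : (c : ℂ) / S * (f₁0 - f₂0) = 0 := by
    linear_combination h1 - e1 - e2
  rcases mul_eq_zero.1 h3 with h4 | h4
  · exact absurd h4 (div_ne_zero hcC hsC)
  · exact sub_eq_zero.1 h4

/-! ### Betti reciprocity with exponential fields. -/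

/-- The stress of a displacement field with components `expPoly ι ρ (c i)`, as coefficients. -/
noncomputable def expPolyStress (lam μ : ℝ) (ι ρ : ℂ) (c : Fin 3 → ℂ × ℂ) (i j : Fin 3) : ℂ × ℂ :=
  (stress lam μ (fun a b => (expPolyDeriv ι ρ (c a) b).1) i j,
    stress lam μ (fun a b => (expPolyDeriv ι ρ (c a) b).2) i j)

theorem expPoly_eq (ι ρ : ℂ) (c : ℂ × ℂ) (x : E3) :
    expPoly ι ρ c x = c.1 * expPoly ι ρ (1, 0) x + c.2 * expPoly ι ρ (0, 1) x := by
  simp only [expPoly]; ring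

theorem integral_mul_expPoly_eq {μ : Measure E3} [IsFiniteMeasure μ] {F ξ : E3 → ℂ}
    (hF : MemLp F 2 μ) (hξ : Continuous ξ) (hc : HasCompactSupport ξ) (ι ρ : ℂ) (c : ℂ × ℂ)
    (s : ℝ) : ∫ x, F x * ξ x * expPoly ι ρ c (s • x) ∂μ =
      c.1 * ∫ x, F x * ξ x * expPoly ι ρ (1, 0) (s • x) ∂μ
        + c.2 * ∫ x, F x * ξ x * expPoly ι ρ (0, 1) (s • x) ∂μ := by
  rw [← integral_const_mul, ← integral_const_mul, ← integral_add
    ((integrable_mul_expPoly hF hξ hc ι ρ _ s).const_mul _)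
    ((integrable_mul_expPoly hF hξ hc ι ρ _ s).const_mul _)]
  congr 1 with x
  rw [expPoly_eq ι ρ c]
  ring

theorem integral_stress_mul {ν : Measure E3} {G : E3 → Fin 3 → Fin 3 → ℂ} {K : E3 → ℂ}
    (hG : ∀ i j, Integrable (fun x => G x i j * K x) ν) (lam μ : ℝ) (i j : Fin 3) :
    ∫ x, stress lam μ (G x) i j * K x ∂ν =
      stress lam μ (fun a b => ∫ x, G x a b * K x ∂ν) i j := by
  unfold stress
  rw [← integral_finsetSum _ fun k _ => hG k k, ← integral_const_mul, ← integral_mul_const,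
    ← integral_add (hG i j) (hG j i), ← integral_const_mul, ← integral_add]
  · congr 1 with x
    rw [← Finset.sum_mul]
    ring
  · exact (((integrable_finsetSum _ fun k _ => hG k k).const_mul _).mul_const _)
  · exact ((hG i j).add (hG j i)).const_mul _

/-- This is the major symmetry of the isotropic elasticity tensor, the algebraic content of Betti's
theorem. -/
theorem sum_stress_symm (lam μ : ℝ) (A B : Fin 3 → Fin 3 → ℂ) :
    ∑ i, ∑ j, stress lam μ A i j * B i j = ∑ i, ∑ j, A i j * stress lam μ B i j := by
  simp only [stress, Fin.sum_univ_three]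
  simp
  ring

/-- The leading terms of the traction jumps are orthogonal to every static exponential solution. -/
theorem sum_traction_eq_zero {lam μ : ℝ} (hθ : θmin < θmax) (hangle : θmax - θmin < Real.pi)
    (hh : 0 < h) (hM : 0 < M) (hδ : 0 < δ)
    {A u : Fin 3 → E3 → ℂ} {G : E3 → Fin 3 → Fin 3 → ℂ}
    (hA : ∀ i, MemLp (A i) 2 (volume.restrict (wedge θmin θmax h M)))
    (hu : ∀ i, MemLp (u i) 2 (volume.restrict (wedge θmin θmax h M)))
    (hG : ∀ i j, MemLp (fun x => G x i j) 2 (volume.restrict (wedge θmin θmax h M)))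
    {g₁ g₂ f₁ f₂ : Fin 3 → E3 → ℂ} {gt₁ gt₂ ft₁ ft₂ : Fin 3 → ℝ → ℂ} {g₁0 g₂0 : Fin 3 → ℂ}
    (hg₁ : ∀ i, IsFaceProfile θmax h M δ (g₁ i) (gt₁ i) (g₁0 i))
    (hg₂ : ∀ i, IsFaceProfile θmin h M δ (g₂ i) (gt₂ i) (g₂0 i))
    (hf₁ : ∀ i, IsFaceProfile θmax h M δ (f₁ i) (ft₁ i) 0)
    (hf₂ : ∀ i, IsFaceProfile θmin h M δ (f₂ i) (ft₂ i) 0)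
    (hδh : δ < h)
    (hf₁o : ∀ i, Tendsto (fun r : ℝ => ft₁ i r / r) (𝓝[>] 0) (𝓝 0))
    (hf₂o : ∀ i, Tendsto (fun r : ℝ => ft₂ i r / r) (𝓝[>] 0) (𝓝 0))
    {Np Nm : Fin 3 → ℂ}
    (htrac : ∀ i, HasWeakFlux θmin θmax h M δ (A i) (fun j x => stress lam μ (G x) i j)
      (g₁ i) (g₂ i))
    (htr : ∀ i j, HasWeakFlux θmin θmax h M δ (fun x => G x i j)
      (fun m x => if m = j then u i x else 0)
      (fun x => Np j * f₁ i x) (fun x => Nm j * f₂ i x))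
    {ι : ℂ} (hι : ι = Complex.I ∨ ι = -Complex.I) (c : Fin 3 → ℂ × ℂ)
    (hc : ∀ i, ∑ j, expPolyDeriv ι (wedgeRate θmin θmax ι)
      (expPolyStress lam μ ι (wedgeRate θmin θmax ι) c i j) j = 0) :
    ∑ i, (g₁0 i * rayIntegral ι (wedgeRate θmin θmax ι) θmax (c i)
      + g₂0 i * rayIntegral ι (wedgeRate θmin θmax ι) θmin (c i)) = 0 := by
  have hfin := isFiniteMeasure_wedge (M := M) hθ hangle hh
  obtain ⟨ξ, hξ, hsupp, hX⟩ := exists_cutoff hM hδ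
  have hcs := hasCompactSupport_of_subset_ball hsupp
  obtain ⟨hw1, hw2⟩ := wedgeRate_re_pos hθ hangle hι
  -- Because the edge values of the traces are zero, `u` pairs with a dilated first derivative to
  -- `o(s⁻²)`, one order better than the `L²` estimate. The cutoff `η` is left free so that
  -- derivatives of `ξ` can be inserted.
  have hsmall := fun i l (η : E3 → ℂ) (hη : ContDiff ℝ ∞ η) (hηs : tsupport η ⊆ Metric.ball 0 δ) d =>
    (htr i l).tendsto hθ hangle hh hM (hG i l) (memLp_ite (hu i) l) ((hf₁ i).const_mul (Np l))
      ((hf₂ i).const_mul (Nm l)) hη hηs hι d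
  have hmain := fun i => (htrac i).tendsto hθ hangle hh hM (hA i) (fun j => by
      unfold stress
      exact ((memLp_finsetSum _ fun k _ => hG k k).const_mul _).mul_const _ |>.add
        (((hG i j).add (hG j i)).const_mul _)) (hg₁ i) (hg₂ i) hξ hsupp hι (c i)
  have hid := fun i j s => (htr i j).expPoly_identity hθ hangle hh (hG i j) (memLp_ite (hu i) j)
    hξ hsupp ι (wedgeRate θmin θmax ι) (expPolyStress lam μ ι (wedgeRate θmin θmax ι) c i j) s
  set ρ := wedgeRate θmin θmax ι with hρ
  set W := wedge θmin θmax h M with hW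
  set S := expPolyStress lam μ ι ρ c with hS
  simp only [sum_ite_integral _ (fun j x => expPoly ι ρ (expPolyDeriv ι ρ _ j) (_ • x)), mul_zero,
    zero_mul, add_zero] at hsmall
  simp only [sum_ite_integral _ (fun j x => expPoly ι ρ (expPolyDeriv ι ρ _ j) (_ • x))] at hid
  -- the displacement terms
  have hdξ : ∀ j, ContDiff ℝ ∞ fun x => fderiv ℝ ξ x (EuclideanSpace.single j 1) := fun j =>
    (hξ.fderiv_right (m := ∞) (by simp)).clm_apply contDiff_const
  have hdξs : ∀ j, tsupport (fun x => fderiv ℝ ξ x (EuclideanSpace.single j 1)) ⊆ Metric.ball 0 δ :=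
    fun j => (tsupport_fderiv_apply_subset ℝ _).trans hsupp
  have hu0 : ∀ i j, Tendsto (fun s : ℝ => (s : ℂ) ^ 2 * ∫ x in W,
      u i x * fderiv ℝ ξ x (EuclideanSpace.single j 1) * expPoly ι ρ (S i j) (s • x))
      atTop (𝓝 0) := by
    intro i j
    have hsm := fun l d => hsmall i l _ (hdξ j) (hdξs j) d
    have hlin := fun d s => integral_mul_expPoly_eq (hu i) (hdξ j).continuous
      (hasCompactSupport_of_subset_ball (hdξs j)) ι ρ d s
    -- The stress of the test field is a linear combination of first derivatives of its components,
    -- so the improved estimate with `η = ∂ⱼξ` applies to it.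
    have hcomb : Tendsto (fun s : ℝ => (lam : ℂ) * (∑ k, (s : ℂ) ^ 2 * ∫ x in W,
        u i x * fderiv ℝ ξ x (EuclideanSpace.single j 1) *
          expPoly ι ρ (expPolyDeriv ι ρ (c k) k) (s • x)) * (if i = j then 1 else 0)
        + (μ : ℂ) * ((s : ℂ) ^ 2 * (∫ x in W,
        u i x * fderiv ℝ ξ x (EuclideanSpace.single j 1) *
          expPoly ι ρ (expPolyDeriv ι ρ (c i) j) (s • x)) + (s : ℂ) ^ 2 * ∫ x in W,
        u i x * fderiv ℝ ξ x (EuclideanSpace.single j 1) *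
          expPoly ι ρ (expPolyDeriv ι ρ (c j) i) (s • x))) atTop
        (𝓝 ((lam : ℂ) * (∑ _k : Fin 3, 0) * (if i = j then 1 else 0) + (μ : ℂ) * (0 + 0))) :=
      (((tendsto_finsetSum _ fun k _ => hsm k (c k)).const_mul _).mul_const _).add
        (((hsm j (c i)).add (hsm i (c j))).const_mul _)
    simp only [Finset.sum_const_zero, mul_zero, zero_mul, add_zero] at hcomb
    refine hcomb.congr fun s => ?_
    rw [hlin (S i j)]
    simp only [hlin (expPolyDeriv ι ρ _ _), hS, expPolyStress, stress, Fin.sum_univ_three]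
    ring
  -- Static equilibrium removes the term in which the divergence hits the stress; after
  -- multiplication by `s²` it would carry the factor `s³`.
  have hdiv0 : ∀ i (s : ℝ), ∑ j, ∫ x in W, u i x * ξ x * expPoly ι ρ (expPolyDeriv ι ρ (S i j) j) (s • x)
      = 0 := by
    intro i s
    have hlin := fun d => integral_mul_expPoly_eq (hu i) hξ.continuous hcs ι ρ d s
    have h1 := congrArg Prod.fst (hc i)
    have h2 := congrArg Prod.snd (hc i)
    rw [Prod.fst_sum] at h1
    rw [Prod.snd_sum] at h2
    simp only [hlin (expPolyDeriv ι ρ _ _)]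
    rw [Finset.sum_add_distrib, ← Finset.sum_mul, ← Finset.sum_mul, h1, h2]
    simp
  have hGS : ∀ i, Tendsto (fun s : ℝ => (s : ℂ) ^ 2 * ∑ j, ∫ x in W,
      G x i j * ξ x * expPoly ι ρ (S i j) (s • x)) atTop (𝓝 0) := by
    intro i
    have t1 : ∀ j, Tendsto (fun s : ℝ => (s : ℂ) ^ 2 * ∫ x, Np j * f₁ i x * (ξ x * expPoly ι ρ (S i j)
        (s • x)) ∂faceMeasure θmax h M) atTop (𝓝 0) := by
      intro j
      obtain ⟨C, hC0, hC⟩ := exists_bound_of_tendsto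
        ((hf₁ i).cont.div Complex.continuous_ofReal.continuousOn fun r hr =>
          Complex.ofReal_ne_zero.2 hr.1.ne') (hf₁o i) hδh
      have := (tendsto_sq_mul_integral_face hh (hf₁ i) hC0 hC (hf₁o i) hξ.continuous hsupp hw1
        (S i j)).const_mul (Np j)
      rw [mul_zero] at this
      refine this.congr fun s => ?_
      simp only [mul_assoc]
      rw [integral_const_mul]
      ring
    have t2 : ∀ j, Tendsto (fun s : ℝ => (s : ℂ) ^ 2 * ∫ x, Nm j * f₂ i x * (ξ x * expPoly ι ρ (S i j)
        (s • x)) ∂faceMeasure θmin h M) atTop (𝓝 0) := by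
      intro j
      obtain ⟨C, hC0, hC⟩ := exists_bound_of_tendsto
        ((hf₂ i).cont.div Complex.continuous_ofReal.continuousOn fun r hr =>
          Complex.ofReal_ne_zero.2 hr.1.ne') (hf₂o i) hδh
      have := (tendsto_sq_mul_integral_face hh (hf₂ i) hC0 hC (hf₂o i) hξ.continuous hsupp hw2
        (S i j)).const_mul (Nm j)
      rw [mul_zero] at this
      refine this.congr fun s => ?_
      simp only [mul_assoc]
      rw [integral_const_mul]
      ring
    have t3 := tendsto_finsetSum (Finset.univ : Finset (Fin 3)) fun j _ =>
      ((t1 j).add (t2 j)).sub (hu0 i j)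
    simp only [add_zero, sub_zero, Finset.sum_const_zero] at t3
    refine t3.congr fun s => ?_
    have hsum : ∑ j, ∫ x in W, u i x * ξ x * expPoly ι ρ (expPolyDeriv ι ρ (S i j) j) (s • x) = 0 :=
      hdiv0 i s
    have h1 : ∀ j, (s : ℂ) ^ 2 * (∫ x, Np j * f₁ i x * (ξ x * expPoly ι ρ (S i j)
        (s • x)) ∂faceMeasure θmax h M) + (s : ℂ) ^ 2 * (∫ x, Nm j * f₂ i x * (ξ x *
        expPoly ι ρ (S i j) (s • x)) ∂faceMeasure θmin h M) - (s : ℂ) ^ 2 * (∫ x in W,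
        u i x * fderiv ℝ ξ x (EuclideanSpace.single j 1) * expPoly ι ρ (S i j) (s • x)) =
        (s : ℂ) ^ 2 * (∫ x in W, G x i j * ξ x * expPoly ι ρ (S i j) (s • x)) + (s : ℂ) ^ 3 *
        ∫ x in W, u i x * ξ x * expPoly ι ρ (expPolyDeriv ι ρ (S i j) j) (s • x) := by
      intro j
      have h2 := hid i j s
      have h3 : ∑ m, ∫ x in W, (if m = j then u i x else 0) *
          fderiv ℝ ξ x (EuclideanSpace.single m 1) * expPoly ι ρ (S i j) (s • x) =
          ∫ x in W, u i x * fderiv ℝ ξ x (EuclideanSpace.single j 1) *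
            expPoly ι ρ (S i j) (s • x) := by
        rw [Finset.sum_eq_single j]
        · simp
        · intro m _ hm
          simp [hm]
        · simp
      rw [h3] at h2
      linear_combination (-(s : ℂ) ^ 2) * h2
    rw [Finset.sum_congr rfl fun j _ => h1 j, Finset.sum_add_distrib, ← Finset.mul_sum,
      ← Finset.mul_sum, hsum, mul_zero, add_zero]
  -- symmetry of the elasticity tensor
  have hsymm : ∀ s : ℝ, ∑ i, ∑ j, ∫ x in W, stress lam μ (G x) i j * ξ x *
      expPoly ι ρ (expPolyDeriv ι ρ (c i) j) (s • x) =
      ∑ i, ∑ j, ∫ x in W, G x i j * ξ x * expPoly ι ρ (S i j) (s • x) := by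
    intro s
    have hlinG := fun i j d => integral_mul_expPoly_eq (hG i j) hξ.continuous hcs ι ρ d s
    have hst : ∀ i j d, ∫ x in W, stress lam μ (G x) i j * ξ x * expPoly ι ρ d (s • x) =
        stress lam μ (fun a b => ∫ x in W, G x a b * ξ x * expPoly ι ρ d (s • x)) i j := by
      intro i j d
      have := integral_stress_mul (ν := volume.restrict W) (G := G)
        (K := fun x => ξ x * expPoly ι ρ d (s • x)) (fun a b => by
          simpa only [mul_assoc] using integrable_mul_expPoly (hG a b) hξ.continuous hcs ι ρ d s)
        lam μ i j
      simpa only [mul_assoc] using this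
    have hst2 : ∀ i j d, ∫ x in W, stress lam μ (G x) i j * ξ x * expPoly ι ρ d (s • x) =
        stress lam μ (fun a b => ∫ x in W, G x a b * ξ x * expPoly ι ρ (1, 0) (s • x)) i j * d.1
        + stress lam μ (fun a b => ∫ x in W, G x a b * ξ x * expPoly ι ρ (0, 1) (s • x)) i j
          * d.2 := by
      intro i j d
      rw [hst]
      simp only [hlinG _ _ d, stress, Fin.sum_univ_three]
      ring
    simp only [hst2]
    simp only [hlinG _ _ (S _ _)]
    simp only [Finset.sum_add_distrib]
    rw [sum_stress_symm, sum_stress_symm]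
    simp only [hS, expPolyStress]
    congr 1 <;> exact Finset.sum_congr rfl fun i _ => Finset.sum_congr rfl fun j _ => mul_comm _ _
  -- By reciprocity the same quantity has two limits: the traction pairing times the edge integral
  -- of `ξ`, and zero. The edge integral is nonzero and cancels.
  have l1 := tendsto_finsetSum (Finset.univ : Finset (Fin 3)) fun i _ => hmain i
  have l2 := tendsto_finsetSum (Finset.univ : Finset (Fin 3)) fun i _ => hGS i
  have l3 := tendsto_nhds_unique l1 (l2.congr fun s => by
    rw [← Finset.mul_sum, ← Finset.mul_sum, hsymm])
  rw [← Finset.mul_sum, Finset.sum_const_zero] at l3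
  exact (mul_eq_zero.1 l3).resolve_left hX

/-! ### Static exponential solutions and the linear system for the edge tractions. -/

theorem sq_eq_neg_one {ι : ℂ} (hι : ι = Complex.I ∨ ι = -Complex.I) : ι ^ 2 = -1 := by
  rcases hι with rfl | rfl <;> simp

/-- Antiplane exponential solutions. -/
theorem expPolyStress_antiplane (lam μ : ℝ) {ι : ℂ} (hι2 : ι ^ 2 = -1) (ρ : ℂ) (i : Fin 3) :
    ∑ j, expPolyDeriv ι ρ (expPolyStress lam μ ι ρ ![0, 0, (1, 0)] i j) j = 0 := by
  fin_cases i <;> ext <;> simp [Fin.sum_univ_three, expPolyStress, expPolyDeriv, stress]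
  linear_combination (μ : ℂ) * ρ ^ 2 * hι2

/-- Divergence free planar exponential solutions. -/
theorem expPolyStress_planar (lam μ : ℝ) {ι : ℂ} (hι2 : ι ^ 2 = -1) (ρ : ℂ) (i : Fin 3) :
    ∑ j, expPolyDeriv ι ρ (expPolyStress lam μ ι ρ ![(1, 0), (ι, 0), 0] i j) j = 0 := by
  fin_cases i <;> ext <;> simp [Fin.sum_univ_three, expPolyStress, expPolyDeriv, stress]
  · linear_combination (lam + 2 * μ : ℂ) * ρ ^ 2 * hι2
  · linear_combination (lam + 2 * μ : ℂ) * ι * ρ ^ 2 * hι2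

/-- Planar polynomial-exponential solutions of Kolosov type. -/
theorem expPolyStress_kolosov (lam μ : ℝ) {ι : ℂ} (hι2 : ι ^ 2 = -1) (ρ : ℂ) (i : Fin 3) :
    ∑ j, expPolyDeriv ι ρ (expPolyStress lam μ ι ρ
      ![((lam : ℂ) + 3 * μ, ρ * (lam + μ)), (-(ι * (lam + 3 * μ)), ι * (ρ * (lam + μ))), 0] i j) j
      = 0 := by
  -- The ratio of `lam + 3 μ` to `lam + μ` is Kolosov's constant of plane strain, with the
  -- denominator cleared; the equilibrium equations then hold modulo `ι² = -1`.
  fin_cases i <;> ext <;> simp [Fin.sum_univ_three, expPolyStress, expPolyDeriv, stress]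
  · linear_combination (-lam ^ 2 - lam * μ + 2 * μ ^ 2 : ℂ) * ρ ^ 2 * hι2
  · linear_combination (lam + 2 * μ : ℂ) * (lam + μ) * ρ ^ 3 * hι2
  · linear_combination (lam ^ 2 + lam * μ - 2 * μ ^ 2 : ℂ) * ι * ρ ^ 2 * hι2
  · linear_combination (lam + 2 * μ : ℂ) * (lam + μ) * ι * ρ ^ 3 * hι2

/-- The system has determinant `F² - E²`. It describes the antiplane components, with `E` and `F`
the unit complex numbers of the two faces. -/
theorem eq_zero_of_conj_rays {a b E F : ℂ} (hEF : E ^ 2 ≠ F ^ 2)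
    (h₁ : a * F + b * E = 0) (h₂ : a * E + b * F = 0) : a = 0 ∧ b = 0 := by
  have hne : E ^ 2 - F ^ 2 ≠ 0 := sub_ne_zero.2 hEF
  have ha : (E ^ 2 - F ^ 2) * a = 0 := by linear_combination E * h₂ - F * h₁
  have hb : (E ^ 2 - F ^ 2) * b = 0 := by linear_combination E * h₁ - F * h₂
  exact ⟨(mul_eq_zero.1 ha).resolve_left hne, (mul_eq_zero.1 hb).resolve_left hne⟩

/-- The unknowns stand for `g₀ ± i g₁` on the two faces. The divergence free solutions eliminate
`x₂` and `y₂`; the Kolosov solutions then form a symmetric system in `x₁` and `y₁ E²` with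
determinant `±(k² - l²)`. -/
theorem eq_zero_of_kolosov {x₁ x₂ y₁ y₂ E F k l : ℂ} (hE : E ≠ 0) (hF : F ≠ 0)
    (hEF : E ^ 2 ≠ F ^ 2) (hkl : k ^ 2 ≠ l ^ 2)
    (hx : x₁ * F + x₂ * E = 0) (hy : y₁ * E + y₂ * F = 0)
    (hxy : k * (y₁ * E ^ 2 * F ^ 3 + y₂ * F ^ 2 * E ^ 3) + l * (x₁ * F ^ 3 + x₂ * E ^ 3) = 0)
    (hyx : k * (x₁ * E + x₂ * F) + l * (y₁ * E ^ 3 + y₂ * F ^ 3) = 0) :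
    x₁ = 0 ∧ x₂ = 0 ∧ y₁ = 0 ∧ y₂ = 0 := by
  have hne : E ^ 2 - F ^ 2 ≠ 0 := sub_ne_zero.2 hEF
  have hkl' : k ^ 2 - l ^ 2 ≠ 0 := sub_ne_zero.2 hkl
  have h1 : (E ^ 2 - F ^ 2) * F * (k * (y₁ * E ^ 2) + l * x₁) = 0 := by
    linear_combination (-1 : ℂ) * hxy + k * E ^ 3 * F * hy + l * E ^ 2 * hx
  have h2 : (E ^ 2 - F ^ 2) * (k * x₁ + l * (y₁ * E ^ 2)) = 0 := by
    linear_combination E * hyx - k * F * hx - l * E * F ^ 2 * hy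
  have h3 := (mul_eq_zero.1 h1).resolve_left (mul_ne_zero hne hF)
  have h4 := (mul_eq_zero.1 h2).resolve_left hne
  have hx1 : x₁ = 0 := by
    have : (k ^ 2 - l ^ 2) * x₁ = 0 := by linear_combination k * h4 - l * h3
    exact (mul_eq_zero.1 this).resolve_left hkl'
  have hy1 : y₁ = 0 := by
    have : (k ^ 2 - l ^ 2) * (E ^ 2 * y₁) = 0 := by linear_combination k * h3 - l * h4
    exact (mul_eq_zero.1 ((mul_eq_zero.1 this).resolve_left hkl')).resolve_left (pow_ne_zero 2 hE)
  refine ⟨hx1, ?_, hy1, ?_⟩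
  · rw [hx1, zero_mul, zero_add] at hx
    exact (mul_eq_zero.1 hx).resolve_right hE
  · rw [hy1, zero_mul, zero_add] at hy
    exact (mul_eq_zero.1 hy).resolve_right hF

/-- Equality of the squares would mean `exp (2 i (a - b)) = 1`, that is, parallel rays. -/
theorem eulerPoint_sq_ne {a b : ℝ} (h : Real.sin (a - b) ≠ 0) :
    ((Real.cos a : ℂ) + Complex.I * Real.sin a) ^ 2
      ≠ ((Real.cos b : ℂ) + Complex.I * Real.sin b) ^ 2 := by
  intro heq
  have hI : Complex.I ^ 2 = -1 := Complex.I_sq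
  have ha := ne_zero_of_unit hI a
  have hb := ne_zero_of_unit hI b
  have hkey : 2 * Complex.I * (Real.sin (a - b) : ℂ) = 0 := by
    have h1 : ((Real.cos a : ℂ) + Complex.I * Real.sin a) * (Real.cos b - Complex.I * Real.sin b)
        - (Real.cos a - Complex.I * Real.sin a) * (Real.cos b + Complex.I * Real.sin b)
        = 2 * Complex.I * (Real.sin (a - b) : ℂ) := by
      rw [Real.sin_sub]; push_cast; ring
    rw [← h1]
    linear_combination (Real.cos a - Complex.I * Real.sin a : ℂ) *
      (Real.cos b - Complex.I * Real.sin b) * heq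
      - ((Real.cos a : ℂ) + Complex.I * Real.sin a) * (Real.cos b - Complex.I * Real.sin b) * ha
      + ((Real.cos a : ℂ) - Complex.I * Real.sin a) * (Real.cos b + Complex.I * Real.sin b) * hb
  have : (Real.sin (a - b) : ℂ) = 0 := by
    rcases mul_eq_zero.1 hkey with h0 | h0
    · simp at h0
    · exact h0
  exact h (Complex.ofReal_eq_zero.1 this)

/-- The ray orthogonality relations force both tractions to vanish at the edge. -/
theorem traction_eq_zero {lam μ : ℝ} (hμ : 0 < μ) (hconv : 0 < 2 * μ + 3 * lam)
    (hθ : θmin < θmax) (hangle : θmax - θmin < Real.pi) {g₁ g₂ : Fin 3 → ℂ}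
    (hg : ∀ ι : ℂ, (ι = Complex.I ∨ ι = -Complex.I) → ∀ c : Fin 3 → ℂ × ℂ,
      (∀ i, ∑ j, expPolyDeriv ι (wedgeRate θmin θmax ι)
        (expPolyStress lam μ ι (wedgeRate θmin θmax ι) c i j) j = 0) →
      ∑ i, (g₁ i * rayIntegral ι (wedgeRate θmin θmax ι) θmax (c i)
        + g₂ i * rayIntegral ι (wedgeRate θmin θmax ι) θmin (c i)) = 0) :
    g₁ = 0 ∧ g₂ = 0 := by
  have hs : Real.sin (θmax - θmin) ≠ 0 :=
    (Real.sin_pos_of_pos_of_lt_pi (by linarith) hangle).ne'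
  set E : ℂ := (Real.cos θmax : ℂ) + Complex.I * Real.sin θmax with hE
  set E' : ℂ := (Real.cos θmax : ℂ) - Complex.I * Real.sin θmax with hE'
  set F : ℂ := (Real.cos θmin : ℂ) + Complex.I * Real.sin θmin with hF
  set F' : ℂ := (Real.cos θmin : ℂ) - Complex.I * Real.sin θmin with hF'
  have hI : Complex.I ^ 2 = -1 := Complex.I_sq
  have hEE : E * E' = 1 := ne_zero_of_unit hI θmax
  have hFF : F * F' = 1 := ne_zero_of_unit hI θmin
  have hE0 : E ≠ 0 := left_ne_zero_of_mul_eq_one hEE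
  have hF0 : F ≠ 0 := left_ne_zero_of_mul_eq_one hFF
  have hEF : E ^ 2 ≠ F ^ 2 := eulerPoint_sq_ne hs
  have hE'v : E' = E⁻¹ := eq_inv_of_mul_eq_one_right hEE
  have hF'v : F' = F⁻¹ := eq_inv_of_mul_eq_one_right hFF
  have hr : ∀ ι : ℂ, (ι = Complex.I ∨ ι = -Complex.I) → wedgeRate θmin θmax ι ≠ 0 := by
    intro ι hι h0
    have := (wedgeRate_re_pos hθ hangle hι).1
    rw [h0] at this
    simp at this
  have hι1 : Complex.I = Complex.I ∨ Complex.I = -Complex.I := Or.inl rfl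
  have hι2 : -Complex.I = Complex.I ∨ -Complex.I = -Complex.I := Or.inr rfl
  have hp : ∀ θ : ℝ, (Real.cos θ : ℂ) + -Complex.I * Real.sin θ
      = Real.cos θ - Complex.I * Real.sin θ := fun θ => by ring
  have hm : ∀ θ : ℝ, (Real.cos θ : ℂ) - -Complex.I * Real.sin θ
      = Real.cos θ + Complex.I * Real.sin θ := fun θ => by ring
  have a1 := hg _ hι1 _ (expPolyStress_antiplane lam μ (sq_eq_neg_one hι1) _)
  have a2 := hg _ hι2 _ (expPolyStress_antiplane lam μ (sq_eq_neg_one hι2) _)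
  have b1 := hg _ hι1 _ (expPolyStress_planar lam μ (sq_eq_neg_one hι1) _)
  have b2 := hg _ hι2 _ (expPolyStress_planar lam μ (sq_eq_neg_one hι2) _)
  have c1 := hg _ hι1 _ (expPolyStress_kolosov lam μ (sq_eq_neg_one hι1) _)
  have c2 := hg _ hι2 _ (expPolyStress_kolosov lam μ (sq_eq_neg_one hι2) _)
  have r1 := hr _ hι1
  have r2 := hr _ hι2
  clear hg hr
  -- The equations are homogeneous in the rate: it matters only that it is nonzero, and clearing
  -- denominators cancels it.
  generalize wedgeRate θmin θmax Complex.I = ρ at a1 b1 c1 r1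
  generalize wedgeRate θmin θmax (-Complex.I) = ρ' at a2 b2 c2 r2
  simp only [rayIntegral, hp, hm, ← hE, ← hE', ← hF, ← hF', hE'v, hF'v, Fin.sum_univ_three,
    Matrix.cons_val_zero, Matrix.cons_val_one, Matrix.cons_val, Prod.fst_zero, Prod.snd_zero,
    zero_mul, zero_div, mul_zero, add_zero, zero_add] at a1 a2 b1 b2 c1 c2
  field_simp at a1 a2 b1 b2 c1 c2
  -- The difference of the squares is `4 μ (lam + 2 μ)`, positive by the convexity conditions.
  have hkl : ((lam : ℂ) + 3 * μ) ^ 2 ≠ ((lam : ℂ) + μ) ^ 2 := by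
    have hne : (lam + 3 * μ) ^ 2 ≠ (lam + μ) ^ 2 := by
      have : 0 < 4 * μ * (lam + 2 * μ) := mul_pos (by linarith) (by linarith)
      intro h
      nlinarith
    exact_mod_cast hne
  obtain ⟨ha, hb⟩ := eq_zero_of_conj_rays hEF (a := g₁ 2) (b := g₂ 2)
    (by linear_combination a1) (by linear_combination a2)
  obtain ⟨x1, x2, y1, y2⟩ := eq_zero_of_kolosov (x₁ := g₁ 0 + Complex.I * g₁ 1)
    (x₂ := g₂ 0 + Complex.I * g₂ 1) (y₁ := g₁ 0 - Complex.I * g₁ 1)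
    (y₂ := g₂ 0 - Complex.I * g₂ 1) hE0 hF0 hEF hkl
    (by linear_combination b1) (by linear_combination b2)
    (by linear_combination c1) (by linear_combination c2)
  have hzero : ∀ a b : ℂ, a + Complex.I * b = 0 → a - Complex.I * b = 0 → a = 0 ∧ b = 0 := by
    intro a b h₁ h₂
    exact ⟨by linear_combination (h₁ + h₂) / 2,
      by linear_combination (-Complex.I / 2) * (h₁ - h₂) + b * hI⟩
  constructor <;> funext i <;> fin_cases i
  exacts [(hzero _ _ x1 y1).1, (hzero _ _ x1 y1).2, ha, (hzero _ _ x2 y2).1, (hzero _ _ x2 y2).2,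
    hb]

/-! ### From the regularity hypotheses to the theorem. -/

theorem IsC1Holder.continuousOn {α : ℝ≥0} {s : Set E3} {f : E3 → Fin 3 → ℂ}
    (hf : IsC1Holder α s f) : ContinuousOn f s := by
  obtain ⟨Df, hD, -⟩ := hf
  exact fun x hx => (hD x hx).continuousWithinAt

theorem IsHolder.continuousOn {β : ℝ≥0} (hβ : 0 < β) {s : Set E3} {g : E3 → Fin 3 → ℂ}
    (hg : IsHolder β s g) : ContinuousOn g s := by
  obtain ⟨C, hC⟩ := hg
  exact hC.continuousOn hβ

theorem isFaceProfile_sub_edge_value {θ : ℝ} (hh : 0 < h) (hM : 0 < M) (hδh : δ < h)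
    {k : E3 → Fin 3 → ℂ} (hk : ContinuousOn k (face θ h M)) (hind : IndepOfX3 (face θ h M) k)
    (i : Fin 3) :
    IsFaceProfile θ h M δ (fun x => k x i - k 0 i)
      (fun r => k (facePoint θ (r, 0)) i - k 0 i) 0 := by
  have := isFaceProfile_of_continuousOn (k := fun x => k x - k 0) hh hM hδh
    (hk.sub continuousOn_const) (fun x hx y hy h₀ h₁ => by simp only [hind x hx y hy h₀ h₁]) i
  simpa using this

end EdgeCorner


theorem mainTheorem5
    (lam μ freq : ℝ) (hμ : 0 < μ) (hconv : 0 < 2 * μ + 3 * lam) (hfreq : 0 < freq)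
    (θmin θmax h M : ℝ) (hθmin : -Real.pi < θmin) (hθ : θmin < θmax) (hθmax : θmax < Real.pi)
    (hangle : θmax - θmin < Real.pi) (hh : 0 < h) (hM : 0 < M)
    (α₁ α₂ β₁ β₂ : ℝ≥0)
    (hα₁ : α₁ ∈ Ioo (0 : ℝ≥0) 1) (hα₂ : α₂ ∈ Ioo (0 : ℝ≥0) 1)
    (hβ₁ : β₁ ∈ Ioo (0 : ℝ≥0) 1) (hβ₂ : β₂ ∈ Ioo (0 : ℝ≥0) 1)
    (f₁ f₂ g₁ g₂ : EdgeCorner.E3 → Fin 3 → ℂ)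
    (hf₁ : EdgeCorner.IsC1Holder α₁ (EdgeCorner.face θmax h M) f₁)
    (hf₂ : EdgeCorner.IsC1Holder α₂ (EdgeCorner.face θmin h M) f₂)
    (hg₁ : EdgeCorner.IsHolder β₁ (EdgeCorner.face θmax h M) g₁)
    (hg₂ : EdgeCorner.IsHolder β₂ (EdgeCorner.face θmin h M) g₂)
    (hf₁3 : EdgeCorner.IndepOfX3 (EdgeCorner.face θmax h M) f₁)
    (hf₂3 : EdgeCorner.IndepOfX3 (EdgeCorner.face θmin h M) f₂)
    (hg₁3 : EdgeCorner.IndepOfX3 (EdgeCorner.face θmax h M) g₁)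
    (hg₂3 : EdgeCorner.IndepOfX3 (EdgeCorner.face θmin h M) g₂)
    (v w : EdgeCorner.E3 → Fin 3 → ℂ) (Gv Gw : EdgeCorner.E3 → Fin 3 → Fin 3 → ℂ)
    (hv : EdgeCorner.IsH1 (EdgeCorner.wedge θmin θmax h M) v Gv)
    (hw : EdgeCorner.IsH1 (EdgeCorner.wedge θmin θmax h M) w Gw)
    (hv_eq : EdgeCorner.IsLameSolution lam μ freq (EdgeCorner.wedge θmin θmax h M) v Gv)
    (hw_eq : EdgeCorner.IsLameSolution lam μ freq (EdgeCorner.wedge θmin θmax h M) w Gw)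
    (hdisp₁ : EdgeCorner.HasTraceOnFace (EdgeCorner.wedge θmin θmax h M) θmax h M
      (w - v) (Gw - Gv) f₁)
    (hdisp₂ : EdgeCorner.HasTraceOnFace (EdgeCorner.wedge θmin θmax h M) θmin h M
      (w - v) (Gw - Gv) f₂)
    (htrac₁ : EdgeCorner.HasTractionJumpOnFace lam μ freq (EdgeCorner.wedge θmin θmax h M)
      θmax h M v Gv w Gw g₁)
    (htrac₂ : EdgeCorner.HasTractionJumpOnFace lam μ freq (EdgeCorner.wedge θmin θmax h M)
      θmin h M v Gv w Gw g₂) :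
    f₁ 0 = f₂ 0 ∧
      (EdgeCorner.GradVanishesAtZero (EdgeCorner.face θmax h M) f₁ →
        EdgeCorner.GradVanishesAtZero (EdgeCorner.face θmin h M) f₂ →
        ![g₁ 0 0, g₁ 0 1] =
            (EdgeCorner.Theta (θmax - θmin)).mulVec ![g₂ 0 0, g₂ 0 1] ∧
          g₁ 0 2 = 0 ∧ g₂ 0 2 = 0) := by
  obtain ⟨δ, hδ, hδh, hδM⟩ : ∃ δ : ℝ, 0 < δ ∧ δ < h ∧ δ < M := by
    obtain ⟨δ, hδ, hδm⟩ := exists_between (lt_min hh hM)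
    exact ⟨δ, hδ, hδm.trans_le (min_le_left _ _), hδm.trans_le (min_le_right _ _)⟩
  have hu := fun i => (hw.memLp i).sub (hv.memLp i)
  have hG := fun i j => (hw.memLp_grad i j).sub (hv.memLp_grad i j)
  have hpf₁ := EdgeCorner.isFaceProfile_of_continuousOn hh hM hδh hf₁.continuousOn hf₁3
  have hpf₂ := EdgeCorner.isFaceProfile_of_continuousOn hh hM hδh hf₂.continuousOn hf₂3
  have hpg₁ := EdgeCorner.isFaceProfile_of_continuousOn hh hM hδh (hg₁.continuousOn hβ₁.1) hg₁3
  have hpg₂ := EdgeCorner.isFaceProfile_of_continuousOn hh hM hδh (hg₂.continuousOn hβ₂.1) hg₂3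
  have hedge : f₁ 0 = f₂ 0 := by
    obtain ⟨c, hc, hflux⟩ := EdgeCorner.exists_trace_flux hθ hangle hh hM hδh.le hδM.le
      hu hG hdisp₁ hdisp₂ hpf₁ hpf₂
    funext i
    exact EdgeCorner.trace_eq_at_edge hθ hangle hh hM hδ (hu i) (hG i) (hpf₁ i) (hpf₂ i) hc
      (hflux i)
  refine ⟨hedge, fun hd₁ hd₂ => ?_⟩
  have hfin := EdgeCorner.isFiniteMeasure_wedge (M := M) hθ hangle hh
  -- The common edge value is subtracted so that the displacement data become `o(r)` on both faces;
  -- a single constant suffices thanks to `hedge`. The gradient, hence the stress, is unchanged, so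
  -- the traction flux may keep the unshifted field in its zeroth order term.
  have hus := fun i => (hu i).sub (memLp_const (f₁ 0 i))
  have hps₁ := EdgeCorner.isFaceProfile_sub_edge_value hh hM hδh hf₁.continuousOn hf₁3
  have hps₂ := EdgeCorner.isFaceProfile_sub_edge_value hh hM hδh hf₂.continuousOn hf₂3
  have htrs₂ := EdgeCorner.hasTraceOnFace_sub_const hdisp₂ (f₁ 0)
  rw [hedge] at htrs₂
  obtain ⟨c, -, hflux⟩ := EdgeCorner.exists_trace_flux hθ hangle hh hM hδh.le hδM.le
    hus hG (EdgeCorner.hasTraceOnFace_sub_const hdisp₁ (f₁ 0)) (hedge ▸ htrs₂) hps₁ hps₂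
  obtain ⟨hz₁, hz₂⟩ := EdgeCorner.traction_eq_zero (g₁ := g₁ 0) (g₂ := g₂ 0) hμ hconv hθ hangle
    fun ι hι d hd => EdgeCorner.sum_traction_eq_zero hθ hangle hh hM hδ
      (fun i => (hu i).const_mul (-(freq : ℂ) ^ 2)) hus hG hpg₁ hpg₂ hps₁ hps₂ hδh
      (hd₁.tendsto_div hh hM) (hd₂.tendsto_div hh hM)
      (EdgeCorner.traction_flux hθ hangle hh hM hδh.le hδM.le hv hw htrac₁ htrac₂ hpg₁ hpg₂)
      hflux hι d hd
  -- Both edge tractions are zero, so the relation with `Theta` reads `0 = Θ 0`.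
  rw [hz₁, hz₂]
  simp
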